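/- Consider equations of the form $$u_t+u^n u_x+\alpha(t)u+\beta(t)u_{xxxxx}=0, \qquad (*)$$ where $n\neq 0,1$ is a real constant (in particular any integer $n\ge 2$), $\alpha$ and $\beta$ are smooth real functions of $t$ on a nonempty open interval $I$, and $\beta$ has no zeros. The equation is considered on the domain $t\in I$, $x\in\mathbb R$, with $u\in\mathbb R$ if $n$ is a positive integer and $u>0$ otherwise. A Lie symmetry generator of $(*)$ is a smooth vector field $Q=\tau(t,x,u)\partial_t+\xi(t,x,u)\partial_x+\eta(t,x,u)\partial_u$ on this domain whose fifth prolongation annihilates the left-hand side of $(*)$ at all points of the jet space that satisfy $(*)$. The maximal Lie invariance algebra is the Lie algebra of all Lie symmetry generators. Two equations are point-equivalent if there is a point transformation, i.e. a diffeomorphism between their domains of the variables $(t,x,u)$, whose prolongation to jets maps one equation to the other. For every equation of the form $(*)$ the following are equivalent: (i) the equation admits a three-dimensional Lie symmetry algebra, i.e. there is a three-dimensional real Lie algebra (under the Lie bracket of vector fields) consisting of Lie symmetry generators of the equation; (ii) the Lie symmetry generators of the equation form a Lie algebra of dimension exactly three, i.e. its maximal Lie invariance algebra is three-dimensional; (iii)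 the equation is point-equivalent to a constant-coefficient equation $u_t+u^n u_x+\varepsilon u_{xxxxx}=0$ of the same class, with the same $n$, with a real constant $\varepsilon\neq0$, and with $t$ ranging over some nonempty open interval. -/

import Mathlib

open scoped ContDiff Topology

noncomputable section

namespace FKdV

/-- Partial derivative with respect to `t` of a function of `(t, x)`. -/
def dt (f : ℝ × ℝ → ℝ) (p : ℝ × ℝ) : ℝ := fderiv ℝ f p (1, 0)

/-- Partial derivative with respect to `x` of a function of `(t, x)`. The `k`-th derivative
with respect to `x` is the iterate `dx^[k]`. -/
def dx (f : ℝ × ℝ → ℝ) (p : ℝ × ℝ) : ℝ := fderiv ℝ f p (0, 1)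

/-- The point of the graph of `u` over `p = (t, x)`, in the space of the variables `(t, x, u)`. -/
def graphPt (u : ℝ × ℝ → ℝ) (p : ℝ × ℝ) : ℝ × ℝ × ℝ := (p.1, p.2, u p)

/-- The values of `u` on which `u ^ n` is considered: all real numbers if `n` is a natural number,
and the positive ones for any other real exponent `n`. -/
def uRange (n : ℝ) : Set ℝ := {u | 0 < u ∨ ∃ k : ℕ, n = k}

/-- The equation `u_t + u ^ n * u_x + α(t) * u + β(t) * u_xxxxx = 0`, where `n ≠ 0, 1`, `α` and
`β` are smooth functions on a nonempty open interval `I` and `β` has no zeros. The values of `α`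
and `β` outside `I` play no role. -/
structure Equation where
  n : ℝ
  n_ne_zero : n ≠ 0
  n_ne_one : n ≠ 1
  I : Set ℝ
  isOpen_I : IsOpen I
  isConnected_I : IsConnected I
  α : ℝ → ℝ
  β : ℝ → ℝ
  smooth_α : ContDiffOn ℝ ∞ α I
  smooth_β : ContDiffOn ℝ ∞ β I
  β_ne_zero : ∀ t ∈ I, β t ≠ 0

/-- The domain of the variables `(t, x, u)`. -/
def Equation.dom (E : Equation) : Set (ℝ × ℝ × ℝ) := E.I ×ˢ Set.univ ×ˢ uRange E.n

/-- The left-hand side of the equation, evaluated at the jet of `u` at the point `p = (t, x)`. -/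
def Equation.lhs (E : Equation) (u : ℝ × ℝ → ℝ) (p : ℝ × ℝ) : ℝ :=
  dt u p + u p ^ E.n * dx u p + E.α p.1 * u p + E.β p.1 * dx^[5] u p

/-- The equation is `u_t + u ^ n * u_x + ε * u_xxxxx = 0`, on its interval. -/
def Equation.IsConstantCoeff (E : Equation) (ε : ℝ) : Prop :=
  ∀ t ∈ E.I, E.α t = 0 ∧ E.β t = ε

/-! Vector fields `Q = τ ∂_t + ξ ∂_x + η ∂_u` are maps `(t, x, u) ↦ (τ, ξ, η)`. -/

/-- The coefficient `τ` of `Q` along the graph of `u`. -/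
def tau (Q : ℝ × ℝ × ℝ → ℝ × ℝ × ℝ) (u : ℝ × ℝ → ℝ) (p : ℝ × ℝ) : ℝ := (Q (graphPt u p)).1

/-- The coefficient `ξ` of `Q` along the graph of `u`. -/
def xi (Q : ℝ × ℝ × ℝ → ℝ × ℝ × ℝ) (u : ℝ × ℝ → ℝ) (p : ℝ × ℝ) : ℝ := (Q (graphPt u p)).2.1

/-- The coefficient `η` of `Q` along the graph of `u`. -/
def eta (Q : ℝ × ℝ × ℝ → ℝ × ℝ × ℝ) (u : ℝ × ℝ → ℝ) (p : ℝ × ℝ) : ℝ := (Q (graphPt u p)).2.2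

/-- The characteristic `η - τ * u_t - ξ * u_x` of `Q`, along `u`. Ordinary derivatives of this
function of `(t, x)` are the total derivatives of the characteristic. -/
def chr (Q : ℝ × ℝ × ℝ → ℝ × ℝ × ℝ) (u : ℝ × ℝ → ℝ) (p : ℝ × ℝ) : ℝ :=
  eta Q u p - tau Q u p * dt u p - xi Q u p * dx u p

/-- The coefficient of `∂/∂u_t` in the prolongation of `Q`, at the jet of `u` at `p`. -/
def prolongT (Q : ℝ × ℝ × ℝ → ℝ × ℝ × ℝ) (u : ℝ × ℝ → ℝ) (p : ℝ × ℝ) : ℝ :=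
  dt (chr Q u) p + tau Q u p * dt (dt u) p + xi Q u p * dx (dt u) p

/-- The coefficient of `∂/∂u_{x…x}` (`k` letters `x`) in the prolongation of `Q`, at the jet of
`u` at `p`. -/
def prolongX (k : ℕ) (Q : ℝ × ℝ × ℝ → ℝ × ℝ × ℝ) (u : ℝ × ℝ → ℝ) (p : ℝ × ℝ) : ℝ :=
  dx^[k] (chr Q u) p + tau Q u p * dt (dx^[k] u) p + xi Q u p * dx (dx^[k] u) p

/-- The fifth prolongation of `Q` applied to the left-hand side
`u_t + u ^ n * u_x + α(t) * u + β(t) * u_xxxxx` of the equation, as a function on the jet space,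
evaluated at the jet of `u` at `p`. -/
def Equation.prolongLhs (E : Equation) (Q : ℝ × ℝ × ℝ → ℝ × ℝ × ℝ) (u : ℝ × ℝ → ℝ)
    (p : ℝ × ℝ) : ℝ :=
  tau Q u p * (deriv E.α p.1 * u p + deriv E.β p.1 * dx^[5] u p)
    + eta Q u p * (E.n * u p ^ (E.n - 1) * dx u p + E.α p.1)
    + prolongT Q u p
    + u p ^ E.n * prolongX 1 Q u p
    + E.β p.1 * prolongX 5 Q u p

/-- `Q` is a Lie symmetry generator of the equation: a smooth vector field on the domain such
that the fifth prolongation of `Q` annihilates the left-hand side at all jets that satisfy the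
equation. Every jet is the jet of a globally defined smooth function `u`. As `Q` is a vector field
on the domain only, its values elsewhere are normalized to `0`. -/
structure Equation.IsLieSymmetry (E : Equation) (Q : ℝ × ℝ × ℝ → ℝ × ℝ × ℝ) : Prop where
  smooth : ContDiffOn ℝ ∞ Q E.dom
  eq_zero : ∀ z ∉ E.dom, Q z = 0
  invariant : ∀ u : ℝ × ℝ → ℝ, ContDiff ℝ ∞ u → ∀ p : ℝ × ℝ, graphPt u p ∈ E.dom →
    E.lhs u p = 0 → E.prolongLhs Q u p = 0

/-- `g` is a Lie algebra of Lie symmetry generators of the equation, under the Lie bracket of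
vector fields. -/
structure Equation.IsLieSymmetryAlgebra (E : Equation)
    (g : Submodule ℝ (ℝ × ℝ × ℝ → ℝ × ℝ × ℝ)) : Prop where
  symmetry : ∀ Q ∈ g, E.IsLieSymmetry Q
  bracket : ∀ Q ∈ g, ∀ R ∈ g, VectorField.lieBracket ℝ Q R ∈ g

/-- `g` is the maximal Lie invariance algebra: the Lie algebra of all Lie symmetry generators. -/
structure Equation.IsMaximalLieSymmetryAlgebra (E : Equation)
    (g : Submodule ℝ (ℝ × ℝ × ℝ → ℝ × ℝ × ℝ)) : Prop extends E.IsLieSymmetryAlgebra g where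
  maximal : ∀ Q, E.IsLieSymmetry Q → Q ∈ g

/-- Two equations are point-equivalent: there is a point transformation (a diffeomorphism `Φ`
between the domains of the variables `(t, x, u)`, of arbitrary form) that maps one equation to the
other. That is, whenever `Φ` maps the graph of `u` near a point to the graph of `v`, the jet of `u`
at the point satisfies the first equation if and only if the jet of `v` at the image point
satisfies the second one. -/
def PointEquivalent (E E' : Equation) : Prop :=
  ∃ Φ : OpenPartialHomeomorph (ℝ × ℝ × ℝ) (ℝ × ℝ × ℝ),
    Φ.source = E.dom ∧ Φ.target = E'.dom ∧
    ContDiffOn ℝ ∞ Φ E.dom ∧ ContDiffOn ℝ ∞ Φ.symm E'.dom ∧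
    ∀ u v : ℝ × ℝ → ℝ, ContDiff ℝ ∞ u → ContDiff ℝ ∞ v →
      ∀ p q : ℝ × ℝ, graphPt u p ∈ E.dom → Φ (graphPt u p) = graphPt v q →
        (∀ᶠ p' in 𝓝 p, ∃ q' : ℝ × ℝ, Φ (graphPt u p') = graphPt v q') →
        (E.lhs u p = 0 ↔ E'.lhs v q = 0)

end FKdV

end

namespace FKdV

open Filter Asymptotics

/-! ### Taylor expansions and derivatives at a point -/

/-! All three conditions are equivalent to one relation between the coefficients, β' + nαβ = 0
(`Equation.IsReducible`). Condition (i) implies the relation, the relation implies both (ii) and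
(iii), and (iii) gives the relation back; (ii) trivially contains (i).

Symmetries. Invariance is tested on functions g(x) + (t − t₀)h(x) with polynomial g and h. Changing
one jet coordinate while staying on the equation isolates one determining equation: u_txxxx shows
that τ = τ(t), u_xxxxx gives ξ_u = 0 and the slope of ξ, u_xxxx makes η affine in u, and u_x, by the
independence of u^n, u^(n−1), 1 for n ≠ 0, 1, makes η homogeneous, ξ_t zero and nσ = c₁ − τ'. A jet
with no x-derivatives gives the last equation. So (`Equation.IsLieSymmetry.exists_form`) a generator
is τ(t)∂_t + (c₁x + c₀)∂_x + σ(t)u∂_u with nσ = c₁ − τ', (τβ)' = 5c₁β, (τα + σ)' = 0. It is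
determined by c₀, c₁ and τ(t₀), so dimension three is the maximum; if it is attained, a generator
with c₁ = 0 and one with c₁ = 1 together force the relation (`Equation.isReducible_of_finrank`).
Under the relation the third equation follows from the other two, and all three parameters are free
(`Equation.IsReducible.exists_maximal`).

Reduction. If A' = α and T' = e^(−nA), then v = e^A u as a function of (T, x) satisfies the equation
with coefficients 0 and βe^(nA), and the relation says exactly that the latter is constant
(`Equation.IsReducible.exists_constantCoeff`).

Point transformations. Nothing is assumed on the form of Φ = (T, X, U). The same perturbations of
the jet of u are applied, and the images of the two graphs are compared. This yields T = T(t), then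
βX_x⁵ = εT_t with X affine in x, then U = a(t)u, X_t = 0, a^n T_t = X_x and a' = αa. Hence βX_x⁴a^n
= ε, and differentiating in t gives the relation (`IsPointTransformation.isReducible`).

In both arguments no general chain rule of order five is needed: only the difference of two nearby
compositions enters, and it is expanded up to o((x − x₀)^5). -/

theorem iteratedDeriv_sub_pow (k m : ℕ) (x₀ x : ℝ) :
    iteratedDeriv k (fun y => (y - x₀) ^ m) x = m.descFactorial k * (x - x₀) ^ (m - k) := by
  have h := congrFun (iteratedDeriv_comp_sub_const k (fun y : ℝ => y ^ m) x₀) x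
  rw [h]
  exact iteratedDeriv_pow m k

theorem taylor_isLittleO_of_contDiffAt {f : ℝ → ℝ} {x₀ : ℝ} {m : ℕ} (hf : ContDiffAt ℝ m f x₀) :
    (fun x => f x - ∑ k ∈ Finset.range (m + 1), iteratedDeriv k f x₀ / k.factorial * (x - x₀) ^ k)
      =o[𝓝 x₀] fun x => (x - x₀) ^ m := by
  obtain ⟨r, hr, hball⟩ : ∃ r > 0, ContDiffOn ℝ m f (Metric.ball x₀ r) := by
    obtain ⟨r, hr, h⟩ := Metric.eventually_nhds_iff_ball.1 (hf.eventually (by simp))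
    exact ⟨r, hr, fun x hx => (h x hx).contDiffWithinAt⟩
  have hx₀ : x₀ ∈ Metric.ball x₀ r := Metric.mem_ball_self hr
  have h := taylor_isLittleO (convex_ball x₀ r) hx₀ hball
  rw [Metric.isOpen_ball.nhdsWithin_eq hx₀] at h
  refine h.congr_left fun x => ?_
  rw [taylor_within_apply]
  congr 1
  refine Finset.sum_congr rfl fun k _ => ?_
  rw [iteratedDerivWithin_of_isOpen Metric.isOpen_ball hx₀, smul_eq_mul]
  ring

theorem isLittleO_pow_of_le {x₀ : ℝ} {j m : ℕ} (h : j ≤ m) :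
    (fun x : ℝ => (x - x₀) ^ m) =O[𝓝 x₀] fun x => (x - x₀) ^ j := by
  obtain ⟨i, rfl⟩ := Nat.exists_eq_add_of_le h
  have : (fun x : ℝ => (x - x₀) ^ i) =O[𝓝 x₀] fun _ => (1 : ℝ) := by
    have hc : ContinuousAt (fun x : ℝ => (x - x₀) ^ i) x₀ := by fun_prop
    exact hc.tendsto.isBigO_one ℝ
  simpa [pow_add, mul_comm] using (isBigO_refl (fun x : ℝ => (x - x₀) ^ j) (𝓝 x₀)).mul this

theorem isLittleO_pow_self_eq_zero {x₀ A : ℝ} {k : ℕ}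
    (h : (fun x => A * (x - x₀) ^ k) =o[𝓝 x₀] fun x => (x - x₀) ^ k) : A = 0 := by
  by_contra hA
  have h1 : (fun x : ℝ => (x - x₀) ^ k) =o[𝓝 x₀] fun x => (x - x₀) ^ k :=
    (isLittleO_const_mul_left_iff hA).1 h
  have h2 := isLittleO_irrefl (f'' := fun x : ℝ => (x - x₀) ^ k) (l := 𝓝 x₀) ?_
  · exact h2 h1
  · have : ∃ᶠ x in 𝓝[≠] x₀, x ≠ x₀ :=
      (eventually_mem_nhdsWithin (s := {x₀}ᶜ) (a := x₀)).frequently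
    refine (this.filter_mono nhdsWithin_le_nhds).mono fun x hx => ?_
    simpa using pow_ne_zero k (sub_ne_zero.2 hx)

/-- If `f ∘ χ` vanishes to order higher than `m` at `x₀`, where `χ` is a local change of variable,
then the derivatives of `f` up to order `m` vanish at `χ x₀`. -/
theorem iteratedDeriv_eq_zero_of_comp_isLittleO {f χ : ℝ → ℝ} {x₀ χ' : ℝ} {m : ℕ}
    (hf : ContDiffAt ℝ m f (χ x₀)) (hχ : HasDerivAt χ χ' x₀) (h0 : χ' ≠ 0)
    (h : (fun x => f (χ x)) =o[𝓝 x₀] fun x => (x - x₀) ^ m) :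
    ∀ k ≤ m, iteratedDeriv k f (χ x₀) = 0 := by
  intro k
  induction k using Nat.strong_induction_on with
  | _ k ih =>
  intro hk
  have hT := taylor_isLittleO_of_contDiffAt (hf.of_le (by exact_mod_cast hk : (k : ℕ∞ω) ≤ m))
  have hsum : ∀ y, ∑ i ∈ Finset.range (k + 1),
      iteratedDeriv i f (χ x₀) / i.factorial * (y - χ x₀) ^ i
      = iteratedDeriv k f (χ x₀) / k.factorial * (y - χ x₀) ^ k := by
    intro y
    rw [Finset.sum_range_succ, Finset.sum_eq_zero, zero_add]
    intro i hi
    have hi' := Finset.mem_range.1 hi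
    rw [ih i hi' (by omega)]; simp
  simp only [hsum] at hT
  have hT2 := hT.comp_tendsto hχ.continuousAt
  have hχO : (fun x => (χ x - χ x₀) ^ k) =O[𝓝 x₀] fun x => (x - x₀) ^ k :=
    (hχ.differentiableAt.isBigO_sub).pow k
  have hT3 := hT2.trans_isBigO hχO
  have hf3 := h.trans_isBigO (isLittleO_pow_of_le (x₀ := x₀) hk)
  have h4 := hf3.sub hT3
  -- As χ' ≠ 0, the powers of χ x - χ x₀ and of x - x₀ are comparable in both directions, so a
  -- nonzero leading Taylor coefficient would contradict the assumed order of vanishing.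
  have hrev : (fun x => (x - x₀) ^ k) =O[𝓝 x₀] fun x => (χ x - χ x₀) ^ k :=
    ((hχ.isTheta_sub h0).isBigO_symm.comp_tendsto
      (tendsto_id.prodMk (tendsto_pure.2 (Eventually.of_forall fun _ => rfl)))).pow k
  have h5 : (fun x => iteratedDeriv k f (χ x₀) / k.factorial * (χ x - χ x₀) ^ k) =o[𝓝 x₀]
      fun x => (x - x₀) ^ k := by
    refine h4.congr_left fun x => ?_
    simp [Function.comp]
  by_contra hne
  have hne' : iteratedDeriv k f (χ x₀) / k.factorial ≠ 0 :=
    div_ne_zero hne (by exact_mod_cast k.factorial_ne_zero)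
  have h6 := hrev.trans_isLittleO ((isLittleO_const_mul_left_iff hne').1 h5)
  exact one_ne_zero (isLittleO_pow_self_eq_zero (A := 1) (by simpa using h6))

theorem iteratedDeriv_eq_of_isLittleO {f g : ℝ → ℝ} {x₀ : ℝ} {m : ℕ}
    (hf : ContDiffAt ℝ m f x₀) (hg : ContDiffAt ℝ m g x₀)
    (h : (fun x => f x - g x) =o[𝓝 x₀] fun x => (x - x₀) ^ m) {k : ℕ} (hk : k ≤ m) :
    iteratedDeriv k f x₀ = iteratedDeriv k g x₀ := by
  have h1 := iteratedDeriv_eq_zero_of_comp_isLittleO (f := f - g) (χ := fun x => x)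
    (hf.sub hg) (hasDerivAt_id x₀) one_ne_zero h k hk
  have hk' : (k : ℕ∞ω) ≤ m := by exact_mod_cast hk
  rw [iteratedDeriv_sub (hf.of_le hk') (hg.of_le hk')] at h1
  linarith

/-- The derivatives of orders `1` and `5` of a function whose difference from `g` is
`k + l s + a s ^ 3 + b s ^ 4 + c s ^ 5 + o (s ^ 5)`, with `s = x - x₀`. -/
theorem deriv_eq_of_isLittleO {f g : ℝ → ℝ} {x₀ : ℝ} (k l a b c : ℝ)
    (hf : ContDiffAt ℝ ∞ f x₀) (hg : ContDiffAt ℝ ∞ g x₀)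
    (h : (fun x => f x - g x - (k + l * (x - x₀) + a * (x - x₀) ^ 3 + b * (x - x₀) ^ 4
      + c * (x - x₀) ^ 5)) =o[𝓝 x₀] fun x => (x - x₀) ^ 5) :
    deriv f x₀ = deriv g x₀ + l ∧ iteratedDeriv 5 f x₀ = iteratedDeriv 5 g x₀ + 120 * c := by
  have hf5 : ContDiffAt ℝ (5 : ℕ) f x₀ := hf.of_le ENat.LEInfty.out
  have hg5 : ContDiffAt ℝ (5 : ℕ) g x₀ := hg.of_le ENat.LEInfty.out
  set P : ℝ → ℝ := fun x => k * (x - x₀) ^ 0 + l * (x - x₀) ^ 1 + a * (x - x₀) ^ 3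
    + b * (x - x₀) ^ 4 + c * (x - x₀) ^ 5 with hP
  have hPs : ∀ i : ℕ, ContDiffAt ℝ i P x₀ := by intro i; rw [hP]; fun_prop
  have hPk : ∀ i : ℕ, iteratedDeriv i P x₀ = k * iteratedDeriv i (fun x => (x - x₀) ^ 0) x₀
      + l * iteratedDeriv i (fun x => (x - x₀) ^ 1) x₀
      + a * iteratedDeriv i (fun x => (x - x₀) ^ 3) x₀
      + b * iteratedDeriv i (fun x => (x - x₀) ^ 4) x₀
      + c * iteratedDeriv i (fun x => (x - x₀) ^ 5) x₀ := by
    intro i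
    rw [hP, iteratedDeriv_fun_add (by fun_prop) (by fun_prop),
      iteratedDeriv_fun_add (by fun_prop) (by fun_prop),
      iteratedDeriv_fun_add (by fun_prop) (by fun_prop),
      iteratedDeriv_fun_add (by fun_prop) (by fun_prop)]
    simp only [iteratedDeriv_const_mul_field]
  have key : ∀ i ≤ 5, iteratedDeriv i f x₀ = iteratedDeriv i g x₀ + iteratedDeriv i P x₀ := by
    intro i hi
    have hi' : (i : ℕ∞ω) ≤ (5 : ℕ) := by exact_mod_cast hi
    have := iteratedDeriv_eq_of_isLittleO (g := g + P) hf5 (hg5.add (hPs 5))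
      (h.congr_left fun x => by simp only [hP, Pi.add_apply]; ring) hi
    rw [this, iteratedDeriv_add (hg5.of_le hi') (hPs i)]
  constructor
  · have := key 1 (by norm_num)
    rw [hPk] at this
    simp only [iteratedDeriv_sub_pow] at this
    simpa using this
  · rw [key 5 le_rfl, hPk]
    simp only [iteratedDeriv_sub_pow]
    norm_num [Nat.descFactorial]
    ring

theorem isLittleO_mul_pow {f : ℝ → ℝ} {x₀ f' : ℝ} (hf : HasDerivAt f f' x₀) (m : ℕ) :
    (fun x => f x * (x - x₀) ^ m - (f x₀ * (x - x₀) ^ m + f' * (x - x₀) ^ (m + 1))) =o[𝓝 x₀]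
      fun x => (x - x₀) ^ (m + 1) := by
  have h := (hasDerivAt_iff_isLittleO.1 hf).mul_isBigO
    (isBigO_refl (fun x : ℝ => (x - x₀) ^ m) (𝓝 x₀))
  refine (h.congr_left fun x => ?_).congr_right fun x => ?_
  · simp only [smul_eq_mul]; ring
  · ring

/-- The effect on `F (x, φ x)` of a perturbation of `φ` of order `m`, to order `m`. -/
theorem isLittleO_perturb {F : ℝ × ℝ → ℝ} {φ : ℝ → ℝ} {x₀ c : ℝ} {m : ℕ} {L : ℝ × ℝ →L[ℝ] ℝ}
    (hF : HasStrictFDerivAt F L (x₀, φ x₀)) (hφ : ContinuousAt φ x₀) (hm : m ≠ 0) :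
    (fun x => F (x, φ x + c * (x - x₀) ^ m) - F (x, φ x) - c * L (0, 1) * (x - x₀) ^ m) =o[𝓝 x₀]
      fun x => (x - x₀) ^ m := by
  have ht1 : Tendsto (fun x => (x, φ x + c * (x - x₀) ^ m)) (𝓝 x₀) (𝓝 (x₀, φ x₀)) := by
    have : ContinuousAt (fun x => (x, φ x + c * (x - x₀) ^ m)) x₀ := by fun_prop
    simpa [ContinuousAt, hm] using this
  have ht2 : Tendsto (fun x => (x, φ x)) (𝓝 x₀) (𝓝 (x₀, φ x₀)) := by
    have : ContinuousAt (fun x => (x, φ x)) x₀ := by fun_prop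
    exact this
  have h := (hasStrictFDerivAt_iff_isLittleO.1 hF).comp_tendsto
    (by simpa [nhds_prod_eq] using ht1.prodMk ht2 :
      Tendsto (fun x => ((x, φ x + c * (x - x₀) ^ m), (x, φ x))) (𝓝 x₀)
        (𝓝 ((x₀, φ x₀), (x₀, φ x₀))))
  have hO : (((fun p : (ℝ × ℝ) × (ℝ × ℝ) => p.1 - p.2) ∘
      fun x => ((x, φ x + c * (x - x₀) ^ m), (x, φ x))) : ℝ → ℝ × ℝ) =O[𝓝 x₀]
      fun x => (x - x₀) ^ m := ?_
  refine (h.trans_isBigO hO).congr_left fun x => ?_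
  swap
  · refine IsBigO.of_bound |c| (Eventually.of_forall fun x => ?_)
    simp only [Function.comp, Prod.mk_sub_mk, sub_self, add_sub_cancel_left, Prod.norm_def,
      norm_zero, norm_mul, Real.norm_eq_abs]
    rw [max_eq_right (by positivity)]
  · simp only [Function.comp, Prod.mk_sub_mk, sub_self, add_sub_cancel_left]
    have : ((0 : ℝ), c * (x - x₀) ^ m) = (c * (x - x₀) ^ m) • ((0 : ℝ), (1 : ℝ)) := by simp
    rw [this, map_smul, smul_eq_mul]
    ring

/-- The effect on `F (x, φ x)` of a perturbation of `φ` of order `m`, to order `m + 1`. -/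
theorem isLittleO_perturb_succ {F G : ℝ × ℝ → ℝ} {φ : ℝ → ℝ} {x₀ φ' c : ℝ} {m : ℕ}
    {L : ℝ × ℝ →L[ℝ] ℝ}
    (hF : ∀ᶠ z in 𝓝 (x₀, φ x₀), HasDerivAt (fun y => F (z.1, y)) (G z) z.2)
    (hG : HasFDerivAt G L (x₀, φ x₀)) (hφ : HasDerivAt φ φ' x₀) (hm : 2 ≤ m) :
    (fun x => F (x, φ x + c * (x - x₀) ^ m) - F (x, φ x) -
      (c * G (x₀, φ x₀) * (x - x₀) ^ m + c * L (1, φ') * (x - x₀) ^ (m + 1))) =o[𝓝 x₀]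
      fun x => (x - x₀) ^ (m + 1) := by
  obtain ⟨r, hr, hball⟩ := Metric.eventually_nhds_iff_ball.1 hF
  have ht1 : Tendsto (fun x => (x, φ x + c * (x - x₀) ^ m)) (𝓝 x₀) (𝓝 (x₀, φ x₀)) := by
    have h1 := hφ.continuousAt
    have : ContinuousAt (fun x => (x, φ x + c * (x - x₀) ^ m)) x₀ := by fun_prop
    simpa [ContinuousAt, show m ≠ 0 by omega] using this
  have ht2 : Tendsto (fun x => (x, φ x)) (𝓝 x₀) (𝓝 (x₀, φ x₀)) := by
    have h1 := hφ.continuousAt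
    have : ContinuousAt (fun x => (x, φ x)) x₀ := by fun_prop
    exact this
  -- By the mean value theorem in the second variable the increment is G(x, φ + θw)·w with w = c(x −
  -- x₀)^m. No regularity of θ in x is needed: since m ≥ 2, θw = o(x − x₀) leaves the derivative of
  -- φ at x₀ unchanged, so the factor G is known to first order.
  have hmv : ∀ᶠ x in 𝓝 x₀, ∃ θ : ℝ, |θ| ≤ 1 ∧
      F (x, φ x + c * (x - x₀) ^ m) - F (x, φ x)
        = G (x, φ x + θ * (c * (x - x₀) ^ m)) * (c * (x - x₀) ^ m) := by
    filter_upwards [ht1 (Metric.ball_mem_nhds _ hr), ht2 (Metric.ball_mem_nhds _ hr)] with x h1 h2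
    set w := c * (x - x₀) ^ m
    have hseg : ∀ s ∈ Set.Icc (0 : ℝ) 1, (x, φ x + s * w) ∈ Metric.ball (x₀, φ x₀) r := by
      intro s hs
      have := (convex_ball (x₀, φ x₀) r) h2 h1 (sub_nonneg.2 hs.2) hs.1 (by ring)
      convert this using 1
      simp only [Prod.smul_mk, Prod.mk_add_mk, smul_eq_mul, Prod.mk.injEq]
      constructor <;> ring
    have hd : ∀ s ∈ Set.Icc (0 : ℝ) 1,
        HasDerivAt (fun s => F (x, φ x + s * w)) (G (x, φ x + s * w) * w) s := by
      intro s hs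
      have h3 := hball _ (hseg s hs)
      have h4 : HasDerivAt (fun s => φ x + s * w) w s := by
        simpa using ((hasDerivAt_id s).mul_const w).const_add (φ x)
      exact HasDerivAt.comp s h3 h4
    obtain ⟨θ, hθ, hθe⟩ := exists_hasDerivAt_eq_slope (fun s => F (x, φ x + s * w))
      (fun s => G (x, φ x + s * w) * w) one_pos
      (fun s hs => (hd s hs).continuousAt.continuousWithinAt)
      (fun s hs => hd s ⟨hs.1.le, hs.2.le⟩)
    refine ⟨θ, abs_le.2 ⟨by linarith [hθ.1], hθ.2.le⟩, ?_⟩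
    simpa using hθe.symm
  choose! θ hθ using hmv.exists_mem.choose_spec.2
  have hθ' : ∀ᶠ x in 𝓝 x₀, |θ x| ≤ 1 ∧ F (x, φ x + c * (x - x₀) ^ m) - F (x, φ x)
        = G (x, φ x + θ x * (c * (x - x₀) ^ m)) * (c * (x - x₀) ^ m) := by
    filter_upwards [hmv.exists_mem.choose_spec.1] with x hx using hθ x hx
  have hθO : (fun x => θ x * (c * (x - x₀) ^ m)) =O[𝓝 x₀] fun x => (x - x₀) ^ m := by
    refine IsBigO.of_bound |c| ?_
    filter_upwards [hθ'] with x hx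
    rw [norm_mul, norm_mul, Real.norm_eq_abs, Real.norm_eq_abs, ← mul_assoc]
    have := hx.1
    gcongr
    nlinarith [abs_nonneg c]
  have hθo : (fun x => θ x * (c * (x - x₀) ^ m)) =o[𝓝 x₀] fun x => x - x₀ := by
    refine hθO.trans_isLittleO ?_
    have h2 : (fun x : ℝ => (x - x₀) ^ m) =O[𝓝 x₀] fun x => (x - x₀) ^ 2 := isLittleO_pow_of_le hm
    refine h2.trans_isLittleO ?_
    have h3 : (fun x : ℝ => x - x₀) =o[𝓝 x₀] fun _ => (1 : ℝ) := by
      rw [isLittleO_one_iff]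
      have : ContinuousAt (fun x => x - x₀) x₀ := by fun_prop
      simpa [ContinuousAt] using this
    simpa [pow_two] using h3.mul_isBigO (isBigO_refl (fun x : ℝ => x - x₀) (𝓝 x₀))
  have hψ : HasDerivAt (fun x => φ x + θ x * (c * (x - x₀) ^ m)) φ' x₀ := by
    have : HasDerivAt (fun x => θ x * (c * (x - x₀) ^ m)) 0 x₀ := by
      rw [hasDerivAt_iff_isLittleO]
      simpa [show m ≠ 0 by omega] using hθo
    simpa only [add_zero] using hφ.fun_add this
  have hGψ : HasDerivAt (fun x => G (x, φ x + θ x * (c * (x - x₀) ^ m))) (L (1, φ')) x₀ := by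
    have h1 := (hasDerivAt_id x₀).prodMk hψ
    have hG' : HasFDerivAt G L (id x₀, φ x₀ + θ x₀ * (c * (x₀ - x₀) ^ m)) := by
      simpa [show m ≠ 0 by omega] using hG
    exact hG'.comp_hasDerivAt x₀ h1
  have h := (isLittleO_mul_pow hGψ m).const_mul_left c
  refine h.congr' ?_ EventuallyEq.rfl
  filter_upwards [hθ'] with x hx
  rw [hx.2]
  simp only [sub_self, zero_pow (show m ≠ 0 by omega), mul_zero, add_zero]
  ring

/-! ### Partial derivatives of functions of `(t, x)` -/

section Plane

variable {f : ℝ × ℝ → ℝ} {S : Set (ℝ × ℝ)}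

theorem contDiffOn_dx (hS : IsOpen S) (hf : ContDiffOn ℝ ∞ f S) : ContDiffOn ℝ ∞ (dx f) S :=
  (hf.fderiv_of_isOpen hS (by simp)).clm_apply contDiffOn_const

theorem contDiffOn_dt (hS : IsOpen S) (hf : ContDiffOn ℝ ∞ f S) : ContDiffOn ℝ ∞ (dt f) S :=
  (hf.fderiv_of_isOpen hS (by simp)).clm_apply contDiffOn_const

theorem contDiffOn_dx_iterate (hS : IsOpen S) (hf : ContDiffOn ℝ ∞ f S) (k : ℕ) :
    ContDiffOn ℝ ∞ (dx^[k] f) S := by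
  induction k with
  | zero => exact hf
  | succ k ih => rw [Function.iterate_succ_apply']; exact contDiffOn_dx hS ih

theorem hasDerivAt_dx {p : ℝ × ℝ} (hf : DifferentiableAt ℝ f p) :
    HasDerivAt (fun x => f (p.1, x)) (dx f p) p.2 := by
  have h1 : HasDerivAt (fun x : ℝ => (p.1, x)) ((0 : ℝ), (1 : ℝ)) p.2 :=
    (hasDerivAt_const _ _).prodMk (hasDerivAt_id _)
  have h2 : HasFDerivAt f (fderiv ℝ f p) (p.1, p.2) := hf.hasFDerivAt
  exact h2.comp_hasDerivAt p.2 h1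

theorem hasDerivAt_dt {p : ℝ × ℝ} (hf : DifferentiableAt ℝ f p) :
    HasDerivAt (fun t => f (t, p.2)) (dt f p) p.1 := by
  have h1 : HasDerivAt (fun t : ℝ => (t, p.2)) ((1 : ℝ), (0 : ℝ)) p.1 :=
    (hasDerivAt_id _).prodMk (hasDerivAt_const _ _)
  have h2 : HasFDerivAt f (fderiv ℝ f p) (p.1, p.2) := hf.hasFDerivAt
  exact h2.comp_hasDerivAt p.1 h1

theorem differentiableAt_of_contDiffOn {E F : Type*} [NormedAddCommGroup E] [NormedSpace ℝ E]
    [NormedAddCommGroup F] [NormedSpace ℝ F] {f : E → F} {S : Set E} {p : E}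
    (hS : IsOpen S) (hf : ContDiffOn ℝ ∞ f S) (hp : p ∈ S) : DifferentiableAt ℝ f p :=
  (hf.contDiffAt (hS.mem_nhds hp)).differentiableAt (by simp)

theorem eventually_mem_slice (hS : IsOpen S) {p : ℝ × ℝ} (hp : p ∈ S) :
    ∀ᶠ x in 𝓝 p.2, (p.1, x) ∈ S := by
  have : ContinuousAt (fun x : ℝ => (p.1, x)) p.2 := by fun_prop
  exact this (hS.mem_nhds hp)

/-- This is the bridge from iterated partial derivatives to one-variable calculus, where the Taylor
expansions above apply. -/
theorem dx_iterate_eq (hS : IsOpen S) (hf : ContDiffOn ℝ ∞ f S) (k : ℕ) :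
    ∀ p ∈ S, dx^[k] f p = iteratedDeriv k (fun x => f (p.1, x)) p.2 := by
  induction k with
  | zero => intro p _; simp
  | succ k ih =>
    intro p hp
    rw [Function.iterate_succ_apply', iteratedDeriv_succ,
      ← (hasDerivAt_dx (differentiableAt_of_contDiffOn hS (contDiffOn_dx_iterate hS hf k) hp)).deriv]
    apply EventuallyEq.deriv_eq
    filter_upwards [eventually_mem_slice hS hp] with x hx using ih _ hx

theorem dt_dx_comm (hS : IsOpen S) (hf : ContDiffOn ℝ ∞ f S) {p : ℝ × ℝ} (hp : p ∈ S) :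
    dt (dx f) p = dx (dt f) p := by
  have hfp := hf.contDiffAt (hS.mem_nhds hp)
  have hd : DifferentiableAt ℝ (fderiv ℝ f) p :=
    differentiableAt_of_contDiffOn hS (hf.fderiv_of_isOpen hS (by simp)) hp
  have h := hfp.isSymmSndFDerivAt (by simp; exact ENat.LEInfty.out)
  have e : ∀ v w : ℝ × ℝ, fderiv ℝ (fun q => fderiv ℝ f q v) p w = fderiv ℝ (fderiv ℝ f) p w v := by
    intro v w
    rw [fderiv_clm_apply hd (differentiableAt_const v)]
    simp
  unfold dt dx
  rw [e, e]
  exact h _ _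

theorem dx_congr {g : ℝ × ℝ → ℝ} {p : ℝ × ℝ} (h : f =ᶠ[𝓝 p] g) : dx f p = dx g p := by
  unfold dx; rw [h.fderiv_eq]

theorem dt_dx_iterate_comm (hS : IsOpen S) (hf : ContDiffOn ℝ ∞ f S) (k : ℕ) :
    ∀ p ∈ S, dt (dx^[k] f) p = dx^[k] (dt f) p := by
  induction k with
  | zero => intro p _; rfl
  | succ k ih =>
    intro p hp
    rw [Function.iterate_succ_apply', Function.iterate_succ_apply',
      dt_dx_comm hS (contDiffOn_dx_iterate hS hf k) hp]
    apply dx_congr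
    filter_upwards [hS.mem_nhds hp] with q hq using ih q hq

end Plane

/-! ### The domain of the variables -/

theorem isOpen_uRange (n : ℝ) : IsOpen (uRange n) := by
  by_cases h : ∃ k : ℕ, n = k
  · have : uRange n = Set.univ := by ext; simp [uRange, h]
    rw [this]; exact isOpen_univ
  · have : uRange n = Set.Ioi 0 := by ext; simp [uRange, h]
    rw [this]; exact isOpen_Ioi

theorem convex_uRange (n : ℝ) : Convex ℝ (uRange n) := by
  by_cases h : ∃ k : ℕ, n = k
  · have : uRange n = Set.univ := by ext; simp [uRange, h]
    rw [this]; exact convex_univ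
  · have : uRange n = Set.Ioi 0 := by ext; simp [uRange, h]
    rw [this]; exact convex_Ioi 0

theorem mem_uRange_of_pos {n u : ℝ} (hu : 0 < u) : u ∈ uRange n := Or.inl hu

theorem Equation.isOpen_dom (E : Equation) : IsOpen E.dom :=
  E.isOpen_I.prod (isOpen_univ.prod (isOpen_uRange _))

theorem Equation.mem_dom {E : Equation} {t x u : ℝ} :
    (t, x, u) ∈ E.dom ↔ t ∈ E.I ∧ u ∈ uRange E.n := by
  simp [Equation.dom]

theorem isOpen_graphPt_preimage (E : Equation) {u : ℝ × ℝ → ℝ} (hu : Continuous u) :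
    IsOpen (graphPt u ⁻¹' E.dom) :=
  E.isOpen_dom.preimage (by unfold graphPt; fun_prop)

theorem contDiff_graphPt {u : ℝ × ℝ → ℝ} (hu : ContDiff ℝ ∞ u) : ContDiff ℝ ∞ (graphPt u) := by
  unfold graphPt; fun_prop

/-! ### Partial derivatives of functions of `(t, x, u)` -/

noncomputable def pdT (F : ℝ × ℝ × ℝ → ℝ) (z : ℝ × ℝ × ℝ) : ℝ := fderiv ℝ F z (1, 0, 0)

noncomputable def pdX (F : ℝ × ℝ × ℝ → ℝ) (z : ℝ × ℝ × ℝ) : ℝ := fderiv ℝ F z (0, 1, 0)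

noncomputable def pdU (F : ℝ × ℝ × ℝ → ℝ) (z : ℝ × ℝ × ℝ) : ℝ := fderiv ℝ F z (0, 0, 1)

theorem fderiv_triple (F : ℝ × ℝ × ℝ → ℝ) (z : ℝ × ℝ × ℝ) (a b c : ℝ) :
    fderiv ℝ F z (a, b, c) = a * pdT F z + b * pdX F z + c * pdU F z := by
  have : (a, b, c) = a • ((1 : ℝ), (0 : ℝ), (0 : ℝ)) + b • ((0 : ℝ), (1 : ℝ), (0 : ℝ))
      + c • ((0 : ℝ), (0 : ℝ), (1 : ℝ)) := by simp
  rw [this, map_add, map_add, map_smul, map_smul, map_smul]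
  simp [pdT, pdX, pdU]

/-- The chain rule along a curve in the space of the variables `(t, x, u)`. -/
theorem hasDerivAt_curve {F : ℝ × ℝ × ℝ → ℝ} {a b c : ℝ → ℝ} {a' b' c' s : ℝ}
    (hF : DifferentiableAt ℝ F (a s, b s, c s)) (ha : HasDerivAt a a' s) (hb : HasDerivAt b b' s)
    (hc : HasDerivAt c c' s) :
    HasDerivAt (fun s => F (a s, b s, c s))
      (a' * pdT F (a s, b s, c s) + b' * pdX F (a s, b s, c s) + c' * pdU F (a s, b s, c s)) s := by
  rw [← fderiv_triple]
  exact hF.hasFDerivAt.comp_hasDerivAt s (ha.prodMk (hb.prodMk hc))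

theorem contDiffOn_pdU {F : ℝ × ℝ × ℝ → ℝ} {D : Set (ℝ × ℝ × ℝ)} (hD : IsOpen D)
    (hF : ContDiffOn ℝ ∞ F D) : ContDiffOn ℝ ∞ (pdU F) D :=
  (hF.fderiv_of_isOpen hD (by simp)).clm_apply contDiffOn_const

/-- A function on the domain whose derivatives with respect to `x` and `u` are `m` and `0` at all
points with a given `t` is affine in `x`. -/
theorem eq_affine_of_pd {E : Equation} {F : ℝ × ℝ × ℝ → ℝ} (hF : DifferentiableOn ℝ F E.dom)
    {t m : ℝ} (ht : t ∈ E.I)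
    (hX : ∀ x, ∀ u ∈ uRange E.n, pdX F (t, x, u) = m)
    (hU : ∀ x, ∀ u ∈ uRange E.n, pdU F (t, x, u) = 0)
    {x₁ u₁ x₂ u₂ : ℝ} (h₁ : u₁ ∈ uRange E.n) (h₂ : u₂ ∈ uRange E.n) :
    F (t, x₁, u₁) - F (t, x₂, u₂) = m * (x₁ - x₂) := by
  have hseg : ∀ s ∈ Set.Icc (0 : ℝ) 1, u₂ + s * (u₁ - u₂) ∈ uRange E.n := by
    intro s hs
    have := (convex_uRange E.n) h₂ h₁ (sub_nonneg.2 hs.2) hs.1 (by ring)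
    convert this using 1
    simp only [smul_eq_mul]; ring
  -- The segment in the (x, u) plane stays in the domain because `uRange` is convex; after
  -- subtracting the expected linear growth the function is constant along it.
  have hd : ∀ s ∈ Set.Icc (0 : ℝ) 1, HasDerivAt
      (fun s => F (t, x₂ + s * (x₁ - x₂), u₂ + s * (u₁ - u₂)) - m * (s * (x₁ - x₂))) 0 s := by
    intro s hs
    have hmem : (t, x₂ + s * (x₁ - x₂), u₂ + s * (u₁ - u₂)) ∈ E.dom :=
      Equation.mem_dom.2 ⟨ht, hseg s hs⟩
    have h1 : HasDerivAt (fun s => x₂ + s * (x₁ - x₂)) (x₁ - x₂) s := by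
      simpa using ((hasDerivAt_id s).mul_const (x₁ - x₂)).const_add x₂
    have h2 : HasDerivAt (fun s => u₂ + s * (u₁ - u₂)) (u₁ - u₂) s := by
      simpa using ((hasDerivAt_id s).mul_const (u₁ - u₂)).const_add u₂
    have h3 := hasDerivAt_curve (F := F) (a := fun _ => t)
      ((hF _ hmem).differentiableAt (E.isOpen_dom.mem_nhds hmem)) (hasDerivAt_const s t) h1 h2
    have h4 : HasDerivAt (fun s => m * (s * (x₁ - x₂))) (m * (x₁ - x₂)) s := by
      simpa using ((hasDerivAt_id s).mul_const (x₁ - x₂)).const_mul m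
    refine (h3.fun_sub h4).congr_deriv ?_
    rw [hX _ _ (hseg s hs), hU _ _ (hseg s hs)]
    ring
  have := constant_of_has_deriv_right_zero (a := 0) (b := 1)
    (fun s hs => (hd s hs).continuousAt.continuousWithinAt)
    (fun s hs => (hd s ⟨hs.1, hs.2.le⟩).hasDerivWithinAt) 1 (by simp)
  simp at this
  linarith

/-! ### Invariance along functions that are affine in `t` -/

section AffineInTime

variable {g h : ℝ → ℝ}

theorem contDiff_affineInTime (hg : ContDiff ℝ ∞ g) (hh : ContDiff ℝ ∞ h) (t₀ : ℝ) :
    ContDiff ℝ ∞ (fun p : ℝ × ℝ => g p.2 + (p.1 - t₀) * h p.2) := by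
  fun_prop

theorem dx_iterate_affineInTime (hg : ContDiff ℝ ∞ g) (hh : ContDiff ℝ ∞ h) (t₀ : ℝ) (k : ℕ) :
    dx^[k] (fun p : ℝ × ℝ => g p.2 + (p.1 - t₀) * h p.2)
      = fun p => iteratedDeriv k g p.2 + (p.1 - t₀) * iteratedDeriv k h p.2 := by
  ext p
  rw [dx_iterate_eq isOpen_univ (contDiff_affineInTime hg hh t₀).contDiffOn k p (Set.mem_univ p)]
  have hg' : ContDiffAt ℝ k g p.2 := (hg.of_le ENat.LEInfty.out).contDiffAt
  have hh' : ContDiffAt ℝ k h p.2 := (hh.of_le ENat.LEInfty.out).contDiffAt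
  simp only
  rw [iteratedDeriv_fun_add hg' (contDiffAt_const.mul hh'), iteratedDeriv_const_mul_field]

theorem dt_affineInTime {g h : ℝ → ℝ} (t₀ : ℝ) {p : ℝ × ℝ} (hg : DifferentiableAt ℝ g p.2)
    (hh : DifferentiableAt ℝ h p.2) :
    dt (fun p : ℝ × ℝ => g p.2 + (p.1 - t₀) * h p.2) p = h p.2 := by
  have hd : DifferentiableAt ℝ (fun p : ℝ × ℝ => g p.2 + (p.1 - t₀) * h p.2) p := by fun_prop
  have h1 := (hasDerivAt_dt hd).deriv
  have h2 : HasDerivAt (fun t => g p.2 + (t - t₀) * h p.2) (h p.2) p.1 := by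
    simpa using (((hasDerivAt_id p.1).sub_const t₀).mul_const (h p.2)).const_add (g p.2)
  exact h1.symm.trans h2.deriv

theorem contDiff_iteratedDeriv {f : ℝ → ℝ} (hf : ContDiff ℝ ∞ f) (k : ℕ) :
    ContDiff ℝ ∞ (iteratedDeriv k f) := by
  rw [iteratedDeriv_eq_iterate]
  induction k with
  | zero => exact hf
  | succ k ih =>
    rw [Function.iterate_succ_apply']
    exact ((contDiff_infty_iff_deriv).1 ih).2

theorem dt_dx_iterate_affineInTime (hg : ContDiff ℝ ∞ g) (hh : ContDiff ℝ ∞ h) (t₀ : ℝ) (k : ℕ)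
    (p : ℝ × ℝ) :
    dt (dx^[k] (fun p : ℝ × ℝ => g p.2 + (p.1 - t₀) * h p.2)) p = iteratedDeriv k h p.2 := by
  rw [dx_iterate_affineInTime hg hh]
  exact dt_affineInTime t₀ ((contDiff_iteratedDeriv hg k).differentiable (by simp) _)
    ((contDiff_iteratedDeriv hh k).differentiable (by simp) _)

theorem lhs_affineInTime (E : Equation) (hg : ContDiff ℝ ∞ g) (hh : ContDiff ℝ ∞ h) (t₀ x₀ : ℝ) :
    E.lhs (fun p : ℝ × ℝ => g p.2 + (p.1 - t₀) * h p.2) (t₀, x₀)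
      = h x₀ + g x₀ ^ E.n * deriv g x₀ + E.α t₀ * g x₀ + E.β t₀ * iteratedDeriv 5 g x₀ := by
  have h1 := dx_iterate_affineInTime hg hh t₀ 1
  have h5 := dx_iterate_affineInTime hg hh t₀ 5
  rw [Function.iterate_one] at h1
  unfold Equation.lhs
  rw [h1, h5, dt_affineInTime t₀ (hg.differentiable (by simp) _) (hh.differentiable (by simp) _)]
  simp [iteratedDeriv_one]

/-- The characteristic of `Q` along `g x + (t - t₀) h x`, at `t = t₀`. -/
noncomputable def sliceChr (Q : ℝ × ℝ × ℝ → ℝ × ℝ × ℝ) (t₀ : ℝ) (g h : ℝ → ℝ) (x : ℝ) : ℝ :=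
  (Q (t₀, x, g x)).2.2 - (Q (t₀, x, g x)).1 * h x - (Q (t₀, x, g x)).2.1 * deriv g x

theorem contDiffAt_sliceChr {E : Equation} {Q : ℝ × ℝ × ℝ → ℝ × ℝ × ℝ}
    (hQ : ContDiffOn ℝ ∞ Q E.dom) {t₀ x₀ : ℝ} (hg : ContDiff ℝ ∞ g) (hh : ContDiff ℝ ∞ h)
    (hz : (t₀, x₀, g x₀) ∈ E.dom) : ContDiffAt ℝ ∞ (sliceChr Q t₀ g h) x₀ := by
  have hQ' : ContDiffAt ℝ ∞ (fun x => Q (t₀, x, g x)) x₀ :=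
    (hQ.contDiffAt (E.isOpen_dom.mem_nhds hz)).comp x₀
      (f := fun x => (t₀, x, g x)) (by fun_prop)
  have hg' : ContDiffAt ℝ ∞ (deriv g) x₀ := ((contDiff_infty_iff_deriv).1 hg).2.contDiffAt
  have hh' := hh.contDiffAt (x := x₀)
  unfold sliceChr
  exact ((hQ'.snd.snd).sub (hQ'.fst.mul hh')).sub ((hQ'.snd.fst).mul hg')

theorem contDiffOn_chr {E : Equation} {Q : ℝ × ℝ × ℝ → ℝ × ℝ × ℝ}
    (hQ : ContDiffOn ℝ ∞ Q E.dom) {u : ℝ × ℝ → ℝ} (hu : ContDiff ℝ ∞ u) :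
    ContDiffOn ℝ ∞ (chr Q u) (graphPt u ⁻¹' E.dom) := by
  have hQ' : ContDiffOn ℝ ∞ (fun p => Q (graphPt u p)) (graphPt u ⁻¹' E.dom) :=
    hQ.comp (contDiff_graphPt hu).contDiffOn fun _ h => h
  have h1 : ContDiffOn ℝ ∞ (dt u) (graphPt u ⁻¹' E.dom) :=
    (contDiffOn_dt isOpen_univ hu.contDiffOn).mono (Set.subset_univ _)
  have h2 : ContDiffOn ℝ ∞ (dx u) (graphPt u ⁻¹' E.dom) :=
    (contDiffOn_dx isOpen_univ hu.contDiffOn).mono (Set.subset_univ _)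
  exact ((hQ'.snd.snd).sub (hQ'.fst.mul h1)).sub ((hQ'.snd.fst).mul h2)

/-- Along g(x) + (t − t₀)h(x) the second t-derivative vanishes, and at t = t₀ the total
x-derivatives of the characteristic are ordinary derivatives of `sliceChr`. The mixed term ξu_tx of
the prolongation cancels against the one in the t-derivative of the characteristic. -/
theorem Equation.IsLieSymmetry.affineInTime {E : Equation} {Q : ℝ × ℝ × ℝ → ℝ × ℝ × ℝ}
    (hQ : E.IsLieSymmetry Q) {t₀ x₀ : ℝ} (hg : ContDiff ℝ ∞ g) (hh : ContDiff ℝ ∞ h)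
    (hz : (t₀, x₀, g x₀) ∈ E.dom)
    (hl : h x₀ + g x₀ ^ E.n * deriv g x₀ + E.α t₀ * g x₀ + E.β t₀ * iteratedDeriv 5 g x₀ = 0) :
    (Q (t₀, x₀, g x₀)).1 * (deriv E.α t₀ * g x₀ + deriv E.β t₀ * iteratedDeriv 5 g x₀)
      + (Q (t₀, x₀, g x₀)).2.2 * (E.n * g x₀ ^ (E.n - 1) * deriv g x₀ + E.α t₀)
      + (pdT (fun z => (Q z).2.2) (t₀, x₀, g x₀) + h x₀ * pdU (fun z => (Q z).2.2) (t₀, x₀, g x₀)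
        - (pdT (fun z => (Q z).1) (t₀, x₀, g x₀)
            + h x₀ * pdU (fun z => (Q z).1) (t₀, x₀, g x₀)) * h x₀
        - (pdT (fun z => (Q z).2.1) (t₀, x₀, g x₀)
            + h x₀ * pdU (fun z => (Q z).2.1) (t₀, x₀, g x₀)) * deriv g x₀)
      + g x₀ ^ E.n * (deriv (sliceChr Q t₀ g h) x₀ + (Q (t₀, x₀, g x₀)).1 * deriv h x₀
        + (Q (t₀, x₀, g x₀)).2.1 * iteratedDeriv 2 g x₀)
      + E.β t₀ * (iteratedDeriv 5 (sliceChr Q t₀ g h) x₀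
        + (Q (t₀, x₀, g x₀)).1 * iteratedDeriv 5 h x₀
        + (Q (t₀, x₀, g x₀)).2.1 * iteratedDeriv 6 g x₀) = 0 := by
  set u : ℝ × ℝ → ℝ := fun p : ℝ × ℝ => g p.2 + (p.1 - t₀) * h p.2 with hu
  have hus : ContDiff ℝ ∞ u := contDiff_affineInTime hg hh t₀
  have hu0 : u (t₀, x₀) = g x₀ := by simp [hu]
  have hgr : graphPt u (t₀, x₀) = (t₀, x₀, g x₀) := by simp [graphPt, hu]
  have hmem : graphPt u (t₀, x₀) ∈ E.dom := by rwa [hgr]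
  have hinv := hQ.invariant u hus (t₀, x₀) hmem (by rw [hu, lhs_affineInTime E hg hh, hl])
  set S := graphPt u ⁻¹' E.dom
  have hS : IsOpen S := isOpen_graphPt_preimage E hus.continuous
  have hp : (t₀, x₀) ∈ S := hmem
  have hchr : ContDiffOn ℝ ∞ (chr Q u) S := contDiffOn_chr hQ.smooth hus
  have hdtu : ∀ p, dt u p = h p.2 := fun p =>
    dt_affineInTime t₀ (hg.differentiable (by simp) _) (hh.differentiable (by simp) _)
  have hdxk : ∀ k p, dx^[k] u p = iteratedDeriv k g p.2 + (p.1 - t₀) * iteratedDeriv k h p.2 :=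
    fun k p => congrFun (dx_iterate_affineInTime hg hh t₀ k) p
  have hdtdxk : ∀ k p, dt (dx^[k] u) p = iteratedDeriv k h p.2 :=
    dt_dx_iterate_affineInTime hg hh t₀
  have hdxu : ∀ p, dx u p = deriv g p.2 + (p.1 - t₀) * deriv h p.2 := by
    intro p; simpa [iteratedDeriv_one] using hdxk 1 p
  have hslice : (fun x => chr Q u (t₀, x)) = sliceChr Q t₀ g h := by
    ext x
    have hgx : graphPt u (t₀, x) = (t₀, x, g x) := by simp [graphPt, hu]
    simp [chr, sliceChr, eta, tau, xi, hdtu, hdxu, hgx]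
  have hDk : ∀ k, dx^[k] (chr Q u) (t₀, x₀) = iteratedDeriv k (sliceChr Q t₀ g h) x₀ := by
    intro k
    rw [dx_iterate_eq hS hchr k _ hp, hslice]
  have hdtdt : dt (dt u) (t₀, x₀) = 0 := by
    have : dt u = fun p => h p.2 + (p.1 - 0) * (fun _ => (0 : ℝ)) p.2 := by ext p; simp [hdtu]
    rw [this, dt_affineInTime (h := fun _ => (0 : ℝ)) 0 (hh.differentiable (by simp) _)
      (by fun_prop)]
  have hdxdt : dx (dt u) (t₀, x₀) = deriv h x₀ := by
    rw [← dt_dx_comm isOpen_univ hus.contDiffOn (Set.mem_univ _)]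
    have := hdtdxk 1 (t₀, x₀)
    rwa [Function.iterate_one, iteratedDeriv_one] at this
  have hgc : HasDerivAt (fun t => g x₀ + (t - t₀) * h x₀) (h x₀) t₀ := by
    simpa using (((hasDerivAt_id t₀).sub_const t₀).mul_const (h x₀)).const_add (g x₀)
  have hgc' : HasDerivAt (fun t => deriv g x₀ + (t - t₀) * deriv h x₀) (deriv h x₀) t₀ := by
    simpa using (((hasDerivAt_id t₀).sub_const t₀).mul_const (deriv h x₀)).const_add (deriv g x₀)
  have hQd := differentiableAt_of_contDiffOn E.isOpen_dom hQ.smooth hz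
  have hcomp : ∀ F : ℝ × ℝ × ℝ → ℝ, DifferentiableAt ℝ F (t₀, x₀, g x₀) →
      HasDerivAt (fun t => F (t, x₀, g x₀ + (t - t₀) * h x₀))
        (pdT F (t₀, x₀, g x₀) + h x₀ * pdU F (t₀, x₀, g x₀)) t₀ := by
    intro F hF
    have := hasDerivAt_curve (F := F) (a := fun t => t) (b := fun _ => x₀)
      (c := fun t => g x₀ + (t - t₀) * h x₀) (s := t₀) (by simpa using hF) (hasDerivAt_id t₀)
      (hasDerivAt_const t₀ x₀) hgc
    simpa using this
  have hdtchr : dt (chr Q u) (t₀, x₀) =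
      pdT (fun z => (Q z).2.2) (t₀, x₀, g x₀) + h x₀ * pdU (fun z => (Q z).2.2) (t₀, x₀, g x₀)
        - (pdT (fun z => (Q z).1) (t₀, x₀, g x₀)
            + h x₀ * pdU (fun z => (Q z).1) (t₀, x₀, g x₀)) * h x₀
        - ((pdT (fun z => (Q z).2.1) (t₀, x₀, g x₀)
            + h x₀ * pdU (fun z => (Q z).2.1) (t₀, x₀, g x₀)) * deriv g x₀
            + (Q (t₀, x₀, g x₀)).2.1 * deriv h x₀) := by
    rw [← (hasDerivAt_dt (differentiableAt_of_contDiffOn hS hchr hp)).deriv]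
    have h1 := hcomp _ hQd.snd.snd
    have h2 := (hcomp _ hQd.fst).mul_const (h x₀)
    have h3 := (hcomp _ hQd.snd.fst).fun_mul hgc'
    have h4 : HasDerivAt (fun t => chr Q u (t, x₀)) _ t₀ :=
      ((h1.fun_sub h2).fun_sub h3).congr_of_eventuallyEq (Eventually.of_forall fun t => by
        simp only [chr, eta, tau, xi, hdtu, hdxu, graphPt]; rfl)
    rw [h4.deriv]
    simp
  have e5 : dx (dx^[5] u) (t₀, x₀) = iteratedDeriv 6 g x₀ := by
    rw [← Function.iterate_succ_apply' dx 5 u, hdxk]; simp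
  have e2 : dx (dx^[1] u) (t₀, x₀) = iteratedDeriv 2 g x₀ := by
    rw [← Function.iterate_succ_apply' dx 1 u, hdxk]; simp
  unfold Equation.prolongLhs prolongT prolongX at hinv
  rw [hdtchr, hDk, hDk, hdtdt, hdxdt, hdtdxk, hdtdxk, e5, e2, hdxu, hdxk 5] at hinv
  simp only [tau, xi, eta, hgr, hu0, iteratedDeriv_one, sub_self, zero_mul, add_zero] at hinv
  rw [← hinv]
  ring

end AffineInTime

/-! ### Polynomial test functions -/

/-- A polynomial of `x` with prescribed jet `(u₀, b, 0, 0, d, c)` at `x₀`. -/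
noncomputable def testPoly (x₀ u₀ b d c x : ℝ) : ℝ :=
  u₀ + b * (x - x₀) + d / 24 * (x - x₀) ^ 4 + c / 120 * (x - x₀) ^ 5

/-- The time derivative of the test functions. -/
noncomputable def testSlope (x₀ a e x : ℝ) : ℝ := a + e * (x - x₀) ^ 4

section TestFunctions

variable (x₀ u₀ a b c d e : ℝ)

theorem contDiff_testPoly : ContDiff ℝ ∞ (testPoly x₀ u₀ b d c) := by
  unfold testPoly; fun_prop

theorem contDiff_testSlope : ContDiff ℝ ∞ (testSlope x₀ a e) := by
  unfold testSlope; fun_prop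

@[simp] theorem testPoly_self : testPoly x₀ u₀ b d c x₀ = u₀ := by simp [testPoly]

@[simp] theorem testSlope_self : testSlope x₀ a e x₀ = a := by simp [testSlope]

theorem iteratedDeriv_testPoly (k : ℕ) : iteratedDeriv k (testPoly x₀ u₀ b d c) x₀
    = u₀ * iteratedDeriv k (fun x => (x - x₀) ^ 0) x₀ + b * iteratedDeriv k (fun x => (x - x₀) ^ 1) x₀
      + d / 24 * iteratedDeriv k (fun x => (x - x₀) ^ 4) x₀
      + c / 120 * iteratedDeriv k (fun x => (x - x₀) ^ 5) x₀ := by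
  have : testPoly x₀ u₀ b d c = fun x => u₀ * (x - x₀) ^ 0 + b * (x - x₀) ^ 1
      + d / 24 * (x - x₀) ^ 4 + c / 120 * (x - x₀) ^ 5 := by ext x; simp [testPoly]
  rw [this, iteratedDeriv_fun_add (by fun_prop) (by fun_prop),
      iteratedDeriv_fun_add (by fun_prop) (by fun_prop),
      iteratedDeriv_fun_add (by fun_prop) (by fun_prop)]
  simp only [iteratedDeriv_const_mul_field]

theorem iteratedDeriv_testSlope (k : ℕ) : iteratedDeriv k (testSlope x₀ a e) x₀
    = a * iteratedDeriv k (fun x => (x - x₀) ^ 0) x₀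
      + e * iteratedDeriv k (fun x => (x - x₀) ^ 4) x₀ := by
  have : testSlope x₀ a e = fun x => a * (x - x₀) ^ 0 + e * (x - x₀) ^ 4 := by
    ext x; simp [testSlope]
  rw [this, iteratedDeriv_fun_add (by fun_prop) (by fun_prop)]
  simp only [iteratedDeriv_const_mul_field]

@[simp] theorem iteratedDeriv_two_testPoly : iteratedDeriv 2 (testPoly x₀ u₀ b d c) x₀ = 0 := by
  rw [iteratedDeriv_testPoly]; simp only [iteratedDeriv_sub_pow]; norm_num [Nat.descFactorial]

@[simp] theorem iteratedDeriv_five_testPoly : iteratedDeriv 5 (testPoly x₀ u₀ b d c) x₀ = c := by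
  rw [iteratedDeriv_testPoly]; simp only [iteratedDeriv_sub_pow]; norm_num [Nat.descFactorial]

@[simp] theorem iteratedDeriv_six_testPoly : iteratedDeriv 6 (testPoly x₀ u₀ b d c) x₀ = 0 := by
  rw [iteratedDeriv_testPoly]; simp only [iteratedDeriv_sub_pow]; norm_num [Nat.descFactorial]

@[simp] theorem iteratedDeriv_five_testSlope : iteratedDeriv 5 (testSlope x₀ a e) x₀ = 0 := by
  rw [iteratedDeriv_testSlope]; simp only [iteratedDeriv_sub_pow]; norm_num [Nat.descFactorial]

theorem hasDerivAt_testPoly (x : ℝ) : HasDerivAt (testPoly x₀ u₀ b d c)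
    (b + d / 6 * (x - x₀) ^ 3 + c / 24 * (x - x₀) ^ 4) x := by
  have h := (hasDerivAt_id x).sub_const x₀
  have h1 := ((((h.const_mul b).const_add u₀).fun_add ((h.fun_pow 4).const_mul (d / 24))).fun_add
    ((h.fun_pow 5).const_mul (c / 120)))
  refine h1.congr_deriv ?_
  simp
  ring

theorem deriv_testPoly (x : ℝ) : deriv (testPoly x₀ u₀ b d c) x
    = b + d / 6 * (x - x₀) ^ 3 + c / 24 * (x - x₀) ^ 4 := (hasDerivAt_testPoly x₀ u₀ b c d x).deriv

@[simp] theorem deriv_testPoly_self : deriv (testPoly x₀ u₀ b d c) x₀ = b := by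
  simp [deriv_testPoly]

@[simp] theorem deriv_testSlope_self : deriv (testSlope x₀ a e) x₀ = 0 := by
  rw [← iteratedDeriv_one, iteratedDeriv_testSlope]
  simp only [iteratedDeriv_sub_pow]; norm_num [Nat.descFactorial]

end TestFunctions

/-! ### Slices at a fixed time -/

section Slice

variable {E : Equation} {F : ℝ × ℝ × ℝ → ℝ} {t₀ x₀ : ℝ}

theorem hasFDerivAt_slice {u₀ : ℝ} (hF : DifferentiableAt ℝ F (t₀, x₀, u₀)) :
    HasFDerivAt (fun w : ℝ × ℝ => F (t₀, w.1, w.2))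
      ((fderiv ℝ F (t₀, x₀, u₀)).comp (ContinuousLinearMap.inr ℝ ℝ (ℝ × ℝ))) (x₀, u₀) := by
  have h : HasFDerivAt (fun w : ℝ × ℝ => (t₀, w)) (ContinuousLinearMap.inr ℝ ℝ (ℝ × ℝ)) (x₀, u₀) :=
    hasFDerivAt_prodMk_right t₀ (x₀, u₀)
  exact HasFDerivAt.comp (x₀, u₀) (g := F) hF.hasFDerivAt h

theorem hasStrictFDerivAt_slice (hF : ContDiffOn ℝ ∞ F E.dom) {u₀ : ℝ}
    (hz : (t₀, x₀, u₀) ∈ E.dom) :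
    HasStrictFDerivAt (fun w : ℝ × ℝ => F (t₀, w.1, w.2))
      ((fderiv ℝ F (t₀, x₀, u₀)).comp (ContinuousLinearMap.inr ℝ ℝ (ℝ × ℝ))) (x₀, u₀) := by
  have h1 := (hF.contDiffAt (E.isOpen_dom.mem_nhds hz)).hasStrictFDerivAt (by simp)
  have h2 : HasStrictFDerivAt (fun w : ℝ × ℝ => (t₀, w)) (ContinuousLinearMap.inr ℝ ℝ (ℝ × ℝ))
      (x₀, u₀) := (hasStrictFDerivAt_const t₀ (x₀, u₀)).prodMk (hasStrictFDerivAt_id (x₀, u₀))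
  exact HasStrictFDerivAt.comp (x₀, u₀) (g := F) h1 h2

theorem hasDerivAt_slice {φ : ℝ → ℝ} {φ' : ℝ} (hF : DifferentiableAt ℝ F (t₀, x₀, φ x₀))
    (hφ : HasDerivAt φ φ' x₀) : HasDerivAt (fun x => F (t₀, x, φ x))
      (pdX F (t₀, x₀, φ x₀) + φ' * pdU F (t₀, x₀, φ x₀)) x₀ := by
  simpa using hasDerivAt_curve (F := F) (a := fun _ => t₀) (b := fun x => x) hF
    (hasDerivAt_const x₀ t₀) (hasDerivAt_id x₀) hφ

theorem hasDerivAt_pdT {u₀ : ℝ} (hF : DifferentiableAt ℝ F (t₀, x₀, u₀)) :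
    HasDerivAt (fun t => F (t, x₀, u₀)) (pdT F (t₀, x₀, u₀)) t₀ := by
  simpa using hasDerivAt_curve (F := F) (a := fun t => t) (b := fun _ => x₀) (c := fun _ => u₀) hF
    (hasDerivAt_id t₀) (hasDerivAt_const t₀ x₀) (hasDerivAt_const t₀ u₀)

theorem hasDerivAt_pdU {u₀ : ℝ} (hF : DifferentiableAt ℝ F (t₀, x₀, u₀)) :
    HasDerivAt (fun u => F (t₀, x₀, u)) (pdU F (t₀, x₀, u₀)) u₀ := by
  simpa using hasDerivAt_curve (F := F) (a := fun _ => t₀) (b := fun _ => x₀) (c := fun u => u) hF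
    (hasDerivAt_const u₀ t₀) (hasDerivAt_const u₀ x₀) (hasDerivAt_id u₀)

theorem hasDerivAt_pdX {u₀ : ℝ} (hF : DifferentiableAt ℝ F (t₀, x₀, u₀)) :
    HasDerivAt (fun x => F (t₀, x, u₀)) (pdX F (t₀, x₀, u₀)) x₀ := by
  simpa using hasDerivAt_slice (φ := fun _ => u₀) hF (hasDerivAt_const x₀ u₀)

/-- The effect of a fifth-order perturbation of `φ` on a function along the graph of `φ`. -/
theorem isLittleO_perturb_five (hF : ContDiffOn ℝ ∞ F E.dom) {φ : ℝ → ℝ} {c : ℝ}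
    (hz : (t₀, x₀, φ x₀) ∈ E.dom) (hφ : ContinuousAt φ x₀) :
    (fun x => F (t₀, x, φ x + c * (x - x₀) ^ 5) - F (t₀, x, φ x)
      - c * pdU F (t₀, x₀, φ x₀) * (x - x₀) ^ 5) =o[𝓝 x₀] fun x => (x - x₀) ^ 5 := by
  have h := isLittleO_perturb (c := c) (m := 5) (hasStrictFDerivAt_slice hF hz) hφ (by norm_num)
  refine h.congr_left fun x => ?_
  simp [pdU]

/-- The effect of a fourth-order perturbation of `φ` on a function along the graph of `φ`. -/
theorem isLittleO_perturb_four (hF : ContDiffOn ℝ ∞ F E.dom) {φ : ℝ → ℝ} {c φ' : ℝ}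
    (hz : (t₀, x₀, φ x₀) ∈ E.dom) (hφ : HasDerivAt φ φ' x₀) :
    (fun x => F (t₀, x, φ x + c * (x - x₀) ^ 4) - F (t₀, x, φ x)
      - (c * pdU F (t₀, x₀, φ x₀) * (x - x₀) ^ 4
        + c * (pdX (pdU F) (t₀, x₀, φ x₀) + φ' * pdU (pdU F) (t₀, x₀, φ x₀)) * (x - x₀) ^ 5))
      =o[𝓝 x₀] fun x => (x - x₀) ^ 5 := by
  have hG := differentiableAt_of_contDiffOn E.isOpen_dom (contDiffOn_pdU E.isOpen_dom hF) hz
  have hev : ∀ᶠ w in 𝓝 (x₀, φ x₀),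
      HasDerivAt (fun y => F (t₀, w.1, y)) (pdU F (t₀, w.1, w.2)) w.2 := by
    have hc : ContinuousAt (fun w : ℝ × ℝ => (t₀, w.1, w.2)) (x₀, φ x₀) := by fun_prop
    filter_upwards [hc (E.isOpen_dom.mem_nhds hz)] with w hw
    exact hasDerivAt_pdU (differentiableAt_of_contDiffOn E.isOpen_dom hF hw)
  have h := isLittleO_perturb_succ (F := fun w => F (t₀, w.1, w.2))
    (G := fun w => pdU F (t₀, w.1, w.2)) (c := c) (m := 4) hev (hasFDerivAt_slice hG) hφ
    (by norm_num)
  refine h.congr_left fun x => ?_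
  simp [fderiv_triple]

theorem eventually_slice_mem_dom {φ : ℝ → ℝ} (hφ : ContinuousAt φ x₀)
    (hz : (t₀, x₀, φ x₀) ∈ E.dom) : ∀ᶠ x in 𝓝 x₀, (t₀, x, φ x) ∈ E.dom := by
  have hc : ContinuousAt (fun x => (t₀, x, φ x)) x₀ := by fun_prop
  exact hc (E.isOpen_dom.mem_nhds hz)

end Slice

/-! ### The determining equations -/

section Determining

variable {E : Equation} {Q : ℝ × ℝ × ℝ → ℝ × ℝ × ℝ}

/-- The values b = u_x, c = u_xxxxx, d = u_xxxx and e = u_txxxx / 24 are at free disposal: u_t = a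
is solved from the equation, which involves neither d nor e. Each determining equation below is the
difference of two instances. -/
theorem Equation.IsLieSymmetry.testFunction (hQ : E.IsLieSymmetry Q) {t₀ x₀ u₀ : ℝ} (b c d e : ℝ)
    (hz : (t₀, x₀, u₀) ∈ E.dom) {a : ℝ} (ha : a = -(u₀ ^ E.n * b + E.α t₀ * u₀ + E.β t₀ * c)) :
    (Q (t₀, x₀, u₀)).1 * (deriv E.α t₀ * u₀ + deriv E.β t₀ * c)
      + (Q (t₀, x₀, u₀)).2.2 * (E.n * u₀ ^ (E.n - 1) * b + E.α t₀)
      + (pdT (fun z => (Q z).2.2) (t₀, x₀, u₀) + a * pdU (fun z => (Q z).2.2) (t₀, x₀, u₀)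
        - (pdT (fun z => (Q z).1) (t₀, x₀, u₀) + a * pdU (fun z => (Q z).1) (t₀, x₀, u₀)) * a
        - (pdT (fun z => (Q z).2.1) (t₀, x₀, u₀)
            + a * pdU (fun z => (Q z).2.1) (t₀, x₀, u₀)) * b)
      + u₀ ^ E.n * deriv (sliceChr Q t₀ (testPoly x₀ u₀ b d c) (testSlope x₀ a e)) x₀
      + E.β t₀ * iteratedDeriv 5 (sliceChr Q t₀ (testPoly x₀ u₀ b d c) (testSlope x₀ a e)) x₀
      = 0 := by
  have h := hQ.affineInTime (contDiff_testPoly x₀ u₀ b c d)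
    (contDiff_testSlope x₀ a e) (t₀ := t₀) (x₀ := x₀) (by simpa using hz) (by
      simp only [testSlope_self, testPoly_self, deriv_testPoly_self, iteratedDeriv_five_testPoly, ha]
      ring)
  simpa using h

theorem contDiffAt_sliceChr_test (hQ : E.IsLieSymmetry Q) {t₀ x₀ u₀ : ℝ} (a b c d e : ℝ)
    (hz : (t₀, x₀, u₀) ∈ E.dom) :
    ContDiffAt ℝ ∞ (sliceChr Q t₀ (testPoly x₀ u₀ b d c) (testSlope x₀ a e)) x₀ :=
  contDiffAt_sliceChr hQ.smooth (contDiff_testPoly x₀ u₀ b c d) (contDiff_testSlope x₀ a e)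
    (by simpa using hz)

/-- The jet coordinate u_txxxx enters only through −τu_t in the characteristic. Passing from e = 0
to e = 1 adds −τ(x − x₀)^4 there, whose fifth derivative is −120(τ_x + bτ_u). As β ≠ 0 this vanishes
for every slope b. -/
theorem Equation.IsLieSymmetry.tau_pd (hQ : E.IsLieSymmetry Q) {t₀ x₀ u₀ : ℝ} (hz : (t₀, x₀, u₀) ∈ E.dom) :
    pdX (fun z => (Q z).1) (t₀, x₀, u₀) = 0 ∧ pdU (fun z => (Q z).1) (t₀, x₀, u₀) = 0 := by
  have key : ∀ b, pdX (fun z => (Q z).1) (t₀, x₀, u₀)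
      + b * pdU (fun z => (Q z).1) (t₀, x₀, u₀) = 0 := by
    intro b
    have h0 := hQ.testFunction b 0 0 0 hz rfl
    have h1 := hQ.testFunction b 0 0 1 hz rfl
    set a := -(u₀ ^ E.n * b + E.α t₀ * u₀ + E.β t₀ * 0)
    have hτ := (differentiableAt_of_contDiffOn E.isOpen_dom hQ.smooth hz).fst
    have hφ := hasDerivAt_testPoly x₀ u₀ b 0 0 x₀
    have hd := hasDerivAt_slice (F := fun z => (Q z).1) (φ := testPoly x₀ u₀ b 0 0)
      (by simpa using hτ) hφ
    have ho := isLittleO_mul_pow hd 4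
    obtain ⟨e1, e5⟩ := deriv_eq_of_isLittleO 0 0 0 (-(Q (t₀, x₀, u₀)).1)
      (-(pdX (fun z => (Q z).1) (t₀, x₀, u₀) + b * pdU (fun z => (Q z).1) (t₀, x₀, u₀)))
      (contDiffAt_sliceChr_test hQ a b 0 0 1 hz) (contDiffAt_sliceChr_test hQ a b 0 0 0 hz)
      (ho.neg_left.congr_left fun x => by
        simp [sliceChr, testSlope]
        ring)
    rw [e1, e5] at h1
    have hβ := E.β_ne_zero t₀ (Equation.mem_dom.1 hz).1
    have : E.β t₀ * (pdX (fun z => (Q z).1) (t₀, x₀, u₀)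
      + b * pdU (fun z => (Q z).1) (t₀, x₀, u₀)) = 0 := by linarith
    exact (mul_eq_zero.1 this).resolve_left hβ
  have k0 := key 0
  have k1 := key 1
  constructor <;> linarith

theorem Equation.IsLieSymmetry.tau_eq (hQ : E.IsLieSymmetry Q) {t x₁ u₁ x₂ u₂ : ℝ} (ht : t ∈ E.I)
    (h₁ : u₁ ∈ uRange E.n) (h₂ : u₂ ∈ uRange E.n) : (Q (t, x₁, u₁)).1 = (Q (t, x₂, u₂)).1 := by
  have := eq_affine_of_pd (F := fun z => (Q z).1) (m := 0)
    (hQ.smooth.fst.differentiableOn (by simp)) ht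
    (fun x u hu => (hQ.tau_pd (Equation.mem_dom.2 ⟨ht, hu⟩)).1)
    (fun x u hu => (hQ.tau_pd (Equation.mem_dom.2 ⟨ht, hu⟩)).2)
    (x₁ := x₁) (x₂ := x₂) h₁ h₂
  linarith

/-- If `F` does not depend on `x` and `u`, then neither does its time derivative. -/
theorem pdT_eq_of_eq {F : ℝ × ℝ × ℝ → ℝ} (hF : ContDiffOn ℝ ∞ F E.dom) {t x₁ u₁ x₂ u₂ : ℝ}
    (ht : t ∈ E.I) (h₁ : u₁ ∈ uRange E.n) (h₂ : u₂ ∈ uRange E.n)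
    (h : ∀ s ∈ E.I, F (s, x₁, u₁) = F (s, x₂, u₂)) :
    pdT F (t, x₁, u₁) = pdT F (t, x₂, u₂) := by
  have d1 := hasDerivAt_pdT (differentiableAt_of_contDiffOn E.isOpen_dom hF
    (Equation.mem_dom.2 ⟨ht, h₁⟩) : DifferentiableAt ℝ F (t, x₁, u₁))
  have d2 := hasDerivAt_pdT (differentiableAt_of_contDiffOn E.isOpen_dom hF
    (Equation.mem_dom.2 ⟨ht, h₂⟩) : DifferentiableAt ℝ F (t, x₂, u₂))
  refine d1.unique (d2.congr_of_eventuallyEq ?_)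
  filter_upwards [E.isOpen_I.mem_nhds ht] with s hs using h s hs

/-- The coordinate c = u_xxxxx is varied, and u_t must change by −β to compensate. The term −ξu_x of
the characteristic contributes −5(ξ_x + bξ_u) through its fifth derivative, and the contributions of
η_u cancel. -/
theorem Equation.IsLieSymmetry.xi_pd (hQ : E.IsLieSymmetry Q) {t₀ x₀ u₀ : ℝ} (hz : (t₀, x₀, u₀) ∈ E.dom) :
    pdU (fun z => (Q z).2.1) (t₀, x₀, u₀) = 0 ∧
    5 * E.β t₀ * pdX (fun z => (Q z).2.1) (t₀, x₀, u₀)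
      = (Q (t₀, x₀, u₀)).1 * deriv E.β t₀ + E.β t₀ * pdT (fun z => (Q z).1) (t₀, x₀, u₀) := by
  obtain ⟨htI, huR⟩ := Equation.mem_dom.1 hz
  have key : ∀ b, 5 * E.β t₀ * (pdX (fun z => (Q z).2.1) (t₀, x₀, u₀)
        + b * pdU (fun z => (Q z).2.1) (t₀, x₀, u₀))
      = (Q (t₀, x₀, u₀)).1 * deriv E.β t₀ + E.β t₀ * pdT (fun z => (Q z).1) (t₀, x₀, u₀) := by
    intro b
    obtain ⟨a₀, ha₀⟩ : ∃ a, a = -(u₀ ^ E.n * b + E.α t₀ * u₀ + E.β t₀ * 0) := ⟨_, rfl⟩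
    obtain ⟨a₁, ha₁⟩ : ∃ a, a = -(u₀ ^ E.n * b + E.α t₀ * u₀ + E.β t₀ * 1) := ⟨_, rfl⟩
    have h0 := hQ.testFunction b 0 0 0 hz ha₀
    have h1 := hQ.testFunction b 1 0 0 hz ha₁
    have hξ := (differentiableAt_of_contDiffOn E.isOpen_dom hQ.smooth hz).snd.fst
    have hz0 : (t₀, x₀, testPoly x₀ u₀ b 0 0 x₀) ∈ E.dom := by simpa using hz
    have hz1 : (t₀, x₀, testPoly x₀ u₀ b 0 1 x₀) ∈ E.dom := by simpa using hz
    have hd := hasDerivAt_slice (F := fun z => (Q z).2.1) (φ := testPoly x₀ u₀ b 0 1)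
      (by simpa using hξ) (hasDerivAt_testPoly x₀ u₀ b 1 0 x₀)
    have ho1 := isLittleO_mul_pow hd 4
    have hc0 := (hasDerivAt_testPoly x₀ u₀ b 0 0 x₀).continuousAt
    have hc1 := (hasDerivAt_testPoly x₀ u₀ b 1 0 x₀).continuousAt
    have ho2 := isLittleO_perturb_five (c := 1 / 120) hQ.smooth.snd.snd hz0 hc0
    have ho3 := isLittleO_perturb_five (c := 1 / 120) hQ.smooth.snd.fst hz0 hc0
    have hg : ∀ x, testPoly x₀ u₀ b 0 0 x + 1 / 120 * (x - x₀) ^ 5 = testPoly x₀ u₀ b 0 1 x := by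
      intro x; simp [testPoly]
    simp only [hg] at ho2 ho3
    -- The slope of the perturbed polynomial is b + (x − x₀)^4 / 24. So the change of ξu_x splits
    -- into b times the change of ξ and ξ(x − x₀)^4 / 24 along the perturbed graph.
    have ho := (ho2.sub (ho3.const_mul_left b)).sub (ho1.const_mul_left (1 / 24))
    obtain ⟨e1, e5⟩ := deriv_eq_of_isLittleO (-(Q (t₀, x₀, u₀)).1 * (a₁ - a₀)) 0 0
      (-(Q (t₀, x₀, u₀)).2.1 / 24)
      ((pdU (fun z => (Q z).2.2) (t₀, x₀, u₀) - b * pdU (fun z => (Q z).2.1) (t₀, x₀, u₀)) / 120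
        - (pdX (fun z => (Q z).2.1) (t₀, x₀, u₀) + b * pdU (fun z => (Q z).2.1) (t₀, x₀, u₀)) / 24)
      (contDiffAt_sliceChr_test hQ a₁ b 1 0 0 hz) (contDiffAt_sliceChr_test hQ a₀ b 0 0 0 hz)
      (ho.congr' (by
        filter_upwards [eventually_slice_mem_dom hc0 hz0, eventually_slice_mem_dom hc1 hz1]
          with x hx0 hx1
        have t0 := hQ.tau_eq (x₁ := x) (x₂ := x₀) htI (Equation.mem_dom.1 hx0).2 huR
        have t1 := hQ.tau_eq (x₁ := x) (x₂ := x₀) htI (Equation.mem_dom.1 hx1).2 huR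
        simp only [sliceChr, testSlope, t0, t1, deriv_testPoly, testPoly_self]
        ring) EventuallyEq.rfl)
    rw [e1, e5, (hQ.tau_pd hz).2] at h1
    rw [(hQ.tau_pd hz).2] at h0
    linear_combination h0 - h1
      - (pdU (fun z => (Q z).2.2) (t₀, x₀, u₀) - pdT (fun z => (Q z).1) (t₀, x₀, u₀)
        - b * pdU (fun z => (Q z).2.1) (t₀, x₀, u₀)) * (ha₀ - ha₁)
  have k0 := key 0
  have k1 := key 1
  have hβ := E.β_ne_zero t₀ htI
  refine ⟨?_, by linarith⟩
  -- The right side of `key` does not depend on b, so the coefficient of b on the left vanishes.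
  have : E.β t₀ * pdU (fun z => (Q z).2.1) (t₀, x₀, u₀) = 0 := by linarith
  exact (mul_eq_zero.1 this).resolve_left hβ

end Determining

/-! ### Linear independence of powers of u -/

theorem rpow_two_eq_one_iff {n : ℝ} : (2 : ℝ) ^ n = 1 ↔ n = 0 := by
  refine ⟨fun h => ?_, fun h => by simp [h]⟩
  have := congrArg Real.log h
  rw [Real.log_rpow two_pos, Real.log_one] at this
  exact (mul_eq_zero.1 this).resolve_right (Real.log_pos one_lt_two).ne'

/-- The functions `u ^ n`, `u ^ (n - 1)` and `1` are linearly independent on the half-line. -/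
theorem rpow_linearIndependent {n A B C : ℝ} (h0 : n ≠ 0) (h1 : n ≠ 1)
    (h : ∀ u > 0, A * u ^ n + B * u ^ (n - 1) + C = 0) : A = 0 ∧ B = 0 ∧ C = 0 := by
  have e1 := h 1 one_pos
  have e2 := h 2 two_pos
  have e4 := h 4 (by norm_num)
  -- At u = 1, 2, 4 the powers become polynomials in r = 2^n. The exceptional values r = 1 and r = 2
  -- correspond to n = 0 and n = 1.
  set r : ℝ := 2 ^ n with hr
  have hrpos : 0 < r := Real.rpow_pos_of_pos two_pos n
  have h2 : (2 : ℝ) ^ (n - 1) = r / 2 := by rw [Real.rpow_sub_one two_ne_zero]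
  have h4 : (4 : ℝ) ^ n = r ^ 2 := by
    rw [show (4 : ℝ) = 2 * 2 by norm_num, Real.mul_rpow two_pos.le two_pos.le, pow_two]
  have h4' : (4 : ℝ) ^ (n - 1) = r ^ 2 / 4 := by
    rw [Real.rpow_sub_one (by norm_num), h4]
  have hr1 : r ≠ 1 := by
    intro h
    rw [hr, rpow_two_eq_one_iff] at h
    exact h0 h
  have hr2 : r ≠ 2 := by
    intro h
    have : (2 : ℝ) ^ (n - 1) = 1 := by rw [h2, h]; norm_num
    rw [rpow_two_eq_one_iff] at this
    exact h1 (by linarith)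
  rw [Real.one_rpow, Real.one_rpow] at e1
  rw [h2] at e2
  rw [h4, h4'] at e4
  have f1 : A * (r - 1) + B * (r / 2 - 1) = 0 := by linear_combination e2 - e1
  have f2 : A * (r ^ 2 - 1) + B * (r ^ 2 / 4 - 1) = 0 := by linear_combination e4 - e1
  -- B is eliminated by r² / 4 − 1 = (r / 2 − 1)(r / 2 + 1).
  have f3 : (A * r * (r - 1)) = 0 := by linear_combination 2 * (f2 - f1 * (r / 2 + 1))
  have hA : A = 0 := by
    rcases mul_eq_zero.1 f3 with h | h
    · exact (mul_eq_zero.1 h).resolve_right hrpos.ne'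
    · exact absurd (by linarith) hr1
  subst hA
  have hB : B = 0 := by
    rcases mul_eq_zero.1 (show B * (r / 2 - 1) = 0 by linarith) with h | h
    · exact h
    · exact absurd (by linarith) hr2
  subst hB
  exact ⟨rfl, rfl, by linarith⟩

/-! ### Affine form of ξ and η, and the equations for τ and σ -/

section Determining

variable {E : Equation} {Q : ℝ × ℝ × ℝ → ℝ × ℝ × ℝ}

/-- The common value of `∂ξ/∂x` at the points with a given `t`. -/
noncomputable def xiSlope (E : Equation) (Q : ℝ × ℝ × ℝ → ℝ × ℝ × ℝ) (t : ℝ) : ℝ :=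
  ((Q (t, 0, 1)).1 * deriv E.β t + E.β t * pdT (fun z => (Q z).1) (t, 0, 1)) / (5 * E.β t)

theorem one_mem_uRange (n : ℝ) : (1 : ℝ) ∈ uRange n := mem_uRange_of_pos one_pos

theorem Equation.IsLieSymmetry.xi_eq (hQ : E.IsLieSymmetry Q) {t x₁ u₁ x₂ u₂ : ℝ} (ht : t ∈ E.I)
    (h₁ : u₁ ∈ uRange E.n) (h₂ : u₂ ∈ uRange E.n) :
    (Q (t, x₁, u₁)).2.1 = (Q (t, x₂, u₂)).2.1 + xiSlope E Q t * (x₁ - x₂) := by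
  have := eq_affine_of_pd (F := fun z => (Q z).2.1) (m := xiSlope E Q t)
    (hQ.smooth.snd.fst.differentiableOn (by simp)) ht
    (fun x u hu => by
      have h := (hQ.xi_pd (Equation.mem_dom.2 ⟨ht, hu⟩) (x₀ := x)).2
      rw [pdT_eq_of_eq hQ.smooth.fst ht hu (one_mem_uRange _) (x₂ := 0)
        (fun s hs => hQ.tau_eq hs hu (one_mem_uRange _)),
        hQ.tau_eq ht hu (one_mem_uRange _) (x₂ := 0)] at h
      rw [xiSlope, ← h]
      have := E.β_ne_zero t ht
      field_simp)
    (fun x u hu => (hQ.xi_pd (Equation.mem_dom.2 ⟨ht, hu⟩)).1)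
    (x₁ := x₁) (x₂ := x₂) h₁ h₂
  linarith

/-- The coordinate d = u_xxxx is varied, which does not affect the equation. The fifth derivative of
η along the graph changes by 5(η_xu + bη_uu), while −ξu_x changes by a polynomial of degree four
near x₀, because ξ is affine in x. -/
theorem Equation.IsLieSymmetry.eta_pd (hQ : E.IsLieSymmetry Q) {t₀ x₀ u₀ : ℝ}
    (hz : (t₀, x₀, u₀) ∈ E.dom) :
    pdX (pdU fun z => (Q z).2.2) (t₀, x₀, u₀) = 0 ∧
    pdU (pdU fun z => (Q z).2.2) (t₀, x₀, u₀) = 0 := by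
  obtain ⟨htI, huR⟩ := Equation.mem_dom.1 hz
  have key : ∀ b, pdX (pdU fun z => (Q z).2.2) (t₀, x₀, u₀)
      + b * pdU (pdU fun z => (Q z).2.2) (t₀, x₀, u₀) = 0 := by
    intro b
    obtain ⟨a, ha⟩ : ∃ a, a = -(u₀ ^ E.n * b + E.α t₀ * u₀ + E.β t₀ * 0) := ⟨_, rfl⟩
    have h0 := hQ.testFunction b 0 0 0 hz ha
    have h1 := hQ.testFunction b 0 1 0 hz ha
    have hz0 : (t₀, x₀, testPoly x₀ u₀ b 0 0 x₀) ∈ E.dom := by simpa using hz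
    have hz1 : (t₀, x₀, testPoly x₀ u₀ b 1 0 x₀) ∈ E.dom := by simpa using hz
    have hd0 := hasDerivAt_testPoly x₀ u₀ b 0 0 x₀
    have hc1 := (hasDerivAt_testPoly x₀ u₀ b 0 1 x₀).continuousAt
    have ho := isLittleO_perturb_four (c := 1 / 24) hQ.smooth.snd.snd hz0 hd0
    have hg : ∀ x, testPoly x₀ u₀ b 0 0 x + 1 / 24 * (x - x₀) ^ 4 = testPoly x₀ u₀ b 1 0 x := by
      intro x; simp [testPoly]
    simp only [hg] at ho
    obtain ⟨e1, e5⟩ := deriv_eq_of_isLittleO 0 0 (-(Q (t₀, x₀, u₀)).2.1 / 6)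
      (pdU (fun z => (Q z).2.2) (t₀, x₀, u₀) / 24 - xiSlope E Q t₀ / 6)
      ((pdX (pdU fun z => (Q z).2.2) (t₀, x₀, u₀)
        + b * pdU (pdU fun z => (Q z).2.2) (t₀, x₀, u₀)) / 24)
      (contDiffAt_sliceChr_test hQ a b 0 1 0 hz) (contDiffAt_sliceChr_test hQ a b 0 0 0 hz)
      (ho.congr' (by
        filter_upwards [eventually_slice_mem_dom hd0.continuousAt hz0,
          eventually_slice_mem_dom hc1 hz1] with x hx0 hx1
        have t0 := hQ.tau_eq (x₁ := x) (x₂ := x₀) htI (Equation.mem_dom.1 hx0).2 huR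
        have t1 := hQ.tau_eq (x₁ := x) (x₂ := x₀) htI (Equation.mem_dom.1 hx1).2 huR
        have s0 := hQ.xi_eq (x₁ := x) (x₂ := x₀) htI (Equation.mem_dom.1 hx0).2 huR
        have s1 := hQ.xi_eq (x₁ := x) (x₂ := x₀) htI (Equation.mem_dom.1 hx1).2 huR
        simp only [sliceChr, testSlope, t0, t1, s0, s1, deriv_testPoly, testPoly_self]
        ring) EventuallyEq.rfl)
    rw [e1, e5] at h1
    have hβ := E.β_ne_zero t₀ htI
    have : E.β t₀ * (pdX (pdU fun z => (Q z).2.2) (t₀, x₀, u₀)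
      + b * pdU (pdU fun z => (Q z).2.2) (t₀, x₀, u₀)) = 0 := by
        linear_combination (h1 - h0) / 5
    exact (mul_eq_zero.1 this).resolve_left hβ
  have k0 := key 0
  have k1 := key 1
  constructor <;> linarith

/-- A function on the domain whose derivatives with respect to `u` does not depend on `x` and `u`
is affine in `u`. -/
theorem eq_affine_of_pdU {F : ℝ × ℝ × ℝ → ℝ} (hF : ContDiffOn ℝ ∞ F E.dom)
    (hX : ∀ z ∈ E.dom, pdX (pdU F) z = 0) (hU : ∀ z ∈ E.dom, pdU (pdU F) z = 0)
    {t x u : ℝ} (ht : t ∈ E.I) (hu : u ∈ uRange E.n) :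
    pdU F (t, x, u) = pdU F (t, 0, 1) ∧ F (t, x, u) = F (t, x, 1) + pdU F (t, 0, 1) * (u - 1) := by
  have hG := contDiffOn_pdU E.isOpen_dom hF
  have h1 : ∀ x, ∀ u ∈ uRange E.n, pdU F (t, x, u) = pdU F (t, 0, 1) := by
    intro x u hu
    have := eq_affine_of_pd (m := 0) (hG.differentiableOn (by simp)) ht
      (fun x u hu => hX _ (Equation.mem_dom.2 ⟨ht, hu⟩))
      (fun x u hu => hU _ (Equation.mem_dom.2 ⟨ht, hu⟩))
      (x₁ := x) (x₂ := 0) hu (one_mem_uRange _)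
    linarith
  refine ⟨h1 x u hu, ?_⟩
  have hd : ∀ v ∈ uRange E.n,
      HasDerivAt (fun v => F (t, x, v) - pdU F (t, 0, 1) * v) 0 v := by
    intro v hv
    have h := hasDerivAt_pdU (differentiableAt_of_contDiffOn E.isOpen_dom hF
      (Equation.mem_dom.2 ⟨ht, hv⟩) : DifferentiableAt ℝ F (t, x, v))
    refine (h.fun_sub ((hasDerivAt_id v).const_mul (pdU F (t, 0, 1)))).congr_deriv ?_
    rw [h1 x v hv]; simp
  have := (isOpen_uRange E.n).is_const_of_deriv_eq_zero (convex_uRange E.n).isPreconnected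
    (fun v hv => (hd v hv).differentiableAt.differentiableWithinAt)
    (fun v hv => (hd v hv).deriv) hu (one_mem_uRange E.n)
  linarith

theorem eventually_testSlope_eq {Q : ℝ × ℝ × ℝ → ℝ × ℝ × ℝ} (hQ : E.IsLieSymmetry Q)
    {t₀ x₀ u₀ : ℝ} (hz : (t₀, x₀, u₀) ∈ E.dom) (b a : ℝ) :
    ∀ᶠ x in 𝓝 x₀, sliceChr Q t₀ (testPoly x₀ u₀ b 0 0) (testSlope x₀ a 0) x
      = (Q (t₀, x, 1)).2.2 + pdU (fun z => (Q z).2.2) (t₀, 0, 1) * (u₀ + b * (x - x₀) - 1)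
        - (Q (t₀, x₀, u₀)).1 * a
        - ((Q (t₀, x₀, u₀)).2.1 + xiSlope E Q t₀ * (x - x₀)) * b := by
  obtain ⟨htI, huR⟩ := Equation.mem_dom.1 hz
  have hz0 : (t₀, x₀, testPoly x₀ u₀ b 0 0 x₀) ∈ E.dom := by simpa using hz
  have hc0 := (hasDerivAt_testPoly x₀ u₀ b 0 0 x₀).continuousAt
  filter_upwards [eventually_slice_mem_dom hc0 hz0] with x hx
  have t0 := hQ.tau_eq (x₁ := x) (x₂ := x₀) htI (Equation.mem_dom.1 hx).2 huR
  have s0 := hQ.xi_eq (x₁ := x) (x₂ := x₀) htI (Equation.mem_dom.1 hx).2 huR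
  have r0 := (eq_affine_of_pdU hQ.smooth.snd.snd (fun z hz => (hQ.eta_pd hz).1)
    (fun z hz => (hQ.eta_pd hz).2) htI (Equation.mem_dom.1 hx).2 (x := x)).2
  simp only [sliceChr, testSlope, t0, s0, deriv_testPoly, r0]
  simp only [testPoly]
  ring

/-- Varying u_x from 0 to 1 gives a relation Au^n + Bu^(n−1) + C = 0 for all u > 0; the three
conclusions are B = 0, A = 0 and C = 0. Both exclusions n ≠ 0 and n ≠ 1 are needed for this. -/
theorem Equation.IsLieSymmetry.eta_xi_eq (hQ : E.IsLieSymmetry Q) {t₀ : ℝ} (x₀ : ℝ)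
    (ht : t₀ ∈ E.I) :
    (Q (t₀, x₀, 1)).2.2 = pdU (fun z => (Q z).2.2) (t₀, 0, 1) ∧
    E.n * pdU (fun z => (Q z).2.2) (t₀, 0, 1)
      = xiSlope E Q t₀ - pdT (fun z => (Q z).1) (t₀, 0, 1) ∧
    pdT (fun z => (Q z).2.1) (t₀, x₀, 1) = 0 := by
  have key := rpow_linearIndependent E.n_ne_zero E.n_ne_one
    (A := E.n * pdU (fun z => (Q z).2.2) (t₀, 0, 1) + pdT (fun z => (Q z).1) (t₀, 0, 1)
      - xiSlope E Q t₀)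
    (B := E.n * ((Q (t₀, x₀, 1)).2.2 - pdU (fun z => (Q z).2.2) (t₀, 0, 1)))
    (C := -pdT (fun z => (Q z).2.1) (t₀, x₀, 1)) ?_
  · obtain ⟨hA, hB, hC⟩ := key
    have := (mul_eq_zero.1 hB).resolve_left E.n_ne_zero
    exact ⟨by linarith, by linarith, by linarith⟩
  intro u₀ hu
  have huR : u₀ ∈ uRange E.n := mem_uRange_of_pos hu
  have hz : (t₀, x₀, u₀) ∈ E.dom := Equation.mem_dom.2 ⟨ht, huR⟩
  obtain ⟨a₀, ha₀⟩ : ∃ a, a = -(u₀ ^ E.n * 0 + E.α t₀ * u₀ + E.β t₀ * 0) := ⟨_, rfl⟩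
  obtain ⟨a₁, ha₁⟩ : ∃ a, a = -(u₀ ^ E.n * 1 + E.α t₀ * u₀ + E.β t₀ * 0) := ⟨_, rfl⟩
  have h0 := hQ.testFunction 0 0 0 0 hz ha₀
  have h1 := hQ.testFunction 1 0 0 0 hz ha₁
  obtain ⟨e1, e5⟩ := deriv_eq_of_isLittleO
    (-(Q (t₀, x₀, u₀)).1 * (a₁ - a₀) - (Q (t₀, x₀, u₀)).2.1)
    (pdU (fun z => (Q z).2.2) (t₀, 0, 1) - xiSlope E Q t₀) 0 0 0
    (contDiffAt_sliceChr_test hQ a₁ 1 0 0 0 hz) (contDiffAt_sliceChr_test hQ a₀ 0 0 0 0 hz)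
    ((isLittleO_zero (fun x : ℝ => (x - x₀) ^ 5) (𝓝 x₀)).congr' (f₁ := fun _ => (0 : ℝ)) (by
      filter_upwards [eventually_testSlope_eq hQ hz 0 a₀, eventually_testSlope_eq hQ hz 1 a₁]
        with x hx0 hx1
      rw [hx0, hx1]
      ring) EventuallyEq.rfl)
  have hη := eq_affine_of_pdU hQ.smooth.snd.snd (fun z hz => (hQ.eta_pd hz).1)
    (fun z hz => (hQ.eta_pd hz).2) ht huR (x := x₀)
  have hτ : pdT (fun z => (Q z).1) (t₀, x₀, u₀) = pdT (fun z => (Q z).1) (t₀, 0, 1) :=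
    pdT_eq_of_eq hQ.smooth.fst ht huR (one_mem_uRange _)
      (fun s hs => hQ.tau_eq hs huR (one_mem_uRange _))
  have hξ : pdT (fun z => (Q z).2.1) (t₀, x₀, u₀) = pdT (fun z => (Q z).2.1) (t₀, x₀, 1) :=
    pdT_eq_of_eq hQ.smooth.snd.fst ht huR (one_mem_uRange _)
      (fun s hs => by simpa using hQ.xi_eq hs huR (one_mem_uRange _) (x₁ := x₀) (x₂ := x₀))
  rw [e1, e5] at h1
  rw [(hQ.tau_pd hz).2, (hQ.xi_pd hz).1, hη.1, hη.2, hτ, hξ] at h1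
  rw [(hQ.tau_pd hz).2, (hQ.xi_pd hz).1, hη.1, hη.2, hτ, hξ] at h0
  have hp : u₀ ^ (E.n - 1) * u₀ = u₀ ^ E.n := by
    rw [Real.rpow_sub_one hu.ne']; field_simp
  have hda : a₁ - a₀ = -u₀ ^ E.n := by rw [ha₀, ha₁]; ring
  linear_combination h1 - h0 - (pdU (fun z => (Q z).2.2) (t₀, 0, 1)
    - pdT (fun z => (Q z).1) (t₀, 0, 1)) * hda
    - E.n * pdU (fun z => (Q z).2.2) (t₀, 0, 1) * hp

/-- The general form of the Lie symmetry generators of the equations of the class. -/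
theorem Equation.IsLieSymmetry.exists_form (hQ : E.IsLieSymmetry Q) :
    ∃ (c₀ c₁ : ℝ) (τ σ : ℝ → ℝ),
      (∀ t ∈ E.I, ∀ x, ∀ u ∈ uRange E.n, Q (t, x, u) = (τ t, c₁ * x + c₀, σ t * u)) ∧
      ∀ t ∈ E.I, DifferentiableAt ℝ τ t ∧ DifferentiableAt ℝ σ t ∧
        E.n * σ t = c₁ - deriv τ t ∧
        deriv τ t * E.β t + τ t * deriv E.β t = 5 * c₁ * E.β t ∧
        deriv τ t * E.α t + τ t * deriv E.α t + deriv σ t = 0 := by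
  obtain ⟨t₁, ht₁⟩ := E.isConnected_I.nonempty
  have hmem : ∀ t ∈ E.I, ∀ x, (t, x, (1 : ℝ)) ∈ E.dom :=
    fun t ht x => Equation.mem_dom.2 ⟨ht, one_mem_uRange _⟩
  have hdiff : ∀ t ∈ E.I, ∀ x, DifferentiableAt ℝ Q (t, x, 1) :=
    fun t ht x => differentiableAt_of_contDiffOn E.isOpen_dom hQ.smooth (hmem t ht x)
  have hconst : ∀ x, ∀ t ∈ E.I, (Q (t, x, 1)).2.1 = (Q (t₁, x, 1)).2.1 := by
    intro x t ht
    have hd : ∀ s ∈ E.I, HasDerivAt (fun s => (Q (s, x, 1)).2.1) 0 s := by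
      intro s hs
      have := hasDerivAt_pdT (F := fun z => (Q z).2.1) (hdiff s hs x).snd.fst
      rwa [(hQ.eta_xi_eq x hs).2.2] at this
    exact E.isOpen_I.is_const_of_deriv_eq_zero E.isConnected_I.isPreconnected
      (fun v hv => (hd v hv).differentiableAt.differentiableWithinAt)
      (fun v hv => (hd v hv).deriv) ht ht₁
  have hslope : ∀ t ∈ E.I, xiSlope E Q t = (Q (t₁, 1, 1)).2.1 - (Q (t₁, 0, 1)).2.1 := by
    intro t ht
    have := hQ.xi_eq (x₁ := 1) (x₂ := 0) ht (one_mem_uRange _) (one_mem_uRange _)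
    rw [hconst _ t ht, hconst _ t ht] at this
    linarith
  have hη := fun t ht x u hu => eq_affine_of_pdU hQ.smooth.snd.snd (fun z hz => (hQ.eta_pd hz).1)
    (fun z hz => (hQ.eta_pd hz).2) (t := t) (x := x) (u := u) ht hu
  -- All parameters are read off at u = 1, which lies in the range of u for every n; homogeneity of
  -- η makes its value there equal to σ.
  refine ⟨(Q (t₁, 0, 1)).2.1, (Q (t₁, 1, 1)).2.1 - (Q (t₁, 0, 1)).2.1, fun t => (Q (t, 0, 1)).1,
    fun t => (Q (t, 0, 1)).2.2, ?_, ?_⟩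
  · intro t ht x u hu
    refine Prod.ext ?_ (Prod.ext ?_ ?_)
    · exact hQ.tau_eq ht hu (one_mem_uRange _)
    · have := hQ.xi_eq (x₁ := x) (x₂ := 0) ht hu (one_mem_uRange _)
      rw [hconst _ t ht, hslope t ht] at this
      simp only
      linarith
    · simp only
      rw [(hη t ht x u hu).2, (hQ.eta_xi_eq x ht).1, (hQ.eta_xi_eq 0 ht).1]
      ring
  · intro t ht
    have hτ := hasDerivAt_pdT (F := fun z => (Q z).1) (hdiff t ht 0).fst
    have hσ := hasDerivAt_pdT (F := fun z => (Q z).2.2) (hdiff t ht 0).snd.snd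
    have hβ := E.β_ne_zero t ht
    refine ⟨hτ.differentiableAt, hσ.differentiableAt, ?_, ?_, ?_⟩
    · simp only
      rw [hτ.deriv, (hQ.eta_xi_eq 0 ht).1, (hQ.eta_xi_eq 0 ht).2.1, hslope t ht]
    · simp only
      rw [hτ.deriv, ← hslope t ht, xiSlope]
      field_simp
      ring
    · have hz := hmem t ht 0
      -- The last equation comes from the jet with u = 1, u_t = −α and all x-derivatives zero. There
      -- the characteristic is constant in x, so only the t-derivative and the terms with α survive.
      obtain ⟨a, ha⟩ : ∃ a, a = -((1 : ℝ) ^ E.n * 0 + E.α t * 1 + E.β t * 0) := ⟨_, rfl⟩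
      have h0 := hQ.testFunction 0 0 0 0 hz ha
      obtain ⟨e1, e5⟩ := deriv_eq_of_isLittleO (g := fun _ => (0 : ℝ))
        ((Q (t, 0, 1)).2.2 - (Q (t, 0, 1)).1 * a) 0 0 0 0
        (contDiffAt_sliceChr_test hQ a 0 0 0 0 hz) contDiffAt_const
        ((isLittleO_zero (fun x : ℝ => (x - 0) ^ 5) (𝓝 0)).congr' (f₁ := fun _ => (0 : ℝ)) (by
          filter_upwards [eventually_testSlope_eq hQ hz 0 a] with x hx
          rw [hx, (hQ.eta_xi_eq x ht).1, (hQ.eta_xi_eq 0 ht).1]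
          ring) EventuallyEq.rfl)
      have h5 : iteratedDeriv 5 (fun _ : ℝ => (0 : ℝ)) 0 = 0 := by simp
      rw [e1, e5, (hQ.tau_pd hz).2, (hQ.xi_pd hz).1, deriv_const, h5] at h0
      rw [hτ.deriv, hσ.deriv]
      rw [(hQ.eta_xi_eq 0 ht).1] at h0
      simp only
      rw [ha] at h0
      linear_combination h0

end Determining

/-! ### Functions on the time interval -/

theorem exists_antideriv {I : Set ℝ} (hI : IsOpen I) (hc : IsConnected I) {f : ℝ → ℝ}
    (hf : ContDiffOn ℝ ∞ f I) :
    ∃ F : ℝ → ℝ, ContDiffOn ℝ ∞ F I ∧ ∀ t ∈ I, HasDerivAt F (f t) t := by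
  obtain ⟨t₀, ht₀⟩ := hc.nonempty
  have hd : ∀ t ∈ I, HasDerivAt (fun t => ∫ s in t₀..t, f s) (f t) t := by
    intro t ht
    have hsub : Set.uIcc t₀ t ⊆ I := hc.isPreconnected.ordConnected.uIcc_subset ht₀ ht
    exact intervalIntegral.integral_hasDerivAt_right
      ((hf.continuousOn.mono hsub).intervalIntegrable)
      (hf.continuousOn.stronglyMeasurableAtFilter hI t ht)
      (hf.continuousOn.continuousAt (hI.mem_nhds ht))
  refine ⟨_, ?_, hd⟩
  rw [contDiffOn_infty_iff_deriv_of_isOpen hI]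
  exact ⟨fun t ht => (hd t ht).differentiableAt.differentiableWithinAt,
    hf.congr fun t ht => (hd t ht).deriv⟩

theorem eq_of_hasDerivAt_zero {I : Set ℝ} (hI : IsOpen I) (hc : IsConnected I) {f : ℝ → ℝ}
    (hf : ∀ t ∈ I, HasDerivAt f 0 t) {s t : ℝ} (hs : s ∈ I) (ht : t ∈ I) : f s = f t :=
  hI.is_const_of_deriv_eq_zero hc.isPreconnected
    (fun v hv => (hf v hv).differentiableAt.differentiableWithinAt)
    (fun v hv => (hf v hv).deriv) hs ht

/-- The condition on the coefficients for the equation to be reducible to one with constant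
coefficients. -/
def Equation.IsReducible (E : Equation) : Prop :=
  ∀ t ∈ E.I, deriv E.β t + E.n * E.α t * E.β t = 0

theorem Equation.hasDerivAt_α (E : Equation) {t : ℝ} (ht : t ∈ E.I) :
    HasDerivAt E.α (deriv E.α t) t :=
  (differentiableAt_of_contDiffOn E.isOpen_I E.smooth_α ht).hasDerivAt

theorem Equation.hasDerivAt_β (E : Equation) {t : ℝ} (ht : t ∈ E.I) :
    HasDerivAt E.β (deriv E.β t) t :=
  (differentiableAt_of_contDiffOn E.isOpen_I E.smooth_β ht).hasDerivAt

/-! ### A three-dimensional algebra forces reducibility -/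

/-- The values that determine a Lie symmetry generator. -/
def evalAt (t₀ : ℝ) : (ℝ × ℝ × ℝ → ℝ × ℝ × ℝ) →ₗ[ℝ] ℝ × ℝ × ℝ where
  toFun Q := ((Q (t₀, 0, 1)).2.1, (Q (t₀, 1, 1)).2.1, (Q (t₀, 0, 1)).1)
  map_add' Q R := by simp
  map_smul' c Q := by simp

/-- Vanishing of the three numbers gives c₀ = c₁ = 0 and τ(t₀) = 0. Then τβ is constant, hence zero,
and nσ = c₁ − τ' = 0. This bounds the dimension of any symmetry algebra by three. -/
theorem Equation.IsLieSymmetry.eq_zero_of_evalAt {E : Equation} {Q : ℝ × ℝ × ℝ → ℝ × ℝ × ℝ}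
    (hQ : E.IsLieSymmetry Q) {t₀ : ℝ} (ht₀ : t₀ ∈ E.I) (h : evalAt t₀ Q = 0) : Q = 0 := by
  obtain ⟨c₀, c₁, τ, σ, hform, hdet⟩ := hQ.exists_form
  have hone := one_mem_uRange E.n
  simp only [evalAt, LinearMap.coe_mk, AddHom.coe_mk, hform t₀ ht₀ _ 1 hone, Prod.mk_eq_zero] at h
  have hc₀ : c₀ = 0 := by linarith [h.1]
  have hc₁ : c₁ = 0 := by linarith [h.2.1]
  subst hc₀ hc₁
  have hw : ∀ t ∈ E.I, HasDerivAt (fun t => τ t * E.β t) 0 t := by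
    intro t ht
    obtain ⟨h1, h2, h3, h4, h5⟩ := hdet t ht
    refine (h1.hasDerivAt.fun_mul (E.hasDerivAt_β ht)).congr_deriv ?_
    rw [h4]; ring
  have hτ : ∀ t ∈ E.I, τ t = 0 := by
    intro t ht
    have := eq_of_hasDerivAt_zero E.isOpen_I E.isConnected_I hw ht ht₀
    simp only [h.2.2, zero_mul] at this
    exact (mul_eq_zero.1 this).resolve_right (E.β_ne_zero t ht)
  have hσ : ∀ t ∈ E.I, σ t = 0 := by
    intro t ht
    obtain ⟨h1, h2, h3, h4, h5⟩ := hdet t ht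
    have hd : deriv τ t = 0 := by
      have : τ =ᶠ[𝓝 t] fun _ => 0 := by
        filter_upwards [E.isOpen_I.mem_nhds ht] with s hs using hτ s hs
      rw [this.deriv_eq]; simp
    rw [hd] at h3
    have : E.n * σ t = 0 := by linarith
    exact (mul_eq_zero.1 this).resolve_left E.n_ne_zero
  ext1 z
  by_cases hz : z ∈ E.dom
  · obtain ⟨t, x, u⟩ := z
    obtain ⟨ht, hu⟩ := Equation.mem_dom.1 hz
    rw [hform t ht x u hu, hτ t ht, hσ t ht]
    simp
  · exact hQ.eq_zero z hz

/-- In dimension three the parameters c₀, c₁, τ(t₀) take all values, so there are generators with c₁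
= 0, τ₁(t₀) = 1 and with c₁ = 1, τ₂(t₀) = 0. The constants K₁, K₂ attached to them satisfy (K₂ +
4)β(t₀) = K₁τ₂β. Since (τ₂β)' = 5β ≠ 0, K₁ = 0, that is τ₁' = nατ₁; with τ₁β constant this is the
relation. The closure under brackets plays no role. -/
theorem Equation.isReducible_of_finrank {E : Equation}
    {g : Submodule ℝ (ℝ × ℝ × ℝ → ℝ × ℝ × ℝ)} (hg : ∀ Q ∈ g, E.IsLieSymmetry Q)
    (h3 : Module.finrank ℝ g = 3) : E.IsReducible := by
  obtain ⟨t₀, ht₀⟩ := E.isConnected_I.nonempty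
  have : FiniteDimensional ℝ g := FiniteDimensional.of_finrank_pos (by omega)
  have hinj : Function.Injective ((evalAt t₀).domRestrict g) := by
    rw [injective_iff_map_eq_zero]
    intro Q hQ
    exact Subtype.ext ((hg Q.1 Q.2).eq_zero_of_evalAt ht₀ hQ)
  have hsurj := (LinearMap.injective_iff_surjective_of_finrank_eq_finrank
    (by rw [h3]; simp)).1 hinj
  have hone := one_mem_uRange E.n
  obtain ⟨⟨Q₁, hQ₁g⟩, hQ₁⟩ := hsurj (0, 0, 1)
  obtain ⟨⟨Q₂, hQ₂g⟩, hQ₂⟩ := hsurj (0, 1, 0)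
  obtain ⟨c₀, c₁, τ₁, σ₁, hform₁, hdet₁⟩ := (hg Q₁ hQ₁g).exists_form
  obtain ⟨d₀, d₁, τ₂, σ₂, hform₂, hdet₂⟩ := (hg Q₂ hQ₂g).exists_form
  simp only [LinearMap.domRestrict_apply, evalAt, LinearMap.coe_mk, AddHom.coe_mk,
    hform₁ t₀ ht₀ _ 1 hone, Prod.mk.injEq] at hQ₁
  simp only [LinearMap.domRestrict_apply, evalAt, LinearMap.coe_mk, AddHom.coe_mk,
    hform₂ t₀ ht₀ _ 1 hone, Prod.mk.injEq] at hQ₂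
  have hc₁ : c₁ = 0 := by linarith [hQ₁.1, hQ₁.2.1]
  have hd₁ : d₁ = 1 := by linarith [hQ₂.1, hQ₂.2.1]
  have hτt₀ : τ₁ t₀ = 1 := hQ₁.2.2
  subst hc₁ hd₁
  have hw₁ : ∀ t ∈ E.I, τ₁ t * E.β t = E.β t₀ := by
    intro t ht
    have : ∀ t ∈ E.I, HasDerivAt (fun t => τ₁ t * E.β t) 0 t := by
      intro t ht
      obtain ⟨h1, h2, h3, h4, h5⟩ := hdet₁ t ht
      refine (h1.hasDerivAt.fun_mul (E.hasDerivAt_β ht)).congr_deriv ?_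
      rw [h4]; ring
    have := eq_of_hasDerivAt_zero E.isOpen_I E.isConnected_I this ht ht₀
    simpa [hτt₀] using this
  have hK : ∀ {c : ℝ} {τ σ : ℝ → ℝ}, (∀ t ∈ E.I, DifferentiableAt ℝ τ t ∧ DifferentiableAt ℝ σ t ∧
        E.n * σ t = c - deriv τ t ∧
        deriv τ t * E.β t + τ t * deriv E.β t = 5 * c * E.β t ∧
        deriv τ t * E.α t + τ t * deriv E.α t + deriv σ t = 0) →
      ∃ K, ∀ t ∈ E.I, E.n * E.α t * τ t + c - deriv τ t = K := by
    intro c τ σ hdet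
    -- The third determining equation says that τα + σ is constant; the claim follows on multiplying
    -- by n and substituting nσ = c − τ'.
    refine ⟨E.n * (τ t₀ * E.α t₀ + σ t₀), fun t ht => ?_⟩
    have : ∀ t ∈ E.I, HasDerivAt (fun t => τ t * E.α t + σ t) 0 t := by
      intro t ht
      obtain ⟨h1, h2, h3, h4, h5⟩ := hdet t ht
      refine ((h1.hasDerivAt.fun_mul (E.hasDerivAt_α ht)).fun_add h2.hasDerivAt).congr_deriv h5
    have h := eq_of_hasDerivAt_zero E.isOpen_I E.isConnected_I this ht ht₀
    rw [← h]
    linear_combination -(hdet t ht).2.2.1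
  obtain ⟨K₁, hK₁⟩ := hK hdet₁
  obtain ⟨K₂, hK₂⟩ := hK hdet₂
  have hrel : ∀ t ∈ E.I, (K₂ + 4) * E.β t₀ = K₁ * (τ₂ t * E.β t) := by
    intro t ht
    rw [← hw₁ t ht, ← hK₁ t ht, ← hK₂ t ht]
    linear_combination τ₂ t * (hdet₁ t ht).2.2.2.1 - τ₁ t * (hdet₂ t ht).2.2.2.1
  have hK₁0 : K₁ = 0 := by
    obtain ⟨h1, h2, h3, h4, h5⟩ := hdet₂ t₀ ht₀
    have hd : HasDerivAt (fun t => K₁ * (τ₂ t * E.β t)) (K₁ * (5 * 1 * E.β t₀)) t₀ := by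
      rw [← h4]
      exact (h1.hasDerivAt.fun_mul (E.hasDerivAt_β ht₀)).const_mul K₁
    have hd' : HasDerivAt (fun t => K₁ * (τ₂ t * E.β t)) 0 t₀ := by
      refine (hasDerivAt_const t₀ ((K₂ + 4) * E.β t₀)).congr_of_eventuallyEq ?_
      filter_upwards [E.isOpen_I.mem_nhds ht₀] with s hs using (hrel s hs).symm
    have := hd.unique hd'
    have hβ := E.β_ne_zero t₀ ht₀
    simpa [hβ] using this
  intro t ht
  have hβ₀ := E.β_ne_zero t₀ ht₀
  have hk := hK₁ t ht
  have : E.β t₀ * (deriv E.β t + E.n * E.α t * E.β t) = 0 := by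
    rw [← hw₁ t ht]
    rw [hK₁0] at hk
    linear_combination E.β t * (hdet₁ t ht).2.2.2.1 + E.β t ^ 2 * hk
  exact (mul_eq_zero.1 this).resolve_left hβ₀

/-! ### Vector fields of the general form are Lie symmetry generators -/

/-- Leibniz's rule stops after two terms, because one factor is affine. -/
theorem iteratedDeriv_affine_mul (c₀ c₁ : ℝ) {f : ℝ → ℝ} (hf : ContDiff ℝ ∞ f) (k : ℕ) :
    iteratedDeriv (k + 1) (fun x => (c₁ * x + c₀) * f x)
      = fun x => (c₁ * x + c₀) * iteratedDeriv (k + 1) f x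
        + (k + 1) * c₁ * iteratedDeriv k f x := by
  have hd : ∀ k x, HasDerivAt (iteratedDeriv k f) (iteratedDeriv (k + 1) f x) x := by
    intro k x
    rw [iteratedDeriv_succ]
    exact ((contDiff_iteratedDeriv hf k).differentiable (by simp) x).hasDerivAt
  have ha : ∀ x, HasDerivAt (fun x => c₁ * x + c₀) c₁ x := by
    intro x; simpa using ((hasDerivAt_id x).const_mul c₁).add_const c₀
  induction k with
  | zero =>
    ext x
    rw [zero_add, iteratedDeriv_one]
    have h := (ha x).fun_mul (hd 0 x)
    simp only [iteratedDeriv_zero] at h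
    rw [h.deriv]
    simp
    ring
  | succ k ih =>
    ext x
    rw [iteratedDeriv_succ, ih]
    have h := ((ha x).fun_mul (hd (k + 1) x)).fun_add ((hd k x).const_mul ((k + 1) * c₁))
    rw [h.deriv]
    push_cast
    ring

/-- The vector field `τ(t) ∂_t + (c₁ x + c₀) ∂_x + σ(t) u ∂_u` on the domain of the equation. -/
noncomputable def formField (E : Equation) (τ σ : ℝ → ℝ) (c₀ c₁ : ℝ) (z : ℝ × ℝ × ℝ) : ℝ × ℝ × ℝ :=
  open Classical in if z ∈ E.dom then (τ z.1, c₁ * z.2.1 + c₀, σ z.1 * z.2.2) else 0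

section FormField

variable {E : Equation} {τ σ : ℝ → ℝ} {c₀ c₁ : ℝ}

theorem formField_of_mem {z : ℝ × ℝ × ℝ} (hz : z ∈ E.dom) :
    formField E τ σ c₀ c₁ z = (τ z.1, c₁ * z.2.1 + c₀, σ z.1 * z.2.2) := if_pos hz

theorem formField_of_notMem {z : ℝ × ℝ × ℝ} (hz : z ∉ E.dom) : formField E τ σ c₀ c₁ z = 0 :=
  if_neg hz

theorem contDiffOn_formField (hτ : ContDiffOn ℝ ∞ τ E.I) (hσ : ContDiffOn ℝ ∞ σ E.I) :
    ContDiffOn ℝ ∞ (formField E τ σ c₀ c₁) E.dom := by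
  have h1 : ContDiffOn ℝ ∞ (fun z : ℝ × ℝ × ℝ => τ z.1) E.dom :=
    hτ.comp contDiff_fst.contDiffOn fun z hz => hz.1
  have h2 : ContDiffOn ℝ ∞ (fun z : ℝ × ℝ × ℝ => σ z.1) E.dom :=
    hσ.comp contDiff_fst.contDiffOn fun z hz => hz.1
  have h3 : ContDiffOn ℝ ∞ (fun z : ℝ × ℝ × ℝ => (τ z.1, c₁ * z.2.1 + c₀, σ z.1 * z.2.2)) E.dom :=
    h1.prodMk ((by fun_prop : ContDiffOn ℝ ∞ (fun z : ℝ × ℝ × ℝ => c₁ * z.2.1 + c₀) E.dom).prodMk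
      (h2.mul (by fun_prop)))
  exact h3.congr fun z hz => formField_of_mem hz

/-- Under the determining equations the prolonged field multiplies the left-hand side of the
equation by σ − τ', so it vanishes wherever the equation holds. -/
theorem isLieSymmetry_formField (hτ : ContDiffOn ℝ ∞ τ E.I) (hσ : ContDiffOn ℝ ∞ σ E.I)
    (hdet : ∀ t ∈ E.I, E.n * σ t = c₁ - deriv τ t ∧
        deriv τ t * E.β t + τ t * deriv E.β t = 5 * c₁ * E.β t ∧
        deriv τ t * E.α t + τ t * deriv E.α t + deriv σ t = 0) :
    E.IsLieSymmetry (formField E τ σ c₀ c₁) := by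
  refine ⟨contDiffOn_formField hτ hσ, fun z hz => formField_of_notMem hz, ?_⟩
  intro u hu p hp hl
  set Q := formField E τ σ c₀ c₁ with hQdef
  set S := graphPt u ⁻¹' E.dom
  have hS : IsOpen S := isOpen_graphPt_preimage E hu.continuous
  have hpS : p ∈ S := hp
  have hQ : ∀ q ∈ S, Q (graphPt u q) = (τ q.1, c₁ * q.2 + c₀, σ q.1 * u q) :=
    fun q hq => formField_of_mem hq
  have hchr : ContDiffOn ℝ ∞ (chr Q u) S := contDiffOn_chr (contDiffOn_formField hτ hσ) hu
  have hchr_eq : ∀ q ∈ S, chr Q u q = σ q.1 * u q - τ q.1 * dt u q - (c₁ * q.2 + c₀) * dx u q := by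
    intro q hq
    simp only [chr, eta, tau, xi, hQ q hq]
  have huS : ContDiffOn ℝ ∞ u Set.univ := hu.contDiffOn
  have hdtu := contDiffOn_dt isOpen_univ huS
  have hdxu := contDiffOn_dx isOpen_univ huS
  have hslice : ∀ {f : ℝ × ℝ → ℝ}, ContDiffOn ℝ ∞ f Set.univ →
      ContDiff ℝ ∞ (fun x => f (p.1, x)) := fun hf =>
    (contDiffOn_univ.1 hf).comp (by fun_prop)
  have hDk : ∀ k, dx^[k + 1] (chr Q u) p = σ p.1 * dx^[k + 1] u p - τ p.1 * dt (dx^[k + 1] u) p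
      - ((c₁ * p.2 + c₀) * dx (dx^[k + 1] u) p + (k + 1) * c₁ * dx^[k + 1] u p) := by
    intro k
    have hs1 := (hslice huS).of_le (ENat.LEInfty.out : ((k + 1 : ℕ) : ℕ∞ω) ≤ ∞)
    have hs2 := (hslice hdtu).of_le (ENat.LEInfty.out : ((k + 1 : ℕ) : ℕ∞ω) ≤ ∞)
    have hs3 := (hslice hdxu).of_le (ENat.LEInfty.out : ((k + 1 : ℕ) : ℕ∞ω) ≤ ∞)
    rw [dx_iterate_eq hS hchr _ p hpS]
    have hev : (fun x => chr Q u (p.1, x)) =ᶠ[𝓝 p.2] fun x =>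
        σ p.1 * u (p.1, x) - τ p.1 * dt u (p.1, x) - (c₁ * x + c₀) * dx u (p.1, x) := by
      filter_upwards [eventually_mem_slice hS hpS] with x hx using hchr_eq _ hx
    have k1 := (contDiffAt_const (c := σ p.1)).mul (hs1.contDiffAt (x := p.2))
    have k2 := (contDiffAt_const (c := τ p.1)).mul (hs2.contDiffAt (x := p.2))
    rw [hev.iteratedDeriv_eq, iteratedDeriv_fun_sub (k1.sub k2)
        ((by fun_prop : ContDiff ℝ _ fun x => c₁ * x + c₀).mul hs3).contDiffAt,
      iteratedDeriv_fun_sub k1 k2, iteratedDeriv_const_mul_field,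
      iteratedDeriv_const_mul_field, iteratedDeriv_affine_mul c₀ c₁ (hslice hdxu) k]
    simp only
    rw [← dx_iterate_eq isOpen_univ huS (k + 1) p trivial,
      ← dx_iterate_eq isOpen_univ hdtu (k + 1) p trivial,
      ← dx_iterate_eq isOpen_univ hdxu (k + 1) p trivial,
      ← dx_iterate_eq isOpen_univ hdxu k p trivial,
      ← dt_dx_iterate_comm isOpen_univ huS (k + 1) p trivial,
      ← Function.iterate_succ_apply' dx (k + 1), Function.iterate_succ_apply dx (k + 1) u,
      Function.iterate_succ_apply dx k u]
  have hI : p.1 ∈ E.I := (Equation.mem_dom.1 hp).1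
  have hτd := (differentiableAt_of_contDiffOn E.isOpen_I hτ hI).hasDerivAt
  have hσd := (differentiableAt_of_contDiffOn E.isOpen_I hσ hI).hasDerivAt
  have hDt : dt (chr Q u) p = deriv σ p.1 * u p + σ p.1 * dt u p
      - (deriv τ p.1 * dt u p + τ p.1 * dt (dt u) p) - (c₁ * p.2 + c₀) * dx (dt u) p := by
    rw [← (hasDerivAt_dt (differentiableAt_of_contDiffOn hS hchr hpS)).deriv]
    have hu1 := hasDerivAt_dt (differentiableAt_of_contDiffOn isOpen_univ huS (Set.mem_univ p))
    have hu2 := hasDerivAt_dt (differentiableAt_of_contDiffOn isOpen_univ hdtu (Set.mem_univ p))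
    have hu3 := hasDerivAt_dt (differentiableAt_of_contDiffOn isOpen_univ hdxu (Set.mem_univ p))
    have h4 := ((hσd.fun_mul hu1).fun_sub (hτd.fun_mul hu2)).fun_sub
      (hu3.const_mul (c₁ * p.2 + c₀))
    rw [dt_dx_comm isOpen_univ huS (Set.mem_univ p)] at h4
    have hct : ContinuousAt (fun t : ℝ => (t, p.2)) p.1 := by fun_prop
    have h5 := h4.congr_of_eventuallyEq (f₁ := fun t => chr Q u (t, p.2)) (by
      filter_upwards [hct (hS.mem_nhds hpS)] with t ht using hchr_eq _ ht)
    exact h5.deriv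
  obtain ⟨d1, d2, d3⟩ := hdet p.1 hI
  -- For a natural exponent u may vanish; the identity then holds because n ≠ 0 makes 0^n zero.
  have hpow : u p * u p ^ (E.n - 1) = u p ^ E.n := by
    rcases eq_or_ne (u p) 0 with h | h
    · rw [h, Real.zero_rpow E.n_ne_zero, zero_mul]
    · rw [Real.rpow_sub_one h]; field_simp
  have h1 := hDk 0
  have h5 := hDk 4
  simp only [zero_add, Function.iterate_one, CharP.cast_eq_zero] at h1
  norm_num only at h5
  unfold Equation.prolongLhs prolongT prolongX
  unfold Equation.lhs at hl
  simp only [tau, xi, eta, hQ p hpS, Function.iterate_one]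
  rw [hDt, h1, h5]
  linear_combination (σ p.1 - deriv τ p.1) * hl + u p * d3 + dx^[5] u p * d2
    + u p ^ E.n * dx u p * d1 + σ p.1 * E.n * dx u p * hpow

theorem fderiv_formField (hτ : ContDiffOn ℝ ∞ τ E.I) (hσ : ContDiffOn ℝ ∞ σ E.I) {z : ℝ × ℝ × ℝ}
    (hz : z ∈ E.dom) (v : ℝ × ℝ × ℝ) :
    fderiv ℝ (formField E τ σ c₀ c₁) z v =
      (deriv τ z.1 * v.1, c₁ * v.2.1, deriv σ z.1 * v.1 * z.2.2 + σ z.1 * v.2.2) := by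
  have hd := differentiableAt_of_contDiffOn E.isOpen_dom
    (contDiffOn_formField hτ hσ (c₀ := c₀) (c₁ := c₁)) hz
  have hcurve : HasDerivAt (fun s : ℝ => z + s • v) v 0 := by
    simpa using ((hasDerivAt_id (0 : ℝ)).smul_const v).const_add z
  have h1 : HasDerivAt (fun s : ℝ => formField E τ σ c₀ c₁ (z + s • v))
      (fderiv ℝ (formField E τ σ c₀ c₁) z v) 0 := by
    have hd' : HasFDerivAt (formField E τ σ c₀ c₁) (fderiv ℝ (formField E τ σ c₀ c₁) z)
      (z + (0 : ℝ) • v) := by simpa using hd.hasFDerivAt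
    exact hd'.comp_hasDerivAt (0 : ℝ) hcurve
  have hI : z.1 ∈ E.I := hz.1
  have hτd := (differentiableAt_of_contDiffOn E.isOpen_I hτ hI).hasDerivAt
  have hσd := (differentiableAt_of_contDiffOn E.isOpen_I hσ hI).hasDerivAt
  have c1 : ∀ a b : ℝ, HasDerivAt (fun s : ℝ => a + s * b) b 0 := fun a b => by
    simpa using ((hasDerivAt_id (0 : ℝ)).mul_const b).const_add a
  have k1 : HasDerivAt (fun s : ℝ => τ (z.1 + s * v.1)) (deriv τ z.1 * v.1) 0 :=
    HasDerivAt.comp (0 : ℝ) (by simpa using hτd) (c1 z.1 v.1)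
  have k2 : HasDerivAt (fun s : ℝ => σ (z.1 + s * v.1)) (deriv σ z.1 * v.1) 0 :=
    HasDerivAt.comp (0 : ℝ) (by simpa using hσd) (c1 z.1 v.1)
  have k3 := k1.prodMk ((((c1 z.2.1 v.2.1).const_mul c₁).add_const c₀).prodMk
    (k2.fun_mul (c1 z.2.2 v.2.2)))
  have hev : (fun s : ℝ => formField E τ σ c₀ c₁ (z + s • v)) =ᶠ[𝓝 0] fun s =>
      (τ (z.1 + s * v.1), c₁ * (z.2.1 + s * v.2.1) + c₀,
        σ (z.1 + s * v.1) * (z.2.2 + s * v.2.2)) := by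
    have : ∀ᶠ s : ℝ in 𝓝 0, z + s • v ∈ E.dom :=
      hcurve.continuousAt (by simpa using E.isOpen_dom.mem_nhds hz)
    filter_upwards [this] with s hs
    rw [formField_of_mem hs]
    simp
  have := h1.unique (k3.congr_of_eventuallyEq hev)
  rw [this]
  simp

end FormField

/-! ### The maximal algebra of a reducible equation -/

section Maximal

variable {E : Equation} {B : ℝ → ℝ}

/-- The general solution `τ` of `(τ β)' = 5 c₁ β`, where `B` is an antiderivative of `β`. -/
noncomputable def tauOf (E : Equation) (B : ℝ → ℝ) (c₁ c₂ t : ℝ) : ℝ :=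
  (5 * c₁ * B t + c₂) / E.β t

/-- The coefficient of `u ∂_u` in a Lie symmetry generator. -/
noncomputable def sigmaOf (E : Equation) (B : ℝ → ℝ) (c₁ c₂ t : ℝ) : ℝ :=
  -(4 * c₁ / E.n) - E.α t * tauOf E B c₁ c₂ t

theorem contDiffOn_tauOf (hB : ContDiffOn ℝ ∞ B E.I) (c₁ c₂ : ℝ) :
    ContDiffOn ℝ ∞ (tauOf E B c₁ c₂) E.I :=
  ((contDiffOn_const.mul hB).add contDiffOn_const).div E.smooth_β E.β_ne_zero

theorem contDiffOn_sigmaOf (hB : ContDiffOn ℝ ∞ B E.I) (c₁ c₂ : ℝ) :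
    ContDiffOn ℝ ∞ (sigmaOf E B c₁ c₂) E.I :=
  contDiffOn_const.sub (E.smooth_α.mul (contDiffOn_tauOf hB c₁ c₂))

/-- The relation β' = −nαβ turns (τβ)' = 5c₁β into τ' = 5c₁ + nατ. With nσ = c₁ − τ' this explains
`sigmaOf`: σ + ατ is the constant −4c₁ / n, so the third determining equation is automatic. -/
theorem hasDerivAt_tauOf (hE : E.IsReducible) (hB : ∀ t ∈ E.I, HasDerivAt B (E.β t) t) (c₁ c₂ : ℝ)
    {t : ℝ} (ht : t ∈ E.I) :
    HasDerivAt (tauOf E B c₁ c₂) (5 * c₁ + E.n * E.α t * tauOf E B c₁ c₂ t) t := by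
  have hβ := E.β_ne_zero t ht
  refine ((((hB t ht).const_mul (5 * c₁)).add_const c₂).fun_div (E.hasDerivAt_β ht)
    hβ).congr_deriv ?_
  have h := hE t ht
  rw [tauOf, show deriv E.β t = -(E.n * E.α t * E.β t) by linarith]
  field_simp
  ring

theorem hasDerivAt_sigmaOf (hE : E.IsReducible) (hB : ∀ t ∈ E.I, HasDerivAt B (E.β t) t)
    (c₁ c₂ : ℝ) {t : ℝ} (ht : t ∈ E.I) :
    HasDerivAt (sigmaOf E B c₁ c₂) (-(deriv E.α t * tauOf E B c₁ c₂ t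
      + E.α t * (5 * c₁ + E.n * E.α t * tauOf E B c₁ c₂ t))) t :=
  (((E.hasDerivAt_α ht).fun_mul (hasDerivAt_tauOf hE hB c₁ c₂ ht)).const_sub
    (-(4 * c₁ / E.n)))

/-- The Lie symmetry generators of a reducible equation, as a linear function of the parameters. -/
noncomputable def symmetryField (E : Equation) (B : ℝ → ℝ) :
    ℝ × ℝ × ℝ →ₗ[ℝ] (ℝ × ℝ × ℝ → ℝ × ℝ × ℝ) where
  toFun c := formField E (tauOf E B c.2.1 c.2.2) (sigmaOf E B c.2.1 c.2.2) c.1 c.2.1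
  map_add' c d := by
    ext1 z
    by_cases hz : z ∈ E.dom
    · simp only [Pi.add_apply, formField_of_mem hz, tauOf, sigmaOf, Prod.fst_add, Prod.snd_add,
        Prod.mk_add_mk, Prod.mk.injEq]
      refine ⟨by ring, by ring, by ring⟩
    · simp [formField_of_notMem hz]
  map_smul' r c := by
    ext1 z
    by_cases hz : z ∈ E.dom
    · simp only [Pi.smul_apply, formField_of_mem hz, tauOf, sigmaOf, Prod.smul_fst, Prod.smul_snd,
        Prod.smul_mk, Prod.mk.injEq, smul_eq_mul, RingHom.id_apply]
      refine ⟨by ring, by ring, by ring⟩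
    · simp [formField_of_notMem hz]

theorem symmetryField_apply (c : ℝ × ℝ × ℝ) : symmetryField E B c =
    formField E (tauOf E B c.2.1 c.2.2) (sigmaOf E B c.2.1 c.2.2) c.1 c.2.1 := rfl

theorem symmetryField_injective (E : Equation) (B : ℝ → ℝ) :
    Function.Injective (symmetryField E B) := by
  rw [injective_iff_map_eq_zero]
  intro c hc
  obtain ⟨t, ht⟩ := E.isConnected_I.nonempty
  have h := fun x => congrFun hc (t, x, 1)
  have hmem : ∀ x, (t, x, (1 : ℝ)) ∈ E.dom := fun x => Equation.mem_dom.2 ⟨ht, one_mem_uRange _⟩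
  simp only [symmetryField_apply, formField_of_mem (hmem _), Pi.zero_apply, Prod.mk_eq_zero] at h
  have h0 : c.1 = 0 := by simpa using (h 0).2.1
  have h1 : c.2.1 = 0 := by simpa [h0] using (h 1).2.1
  have h2 := (h 0).1
  rw [tauOf, h1, div_eq_zero_iff] at h2
  have h3 : c.2.2 = 0 := by simpa [E.β_ne_zero t ht] using h2
  exact Prod.ext h0 (Prod.ext h1 h3)

theorem isLieSymmetry_symmetryField (hE : E.IsReducible) (hBs : ContDiffOn ℝ ∞ B E.I)
    (hB : ∀ t ∈ E.I, HasDerivAt B (E.β t) t) (c : ℝ × ℝ × ℝ) :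
    E.IsLieSymmetry (symmetryField E B c) := by
  refine isLieSymmetry_formField (contDiffOn_tauOf hBs _ _) (contDiffOn_sigmaOf hBs _ _) ?_
  intro t ht
  have hτ := hasDerivAt_tauOf hE hB c.2.1 c.2.2 ht
  have hσ := hasDerivAt_sigmaOf hE hB c.2.1 c.2.2 ht
  have h := hE t ht
  have hn := E.n_ne_zero
  refine ⟨?_, ?_, ?_⟩
  · rw [hτ.deriv, sigmaOf]
    field_simp
    ring
  · rw [hτ.deriv]
    linear_combination tauOf E B c.2.1 c.2.2 t * h
  · rw [hτ.deriv, hσ.deriv]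
    ring

/-- For any generator τβ − 5c₁B is constant. Its value is the third parameter, and then σ is forced
by nσ = c₁ − τ'. -/
theorem Equation.IsLieSymmetry.mem_range (hE : E.IsReducible)
    (hB : ∀ t ∈ E.I, HasDerivAt B (E.β t) t) {Q : ℝ × ℝ × ℝ → ℝ × ℝ × ℝ} (hQ : E.IsLieSymmetry Q) :
    Q ∈ (symmetryField E B).range := by
  obtain ⟨c₀, c₁, τ, σ, hform, hdet⟩ := hQ.exists_form
  obtain ⟨t₀, ht₀⟩ := E.isConnected_I.nonempty
  have hw : ∀ t ∈ E.I, HasDerivAt (fun t => τ t * E.β t - 5 * c₁ * B t) 0 t := by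
    intro t ht
    obtain ⟨h1, h2, h3, h4, h5⟩ := hdet t ht
    refine ((h1.hasDerivAt.fun_mul (E.hasDerivAt_β ht)).fun_sub
      ((hB t ht).const_mul (5 * c₁))).congr_deriv ?_
    rw [h4]; ring
  refine ⟨(c₀, c₁, τ t₀ * E.β t₀ - 5 * c₁ * B t₀), ?_⟩
  ext1 z
  rw [symmetryField_apply]
  by_cases hz : z ∈ E.dom
  · obtain ⟨t, x, u⟩ := z
    obtain ⟨ht, hu⟩ := Equation.mem_dom.1 hz
    obtain ⟨h1, h2, h3, h4, h5⟩ := hdet t ht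
    have hβ := E.β_ne_zero t ht
    have hn := E.n_ne_zero
    have hτ : tauOf E B c₁ (τ t₀ * E.β t₀ - 5 * c₁ * B t₀) t = τ t := by
      have := eq_of_hasDerivAt_zero E.isOpen_I E.isConnected_I hw ht ht₀
      rw [tauOf, ← this]
      field_simp
      ring
    have hσ : sigmaOf E B c₁ (τ t₀ * E.β t₀ - 5 * c₁ * B t₀) t = σ t := by
      rw [sigmaOf, hτ]
      have h := hE t ht
      have h6 : deriv τ t = 5 * c₁ + E.n * E.α t * τ t := by
        apply mul_right_cancel₀ hβ
        linear_combination h4 - τ t * h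
      rw [h6] at h3
      field_simp
      linear_combination -h3
    rw [hform t ht x u hu, formField_of_mem hz]
    simp only [hτ, hσ]
  · rw [formField_of_notMem hz, hQ.eq_zero z hz]

theorem lieBracket_symmetryField (hE : E.IsReducible) (hBs : ContDiffOn ℝ ∞ B E.I)
    (hB : ∀ t ∈ E.I, HasDerivAt B (E.β t) t) (c d : ℝ × ℝ × ℝ) :
    VectorField.lieBracket ℝ (symmetryField E B c) (symmetryField E B d)
      = symmetryField E B (d.2.1 * c.1 - c.2.1 * d.1, 0, 5 * (d.2.1 * c.2.2 - c.2.1 * d.2.2)) := by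
  ext1 z
  rw [VectorField.lieBracket]
  simp only [symmetryField_apply]
  by_cases hz : z ∈ E.dom
  · have ht : z.1 ∈ E.I := hz.1
    have hβ := E.β_ne_zero _ ht
    rw [fderiv_formField (contDiffOn_tauOf hBs _ _) (contDiffOn_sigmaOf hBs _ _) hz,
      fderiv_formField (contDiffOn_tauOf hBs _ _) (contDiffOn_sigmaOf hBs _ _) hz,
      (hasDerivAt_tauOf hE hB _ _ ht).deriv, (hasDerivAt_tauOf hE hB _ _ ht).deriv,
      (hasDerivAt_sigmaOf hE hB _ _ ht).deriv, (hasDerivAt_sigmaOf hE hB _ _ ht).deriv]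
    simp only [formField_of_mem hz, Prod.mk_sub_mk, Prod.mk.injEq, sigmaOf]
    have hτ : tauOf E B 0 (5 * (d.2.1 * c.2.2 - c.2.1 * d.2.2)) z.1
        = 5 * d.2.1 * tauOf E B c.2.1 c.2.2 z.1 - 5 * c.2.1 * tauOf E B d.2.1 d.2.2 z.1 := by
      simp only [tauOf]
      ring
    rw [hτ]
    refine ⟨by ring, by ring, by ring⟩
  -- Off the domain both fields take the value 0, so each derivative in the bracket is applied to
  -- the zero vector; differentiability there is irrelevant.
  · simp [formField_of_notMem hz]

/-- The relation makes the explicit three-parameter family consist of symmetries; it exhausts them,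
is closed under brackets, and is parametrized injectively. -/
theorem Equation.IsReducible.exists_maximal (hE : E.IsReducible) :
    ∃ g, E.IsMaximalLieSymmetryAlgebra g ∧ Module.finrank ℝ g = 3 := by
  obtain ⟨B, hBs, hB⟩ := exists_antideriv E.isOpen_I E.isConnected_I E.smooth_β
  refine ⟨(symmetryField E B).range, ⟨⟨?_, ?_⟩, fun Q hQ => hQ.mem_range hE hB⟩, ?_⟩
  · rintro _ ⟨c, rfl⟩
    exact isLieSymmetry_symmetryField hE hBs hB c
  · rintro _ ⟨c, rfl⟩ _ ⟨d, rfl⟩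
    exact ⟨_, (lieBracket_symmetryField hE hBs hB c d).symm⟩
  · rw [LinearMap.finrank_range_of_inj (symmetryField_injective E B)]
    simp

end Maximal

/-! ### Reduction to constant coefficients -/

/-- A negative u occurs only for natural n, where the real power is an ordinary one. -/
theorem mul_rpow_of_mem_uRange {n a u : ℝ} (ha : 0 < a) (hu : u ∈ uRange n) :
    (a * u) ^ n = a ^ n * u ^ n := by
  rcases hu with hu | ⟨k, rfl⟩
  · exact Real.mul_rpow ha.le hu.le
  · simp only [Real.rpow_natCast, mul_pow]

theorem mul_mem_uRange {n a u : ℝ} (ha : 0 < a) (hu : u ∈ uRange n) : a * u ∈ uRange n := by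
  rcases hu with hu | hk
  · exact Or.inl (mul_pos ha hu)
  · exact Or.inr hk

/-- A smooth function with positive derivative on an interval is a diffeomorphism onto its image. -/
theorem exists_openPartialHomeomorph_of_deriv_pos {I : Set ℝ} (hI : IsOpen I) (hc : IsConnected I)
    {T T' : ℝ → ℝ} (hT : ContDiffOn ℝ ∞ T I) (hd : ∀ t ∈ I, HasDerivAt T (T' t) t)
    (hpos : ∀ t ∈ I, 0 < T' t) :
    ∃ e : OpenPartialHomeomorph ℝ ℝ, e.source = I ∧ ⇑e = T ∧ ContDiffOn ℝ ∞ e.symm e.target := by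
  have hmono : StrictMonoOn T I := by
    refine strictMonoOn_of_deriv_pos hc.isPreconnected.ordConnected.convex hT.continuousOn ?_
    intro t ht
    have ht' := interior_subset ht
    rw [(hd t ht').deriv]
    exact hpos t ht'
  have hopen : IsOpenMap (I.domRestrict T) := by
    rw [isOpenMap_iff_nhds_le]
    rintro ⟨t, ht⟩
    have hs : HasStrictDerivAt T (T' t) t :=
      (hT.contDiffAt (hI.mem_nhds ht)).hasStrictDerivAt' (hd t ht) (by simp)
    rw [show I.domRestrict T = T ∘ Subtype.val from rfl, ← Filter.map_map,
      map_nhds_subtype_val, hI.nhdsWithin_eq ht, hs.map_nhds_eq (hpos t ht).ne']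
    exact le_rfl
  let e := OpenPartialHomeomorph.ofContinuousOpenRestrict (hmono.injOn.toPartialEquiv T I)
    hT.continuousOn hopen hI
  refine ⟨e, rfl, rfl, ?_⟩
  intro y hy
  have ht : e.symm y ∈ I := e.map_target hy
  exact (e.contDiffAt_symm_deriv (hpos _ ht).ne' hy (hd _ ht)
    (hT.contDiffAt (hI.mem_nhds ht))).contDiffWithinAt

/-- The factor e^A with A' = α absorbs the damping term; it is positive, hence preserves the range
of u. It multiplies the nonlinear term by e^(nA), which the new time with T' = e^(−nA) compensates.
The coefficient of the fifth derivative becomes βe^(nA), a constant by the relation. -/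
theorem Equation.IsReducible.exists_constantCoeff {E : Equation} (hE : E.IsReducible) :
    ∃ (ε : ℝ) (E' : Equation), ε ≠ 0 ∧ E'.n = E.n ∧ E'.IsConstantCoeff ε ∧
      PointEquivalent E E' := by
  obtain ⟨A, hAs, hA⟩ := exists_antideriv E.isOpen_I E.isConnected_I E.smooth_α
  have hexp : ContDiffOn ℝ ∞ (fun t => Real.exp (-(E.n * A t))) E.I :=
    (contDiffOn_const.mul hAs).neg.exp
  obtain ⟨T, hTs, hT⟩ := exists_antideriv E.isOpen_I E.isConnected_I hexp
  obtain ⟨e, hes, heT, hesymm⟩ := exists_openPartialHomeomorph_of_deriv_pos E.isOpen_I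
    E.isConnected_I hTs hT fun t _ => Real.exp_pos _
  obtain ⟨t₀, ht₀⟩ := E.isConnected_I.nonempty
  set ε := E.β t₀ * Real.exp (E.n * A t₀) with hε
  have hβ : ∀ t ∈ E.I, E.β t * Real.exp (E.n * A t) = ε := by
    intro t ht
    refine eq_of_hasDerivAt_zero (f := fun t => E.β t * Real.exp (E.n * A t)) E.isOpen_I
      E.isConnected_I (fun s hs => ?_) ht ht₀
    refine ((E.hasDerivAt_β hs).fun_mul ((hA s hs).const_mul E.n).exp).congr_deriv ?_
    linear_combination Real.exp (E.n * A s) * hE s hs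
  have hε0 : ε ≠ 0 := mul_ne_zero (E.β_ne_zero t₀ ht₀) (Real.exp_ne_zero _)
  have htarget : e.target = T '' E.I := by
    rw [← e.image_source_eq_target, heT, hes]
  let E' : Equation :=
    { n := E.n
      n_ne_zero := E.n_ne_zero
      n_ne_one := E.n_ne_one
      I := e.target
      isOpen_I := e.open_target
      isConnected_I := by
        rw [htarget]
        exact E.isConnected_I.image T hTs.continuousOn
      α := fun _ => 0
      β := fun _ => ε
      smooth_α := contDiffOn_const
      smooth_β := contDiffOn_const
      β_ne_zero := fun _ _ => hε0 }
  have hmem' : ∀ {t x u : ℝ}, (t, x, u) ∈ E'.dom ↔ t ∈ e.target ∧ u ∈ uRange E.n :=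
    Equation.mem_dom
  have hsmooth : ContDiffOn ℝ ∞
      (fun z : ℝ × ℝ × ℝ => (e z.1, z.2.1, Real.exp (A z.1) * z.2.2)) E.dom := by
    have h1 : ContDiffOn ℝ ∞ (fun z : ℝ × ℝ × ℝ => T z.1) E.dom :=
      hTs.comp contDiff_fst.contDiffOn fun z hz => hz.1
    have h2 : ContDiffOn ℝ ∞ (fun z : ℝ × ℝ × ℝ => A z.1) E.dom :=
      hAs.comp contDiff_fst.contDiffOn fun z hz => hz.1
    rw [heT]
    exact h1.prodMk ((by fun_prop : ContDiffOn ℝ ∞ (fun z : ℝ × ℝ × ℝ => z.2.1) E.dom).prodMk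
      (h2.exp.mul (by fun_prop)))
  have hsmooth' : ContDiffOn ℝ ∞
      (fun z : ℝ × ℝ × ℝ => (e.symm z.1, z.2.1, Real.exp (-A (e.symm z.1)) * z.2.2)) E'.dom := by
    have h1 : ContDiffOn ℝ ∞ (fun z : ℝ × ℝ × ℝ => e.symm z.1) E'.dom :=
      hesymm.comp contDiff_fst.contDiffOn fun z hz => hz.1
    have h2 : ContDiffOn ℝ ∞ (fun z : ℝ × ℝ × ℝ => A (e.symm z.1)) E'.dom :=
      hAs.comp h1 fun z hz => hes ▸ e.map_target hz.1
    exact h1.prodMk ((by fun_prop : ContDiffOn ℝ ∞ (fun z : ℝ × ℝ × ℝ => z.2.1) E'.dom).prodMk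
      (h2.neg.exp.mul (by fun_prop)))
  let Φ : OpenPartialHomeomorph (ℝ × ℝ × ℝ) (ℝ × ℝ × ℝ) :=
    { toFun := fun z => (e z.1, z.2.1, Real.exp (A z.1) * z.2.2)
      invFun := fun z => (e.symm z.1, z.2.1, Real.exp (-A (e.symm z.1)) * z.2.2)
      source := E.dom
      target := E'.dom
      map_source' := by
        rintro ⟨t, x, u⟩ hz
        obtain ⟨ht, hu⟩ := Equation.mem_dom.1 hz
        exact hmem'.2 ⟨e.map_source (hes ▸ ht), mul_mem_uRange (Real.exp_pos _) hu⟩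
      map_target' := by
        rintro ⟨t, x, u⟩ hz
        obtain ⟨ht, hu⟩ := hmem'.1 hz
        exact Equation.mem_dom.2 ⟨hes ▸ e.map_target ht, mul_mem_uRange (Real.exp_pos _) hu⟩
      left_inv' := by
        rintro ⟨t, x, u⟩ hz
        obtain ⟨ht, hu⟩ := Equation.mem_dom.1 hz
        have : e.symm (e t) = t := e.left_inv (hes ▸ ht)
        simp only [this, ← mul_assoc, ← Real.exp_add]
        simp
      right_inv' := by
        rintro ⟨t, x, u⟩ hz
        obtain ⟨ht, hu⟩ := hmem'.1 hz
        have : e (e.symm t) = t := e.right_inv ht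
        simp only [this, ← mul_assoc, ← Real.exp_add]
        simp
      open_source := E.isOpen_dom
      open_target := E'.isOpen_dom
      continuousOn_toFun := hsmooth.continuousOn
      continuousOn_invFun := hsmooth'.continuousOn }
  refine ⟨ε, E', hε0, rfl, fun t _ => ⟨rfl, rfl⟩, Φ, rfl, rfl, hsmooth, hsmooth', ?_⟩
  rintro u v hu hv ⟨t, x⟩ ⟨t', x'⟩ hp hpq hev
  obtain ⟨ht, hu0⟩ := Equation.mem_dom.1 hp
  simp only at ht hu0
  have hΦ : ∀ q : ℝ × ℝ, Φ (graphPt u q) = (T q.1, q.2, Real.exp (A q.1) * u q) := by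
    intro q
    change (e q.1, q.2, Real.exp (A q.1) * u q) = _
    rw [heT]
  rw [hΦ] at hpq
  simp only [graphPt, Prod.mk.injEq] at hpq
  obtain ⟨rfl, rfl, hvq⟩ := hpq
  -- The condition on graphs near the point pins down v near the image point, so its derivatives
  -- there can be compared with those of u.
  have hrel : ∀ᶠ q : ℝ × ℝ in 𝓝 (t, x), v (T q.1, q.2) = Real.exp (A q.1) * u q := by
    filter_upwards [hev] with q ⟨q', hq'⟩
    rw [hΦ] at hq'
    simp only [graphPt, Prod.mk.injEq] at hq'
    rw [hq'.2.2, hq'.1, hq'.2.1]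
  have hcx : ContinuousAt (fun y : ℝ => (t, y)) x := by fun_prop
  have hct : ContinuousAt (fun s : ℝ => (s, x)) t := by fun_prop
  have hDx : ∀ k, dx^[k] v (T t, x) = Real.exp (A t) * dx^[k] u (t, x) := by
    intro k
    rw [dx_iterate_eq isOpen_univ hv.contDiffOn k _ trivial,
      dx_iterate_eq isOpen_univ hu.contDiffOn k _ trivial, ← iteratedDeriv_const_mul_field]
    apply EventuallyEq.iteratedDeriv_eq
    exact hcx.eventually hrel
  have hDt : dt v (T t, x) * Real.exp (-(E.n * A t))
      = Real.exp (A t) * (E.α t * u (t, x) + dt u (t, x)) := by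
    have h1 := hasDerivAt_dt (hv.differentiable (by simp) (T t, x))
    have h2 : HasDerivAt (fun s => v (T s, x)) _ t := HasDerivAt.comp t h1 (hT t ht)
    have h3 := (hA t ht).exp.fun_mul (hasDerivAt_dt (hu.differentiable (by simp) (t, x)))
    rw [h2.unique (h3.congr_of_eventuallyEq (hct.eventually hrel))]
    ring
  have hT0 := Real.exp_ne_zero (-(E.n * A t))
  have hinv : Real.exp (E.n * A t) * Real.exp (-(E.n * A t)) = 1 := by
    rw [← Real.exp_add]; simp
  have hpow : (Real.exp (A t) * u (t, x)) ^ E.n = Real.exp (E.n * A t) * u (t, x) ^ E.n := by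
    rw [mul_rpow_of_mem_uRange (Real.exp_pos _) hu0, ← Real.exp_mul, mul_comm (A t)]
  have key : E'.lhs v (T t, x) * Real.exp (-(E.n * A t)) = Real.exp (A t) * E.lhs u (t, x) := by
    have h1 := hDx 1
    rw [Function.iterate_one] at h1
    change (dt v (T t, x) + v (T t, x) ^ E.n * dx v (T t, x) + 0 * v (T t, x)
      + ε * dx^[5] v (T t, x)) * _ = Real.exp (A t) * (dt u (t, x)
        + u (t, x) ^ E.n * dx u (t, x) + E.α t * u (t, x) + E.β t * dx^[5] u (t, x))
    rw [h1, hDx 5, ← hvq, hpow, ← hβ t ht]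
    linear_combination hDt + Real.exp (A t) * (u (t, x) ^ E.n * dx u (t, x)
      + E.β t * dx^[5] u (t, x)) * hinv
  constructor
  · intro h
    rw [h, mul_zero] at key
    exact (mul_eq_zero.1 key).resolve_right hT0
  · intro h
    rw [h, zero_mul] at key
    exact (mul_eq_zero.1 key.symm).resolve_left (Real.exp_ne_zero _)

/-! ### Auxiliary facts on point transformations -/

theorem isLittleO_pow_sub {χ : ℝ → ℝ} {x₀ r : ℝ} (hχ : HasDerivAt χ r x₀) (k : ℕ) :
    (fun x => (χ x - χ x₀) ^ k - (r * (x - x₀)) ^ k) =o[𝓝 x₀] fun x => (x - x₀) ^ k := by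
  induction k with
  | zero => simp
  | succ k ih =>
    have h1 : (fun x => χ x - χ x₀ - r * (x - x₀)) =o[𝓝 x₀] fun x => x - x₀ := by
      simpa [mul_comm] using hasDerivAt_iff_isLittleO.1 hχ
    have h2 : (fun x => (χ x - χ x₀) ^ k) =O[𝓝 x₀] fun x => (x - x₀) ^ k :=
      hχ.differentiableAt.isBigO_sub.pow k
    have h3 : (fun x => r * (x - x₀)) =O[𝓝 x₀] fun x => x - x₀ :=
      (isBigO_refl _ _).const_mul_left r
    refine ((h2.mul_isLittleO h1).add (ih.mul_isBigO h3)).congr (fun x => ?_) fun x => ?_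
    · ring
    · ring

/-- The derivatives of orders `1` and `5` of a function whose composition with a local change of
variable `χ` is `k + l s + b s ^ 4 + c s ^ 5` up to higher order, with `s = χ x - χ x₀`. -/
theorem deriv_of_comp_isLittleO {f χ : ℝ → ℝ} {x₀ r : ℝ} (k l b c : ℝ) (hf : ContDiff ℝ ∞ f)
    (hχ : HasDerivAt χ r x₀) (hr : r ≠ 0)
    (h : (fun x => f (χ x) - (k + l * (χ x - χ x₀) + b * (χ x - χ x₀) ^ 4
      + c * (χ x - χ x₀) ^ 5)) =o[𝓝 x₀] fun x => (x - x₀) ^ 5) :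
    deriv f (χ x₀) = l ∧ iteratedDeriv 5 f (χ x₀) = 120 * c := by
  set P : ℝ → ℝ := fun y => k + l * (y - χ x₀) + 0 * (y - χ x₀) ^ 3 + b * (y - χ x₀) ^ 4
    + c * (y - χ x₀) ^ 5 with hP
  have hPs : ContDiff ℝ ∞ P := by rw [hP]; fun_prop
  have h0 := iteratedDeriv_eq_zero_of_comp_isLittleO (f := f - P) (m := 5)
    ((hf.sub hPs).of_le ENat.LEInfty.out).contDiffAt hχ hr
    (h.congr_left fun x => by simp only [Pi.sub_apply, hP]; ring)
  obtain ⟨e1, e5⟩ := deriv_eq_of_isLittleO (f := P) (g := fun _ => 0) (x₀ := χ x₀) k l 0 b c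
    hPs.contDiffAt contDiffAt_const (by simp [hP])
  have key : ∀ i ≤ 5, iteratedDeriv i f (χ x₀) = iteratedDeriv i P (χ x₀) := by
    intro i hi
    have := h0 i hi
    rw [iteratedDeriv_sub (hf.of_le ENat.LEInfty.out).contDiffAt
      (hPs.of_le ENat.LEInfty.out).contDiffAt] at this
    linarith
  constructor
  · have := key 1 (by norm_num)
    rw [iteratedDeriv_one, iteratedDeriv_one] at this
    rw [this, e1]; simp
  · rw [key 5 le_rfl, e5]; simp

/-- A function that is smooth near a point agrees near that point with a smooth function. -/
theorem exists_contDiff_eventuallyEq {V : Type*} [NormedAddCommGroup V] [NormedSpace ℝ V]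
    [HasContDiffBump V] {f : V → ℝ} {q : V} (hf : ∀ᶠ y in 𝓝 q, ContDiffAt ℝ ∞ f y) :
    ∃ v : V → ℝ, ContDiff ℝ ∞ v ∧ v =ᶠ[𝓝 q] f := by
  obtain ⟨r, hr, hball⟩ := Metric.eventually_nhds_iff_ball.1 hf
  let φ : ContDiffBump q := ⟨r / 4, r / 2, by positivity, by linarith⟩
  refine ⟨fun y => φ y * f y, ?_, ?_⟩
  · rw [contDiff_iff_contDiffAt]
    intro y
    by_cases hy : y ∈ Metric.ball q r
    · exact φ.contDiffAt.mul (hball y hy)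
    · have hev : (fun y => φ y * f y) =ᶠ[𝓝 y] fun _ => 0 := by
        have : y ∈ (Metric.closedBall q (r / 2))ᶜ := by
          simp only [Metric.mem_ball, not_lt] at hy
          simp only [Set.mem_compl_iff, Metric.mem_closedBall, not_le]
          linarith
        filter_upwards [Metric.isClosed_closedBall.isOpen_compl.mem_nhds this] with w hw
        have hw' : r / 2 ≤ dist w q := by
          simp only [Set.mem_compl_iff, Metric.mem_closedBall, not_le] at hw
          exact hw.le
        rw [φ.zero_of_le_dist hw', zero_mul]
      exact contDiffAt_const.congr_of_eventuallyEq hev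
  · filter_upwards [φ.eventuallyEq_one] with y hy
    rw [hy]; simp

/-- The inverse function theorem on an open subset of a finite-dimensional space. -/
theorem exists_local_inverse {V : Type*} [NormedAddCommGroup V] [NormedSpace ℝ V]
    [FiniteDimensional ℝ V] {ψ : V → V} {S : Set V} {p : V} (hS : IsOpen S)
    (hψ : ContDiffOn ℝ ∞ ψ S) (hp : p ∈ S) (hinj : Function.Injective (fderiv ℝ ψ p)) :
    ∃ θ : V → V, θ (ψ p) = p ∧ (∀ᶠ y in 𝓝 (ψ p), ContDiffAt ℝ ∞ θ y) ∧
      (∀ᶠ y in 𝓝 (ψ p), ψ (θ y) = y) ∧ ∀ᶠ p' in 𝓝 p, θ (ψ p') = p' := by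
  have : CompleteSpace V := FiniteDimensional.complete ℝ V
  let L : V ≃L[ℝ] V :=
    (LinearEquiv.ofInjectiveEndo (fderiv ℝ ψ p : V →ₗ[ℝ] V) hinj).toContinuousLinearEquiv
  have hL : (L : V →L[ℝ] V) = fderiv ℝ ψ p := by ext v; rfl
  have hc := hψ.contDiffAt (hS.mem_nhds hp)
  have hd : HasFDerivAt ψ (L : V →L[ℝ] V) p := by
    rw [hL]; exact (differentiableAt_of_contDiffOn hS hψ hp).hasFDerivAt
  let e := hc.toOpenPartialHomeomorph ψ hd (by simp)
  have hpe : p ∈ e.source := hc.mem_toOpenPartialHomeomorph_source hd (by simp)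
  have hcoe : ⇑e = ψ := hc.toOpenPartialHomeomorph_coe hd (by simp)
  have hmap : ψ p ∈ e.target := by
    have := e.map_source hpe
    rwa [hcoe] at this
  have hθp : e.symm (ψ p) = p := by
    have := e.left_inv hpe
    rwa [hcoe] at this
  have hcont : ContinuousAt e.symm (ψ p) := e.continuousAt_symm hmap
  refine ⟨e.symm, hθp, ?_, ?_, ?_⟩
  · have h1 : ∀ᶠ p' in 𝓝 p, fderiv ℝ ψ p' ∈ Set.range ((↑) : (V ≃L[ℝ] V) → V →L[ℝ] V) := by
      have hcf : ContinuousAt (fderiv ℝ ψ) p :=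
        (hψ.continuousOn_fderiv_of_isOpen hS (by simp)).continuousAt (hS.mem_nhds hp)
      exact hcf (hL ▸ ContinuousLinearEquiv.nhds L)
    have h2 : ∀ᶠ y in 𝓝 (ψ p), e.symm y ∈ S ∧
        fderiv ℝ ψ (e.symm y) ∈ Set.range ((↑) : (V ≃L[ℝ] V) → V →L[ℝ] V) := by
      have h3 := (hS.eventually_mem hp).and h1
      rw [← hθp] at h3
      exact hcont.eventually h3
    filter_upwards [h2, e.open_target.mem_nhds hmap] with y ⟨hyS, L', hL'⟩ hyt
    refine e.contDiffAt_symm (f₀' := L') hyt ?_ ?_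
    · rw [hcoe, hL']
      exact (differentiableAt_of_contDiffOn hS hψ hyS).hasFDerivAt
    · rw [hcoe]
      exact hψ.contDiffAt (hS.mem_nhds hyS)
  · filter_upwards [e.open_target.mem_nhds hmap] with y hy
    have := e.right_inv hy
    rwa [hcoe] at this
  · filter_upwards [e.open_source.mem_nhds hpe] with y hy
    have := e.left_inv hy
    rwa [hcoe] at this

/-- If the power of an affine function is a combination of the power of the variable and a
constant, then the affine function is homogeneous. -/
theorem affine_rpow_eq {n a b A B : ℝ} (hn0 : n ≠ 0) (hn1 : n ≠ 1) (ha : a ≠ 0) (hA : A ≠ 0)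
    (h : ∀ u > 0, (a * u + b) ^ n = A * u ^ n + B) : b = 0 ∧ B = 0 ∧ a ^ n = A := by
  have hev : ∀ u, 0 < u → a * u + b ≠ 0 → ∀ᶠ v in 𝓝 u, 0 < v ∧ a * v + b ≠ 0 := by
    intro u hu hab
    have hc : ContinuousAt (fun v => a * v + b) u := by fun_prop
    exact (lt_mem_nhds hu).and (hc.eventually_ne hab)
  -- One differentiation removes B and lowers the exponent by one. Points with au + b = 0 are
  -- excluded because the real power need not be differentiable there; negative values of au + b are
  -- harmless.
  have step : ∀ {m A B : ℝ}, (∀ u, 0 < u → a * u + b ≠ 0 → (a * u + b) ^ m = A * u ^ m + B) →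
      m ≠ 0 → ∀ u, 0 < u → a * u + b ≠ 0 → a * (a * u + b) ^ (m - 1) = A * u ^ (m - 1) := by
    intro m A B hm hm0 u hu hab
    have h1 : HasDerivAt (fun u => a * u + b) a u := by
      simpa using ((hasDerivAt_id u).const_mul a).add_const b
    have h2 := h1.rpow_const (p := m) (Or.inl hab)
    have h3 := (((hasDerivAt_id u).rpow_const (p := m) (Or.inl hu.ne')).const_mul A).add_const B
    have h4 := h2.unique (h3.congr_of_eventuallyEq (by
      filter_upwards [hev u hu hab] with v hv using hm v hv.1 hv.2))
    apply mul_left_cancel₀ hm0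
    simp only [id] at h4
    linear_combination h4
  obtain ⟨u, hu, hab⟩ : ∃ u, 0 < u ∧ a * u + b ≠ 0 := by
    by_cases hab : a * 1 + b = 0
    · exact ⟨2, two_pos, fun h2 => ha (by linarith)⟩
    · exact ⟨1, one_pos, hab⟩
  have s1 := step (fun u hu _ => h u hu) hn0
  -- A second differentiation, with exponent n − 1 ≠ 0. The quotient of the first two derivatives
  -- then gives au + b = au, that is b = 0.
  have s2 : a * (a * (a * u + b) ^ (n - 1 - 1)) = A * u ^ (n - 1 - 1) := by
    have := step (A := A / a) (B := 0) (fun u hu hab => by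
      have := s1 u hu hab
      field_simp
      linarith) (sub_ne_zero.2 hn1) u hu hab
    rw [this]
    field_simp
  have hb : b = 0 := by
    have h1 := s1 u hu hab
    rw [Real.rpow_sub_one hab (n - 1), Real.rpow_sub_one hu.ne' (n - 1)] at s2
    have hup : u ^ (n - 1) ≠ 0 := (Real.rpow_pos_of_pos hu _).ne'
    field_simp at s2
    have h3 : A * u ^ (n - 1) * (a * u - (a * u + b)) = 0 := by
      linear_combination s2 - a * u * h1
    rcases mul_eq_zero.1 h3 with h4 | h4
    · exact absurd h4 (mul_ne_zero hA hup)
    · linarith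
  subst hb
  have h1 := s1 1 one_pos (by simpa using ha)
  have h2 := h 1 one_pos
  simp only [mul_one, add_zero, Real.one_rpow] at h1 h2
  have h3 : a ^ n = A := by
    rw [Real.rpow_sub_one ha] at h1
    field_simp at h1
    linarith
  exact ⟨rfl, by linarith, h3⟩

/-! ### Point transformations to equations with constant coefficients -/

/-- `Φ` is a point transformation of `E` to `E'`, in one direction. -/
structure IsPointTransformation (E E' : Equation)
    (Φ : OpenPartialHomeomorph (ℝ × ℝ × ℝ) (ℝ × ℝ × ℝ)) : Prop where
  source : Φ.source = E.dom
  target : Φ.target = E'.dom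
  smooth : ContDiffOn ℝ ∞ Φ E.dom
  smooth_symm : ContDiffOn ℝ ∞ Φ.symm E'.dom
  map_solution : ∀ u v : ℝ × ℝ → ℝ, ContDiff ℝ ∞ u → ContDiff ℝ ∞ v →
    ∀ p q : ℝ × ℝ, graphPt u p ∈ E.dom → Φ (graphPt u p) = graphPt v q →
      (∀ᶠ p' in 𝓝 p, ∃ q' : ℝ × ℝ, Φ (graphPt u p') = graphPt v q') →
      E.lhs u p = 0 → E'.lhs v q = 0

/-- The projection to the plane of the image of the graph of `u`. -/
def planeMap (Φ : ℝ × ℝ × ℝ → ℝ × ℝ × ℝ) (u : ℝ × ℝ → ℝ) (p : ℝ × ℝ) : ℝ × ℝ :=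
  ((Φ (graphPt u p)).1, (Φ (graphPt u p)).2.1)

/-- The Jacobian determinant of `planeMap Φ u`, in terms of the first derivatives `a`, `b`
of `u`. -/
noncomputable def planeJac (Φ : ℝ × ℝ × ℝ → ℝ × ℝ × ℝ) (z : ℝ × ℝ × ℝ) (a b : ℝ) : ℝ :=
  (pdT (fun z => (Φ z).1) z + a * pdU (fun z => (Φ z).1) z)
      * (pdX (fun z => (Φ z).2.1) z + b * pdU (fun z => (Φ z).2.1) z)
    - (pdX (fun z => (Φ z).1) z + b * pdU (fun z => (Φ z).1) z)
      * (pdT (fun z => (Φ z).2.1) z + a * pdU (fun z => (Φ z).2.1) z)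

/-- The function whose vanishing defines the preimage of the graph of `v` under `Φ`. -/
def pullback (Φ : ℝ × ℝ × ℝ → ℝ × ℝ × ℝ) (v : ℝ × ℝ → ℝ) (z : ℝ × ℝ × ℝ) : ℝ :=
  (Φ z).2.2 - v ((Φ z).1, (Φ z).2.1)

theorem fderiv_graphPt {u : ℝ × ℝ → ℝ} {p : ℝ × ℝ} (hu : DifferentiableAt ℝ u p) (v : ℝ × ℝ) :
    fderiv ℝ (graphPt u) p v = (v.1, v.2, v.1 * dt u p + v.2 * dx u p) := by
  have h : HasFDerivAt (graphPt u) ((ContinuousLinearMap.fst ℝ ℝ ℝ).prod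
      ((ContinuousLinearMap.snd ℝ ℝ ℝ).prod (fderiv ℝ u p))) p :=
    hasFDerivAt_fst.prodMk (hasFDerivAt_snd.prodMk hu.hasFDerivAt)
  rw [h.fderiv]
  have : v = v.1 • ((1 : ℝ), (0 : ℝ)) + v.2 • ((0 : ℝ), (1 : ℝ)) := by simp
  simp only [ContinuousLinearMap.prod_apply, ContinuousLinearMap.coe_fst',
    ContinuousLinearMap.coe_snd', Prod.mk.injEq, true_and]
  conv_lhs => rw [this]
  rw [map_add, map_smul, map_smul]
  rfl

section PointTransformation

variable {E E' : Equation} {Φ : OpenPartialHomeomorph (ℝ × ℝ × ℝ) (ℝ × ℝ × ℝ)}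

theorem IsPointTransformation.exists_fderiv_eq (hΦ : IsPointTransformation E E' Φ)
    {z : ℝ × ℝ × ℝ} (hz : z ∈ E.dom) (w : ℝ × ℝ × ℝ) : ∃ v, fderiv ℝ Φ z v = w := by
  have hz' : Φ z ∈ E'.dom := hΦ.target ▸ Φ.map_source (hΦ.source.symm ▸ hz)
  have hsz : Φ.symm (Φ z) = z := Φ.left_inv (hΦ.source.symm ▸ hz)
  have h1 := (differentiableAt_of_contDiffOn E.isOpen_dom hΦ.smooth hz).hasFDerivAt
  have h2 := (differentiableAt_of_contDiffOn E'.isOpen_dom hΦ.smooth_symm hz').hasFDerivAt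
  rw [← hsz] at h1
  have h3 := h1.comp (Φ z) h2
  have h4 : HasFDerivAt (fun y => Φ (Φ.symm y)) (ContinuousLinearMap.id ℝ (ℝ × ℝ × ℝ)) (Φ z) := by
    refine (hasFDerivAt_id (Φ z)).congr_of_eventuallyEq ?_
    filter_upwards [E'.isOpen_dom.mem_nhds hz'] with y hy
    exact Φ.right_inv (hΦ.target.symm ▸ hy)
  refine ⟨fderiv ℝ Φ.symm (Φ z) w, ?_⟩
  have h5 := congrArg (fun L => L w) (h3.unique h4)
  rw [hsz] at h5
  exact h5

/-- The differential of a point transformation is surjective, in terms of partial derivatives. -/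
theorem IsPointTransformation.exists_pd_eq (hΦ : IsPointTransformation E E' Φ)
    {z : ℝ × ℝ × ℝ} (hz : z ∈ E.dom) (w : ℝ × ℝ × ℝ) : ∃ a b c : ℝ,
      a * pdT (fun z => (Φ z).1) z + b * pdX (fun z => (Φ z).1) z + c * pdU (fun z => (Φ z).1) z
        = w.1 ∧
      a * pdT (fun z => (Φ z).2.1) z + b * pdX (fun z => (Φ z).2.1) z
        + c * pdU (fun z => (Φ z).2.1) z = w.2.1 ∧
      a * pdT (fun z => (Φ z).2.2) z + b * pdX (fun z => (Φ z).2.2) z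
        + c * pdU (fun z => (Φ z).2.2) z = w.2.2 := by
  obtain ⟨⟨a, b, c⟩, hv⟩ := hΦ.exists_fderiv_eq hz w
  have hd := (differentiableAt_of_contDiffOn E.isOpen_dom hΦ.smooth hz).hasFDerivAt
  refine ⟨a, b, c, ?_, ?_, ?_⟩
  · rw [← fderiv_triple, hd.fst.fderiv, ← hv]; rfl
  · rw [← fderiv_triple, hd.snd.fst.fderiv, ← hv]; rfl
  · rw [← fderiv_triple, hd.snd.snd.fderiv, ← hv]; rfl

/-- Not all projections of graphs are degenerate. -/
theorem IsPointTransformation.exists_planeJac_ne_zero (hΦ : IsPointTransformation E E' Φ)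
    {z : ℝ × ℝ × ℝ} (hz : z ∈ E.dom) : ∃ a b, planeJac Φ z a b ≠ 0 := by
  by_contra! h
  obtain ⟨a₁, b₁, c₁, h1, h2, -⟩ := hΦ.exists_pd_eq hz (1, 0, 0)
  obtain ⟨a₂, b₂, c₂, h3, h4, -⟩ := hΦ.exists_pd_eq hz (0, 1, 0)
  have e0 := h 0 0
  have e1 := h 1 0
  have e2 := h 0 1
  unfold planeJac at e0 e1 e2
  generalize pdT (fun z => (Φ z).1) z = p at *
  generalize pdX (fun z => (Φ z).1) z = q at *
  generalize pdU (fun z => (Φ z).1) z = r at *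
  generalize pdT (fun z => (Φ z).2.1) z = p' at *
  generalize pdX (fun z => (Φ z).2.1) z = q' at *
  generalize pdU (fun z => (Φ z).2.1) z = r' at *
  simp only at h1 h2 h3 h4
  -- `planeJac` is affine in (a, b), and its three coefficients are the 2 × 2 minors of the
  -- differential of (T, X). If all vanish, that differential has rank less than two, contrary to
  -- surjectivity; the identity is the Cauchy–Binet formula.
  have : (a₁ * p + b₁ * q + c₁ * r) * (a₂ * p' + b₂ * q' + c₂ * r')
      - (a₂ * p + b₂ * q + c₂ * r) * (a₁ * p' + b₁ * q' + c₁ * r') = 0 := by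
    linear_combination (a₁ * b₂ - b₁ * a₂) * e0 + (a₁ * c₂ - c₁ * a₂) * (e2 - e0)
      - (b₁ * c₂ - c₁ * b₂) * (e1 - e0)
  rw [h1, h2, h3, h4] at this
  norm_num at this

theorem contDiffOn_pullback (hΦ : IsPointTransformation E E' Φ) {v : ℝ × ℝ → ℝ}
    (hv : ContDiff ℝ ∞ v) : ContDiffOn ℝ ∞ (pullback Φ v) E.dom :=
  hΦ.smooth.snd.snd.sub (hv.comp_contDiffOn (hΦ.smooth.fst.prodMk hΦ.smooth.snd.fst))

theorem fderiv_pullback (hΦ : IsPointTransformation E E' Φ) {v : ℝ × ℝ → ℝ}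
    (hv : ContDiff ℝ ∞ v) {z : ℝ × ℝ × ℝ} (hz : z ∈ E.dom) (w : ℝ × ℝ × ℝ) :
    fderiv ℝ (pullback Φ v) z w = fderiv ℝ (fun z => (Φ z).2.2) z w
      - (fderiv ℝ (fun z => (Φ z).1) z w * dt v ((Φ z).1, (Φ z).2.1)
        + fderiv ℝ (fun z => (Φ z).2.1) z w * dx v ((Φ z).1, (Φ z).2.1)) := by
  have hd := (differentiableAt_of_contDiffOn E.isOpen_dom hΦ.smooth hz)
  have h1 := hd.fst.hasFDerivAt
  have h2 := hd.snd.fst.hasFDerivAt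
  have h3 := hd.snd.snd.hasFDerivAt
  have hv' : HasFDerivAt v (fderiv ℝ v ((Φ z).1, (Φ z).2.1)) ((Φ z).1, (Φ z).2.1) :=
    (hv.differentiable (by simp) _).hasFDerivAt
  have h4 : HasFDerivAt (fun z => v ((Φ z).1, (Φ z).2.1)) _ z :=
    hv'.comp z (h1.prodMk h2)
  have h5 : HasFDerivAt (pullback Φ v) _ z := h3.fun_sub h4
  rw [h5.fderiv]
  simp only [sub_apply, ContinuousLinearMap.comp_apply,
    ContinuousLinearMap.prod_apply, sub_right_inj]
  set s := (fderiv ℝ (fun z => (Φ z).1) z) w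
  set t := (fderiv ℝ (fun z => (Φ z).2.1) z) w
  have : (s, t) = s • ((1 : ℝ), (0 : ℝ)) + t • ((0 : ℝ), (1 : ℝ)) := by simp
  rw [this, map_add, map_smul, map_smul]
  rfl

/-- If `Φ` maps the graph of `u` with a nondegenerate projection, the image is locally the graph
of a smooth function. -/
theorem IsPointTransformation.exists_image (hΦ : IsPointTransformation E E' Φ)
    {u : ℝ × ℝ → ℝ} (hu : ContDiff ℝ ∞ u) {p : ℝ × ℝ} (hp : graphPt u p ∈ E.dom)
    (hJ : planeJac Φ (graphPt u p) (dt u p) (dx u p) ≠ 0) :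
    ∃ (v : ℝ × ℝ → ℝ) (θ : ℝ × ℝ → ℝ × ℝ), ContDiff ℝ ∞ v ∧
      (∀ᶠ p' in 𝓝 p, v (planeMap Φ u p') = (Φ (graphPt u p')).2.2) ∧
      θ (planeMap Φ u p) = p ∧ DifferentiableAt ℝ θ (planeMap Φ u p) ∧
      (∀ᶠ y in 𝓝 (planeMap Φ u p), planeMap Φ u (θ y) = y) ∧
      (E.lhs u p = 0 → E'.lhs v (planeMap Φ u p) = 0) := by
  set S := graphPt u ⁻¹' E.dom
  have hS : IsOpen S := isOpen_graphPt_preimage E hu.continuous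
  have hΦu : ContDiffOn ℝ ∞ (fun p => Φ (graphPt u p)) S :=
    hΦ.smooth.comp (contDiff_graphPt hu).contDiffOn fun _ h => h
  have hψ : ContDiffOn ℝ ∞ (planeMap Φ u) S := hΦu.fst.prodMk hΦu.snd.fst
  have hd := differentiableAt_of_contDiffOn E.isOpen_dom hΦ.smooth hp
  have hgd := (contDiff_graphPt hu).differentiable (by simp) p
  have hud := hu.differentiable (by simp) p
  have hinj : Function.Injective (fderiv ℝ (planeMap Φ u) p) := by
    rw [injective_iff_map_eq_zero]
    rintro ⟨s, t⟩ hst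
    have h1 : HasFDerivAt (fun p => (Φ (graphPt u p)).1) _ p :=
      hd.fst.hasFDerivAt.comp p hgd.hasFDerivAt
    have h2 : HasFDerivAt (fun p => (Φ (graphPt u p)).2.1) _ p :=
      hd.snd.fst.hasFDerivAt.comp p hgd.hasFDerivAt
    have h3 : HasFDerivAt (planeMap Φ u) _ p := h1.prodMk h2
    rw [h3.fderiv] at hst
    simp only [ContinuousLinearMap.prod_apply, ContinuousLinearMap.comp_apply,
      fderiv_graphPt hud, fderiv_triple, Prod.mk_eq_zero] at hst
    obtain ⟨e1, e2⟩ := hst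
    unfold planeJac at hJ
    have hs : planeJac Φ (graphPt u p) (dt u p) (dx u p) * s = 0 := by
      unfold planeJac
      linear_combination (pdX (fun z => (Φ z).2.1) (graphPt u p)
        + dx u p * pdU (fun z => (Φ z).2.1) (graphPt u p)) * e1
        - (pdX (fun z => (Φ z).1) (graphPt u p)
        + dx u p * pdU (fun z => (Φ z).1) (graphPt u p)) * e2
    have ht : planeJac Φ (graphPt u p) (dt u p) (dx u p) * t = 0 := by
      unfold planeJac
      linear_combination (pdT (fun z => (Φ z).1) (graphPt u p)
        + dt u p * pdU (fun z => (Φ z).1) (graphPt u p)) * e2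
        - (pdT (fun z => (Φ z).2.1) (graphPt u p)
        + dt u p * pdU (fun z => (Φ z).2.1) (graphPt u p)) * e1
    exact Prod.ext ((mul_eq_zero.1 hs).resolve_left hJ) ((mul_eq_zero.1 ht).resolve_left hJ)
  obtain ⟨θ, hθp, hθs, hψθ, hθψ⟩ := exists_local_inverse hS hψ hp hinj
  have hθd : DifferentiableAt ℝ θ (planeMap Φ u p) := hθs.self_of_nhds.differentiableAt (by simp)
  have hev : ∀ᶠ y in 𝓝 (planeMap Φ u p),
      ContDiffAt ℝ ∞ (fun y => (Φ (graphPt u (θ y))).2.2) y := by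
    have : ∀ᶠ y in 𝓝 (planeMap Φ u p), θ y ∈ S :=
      hθd.continuousAt (by rw [hθp]; exact hS.mem_nhds hp)
    filter_upwards [hθs, this] with y hy hyS
    exact (hΦu.snd.snd.contDiffAt (hS.mem_nhds hyS)).comp y hy
  -- The image is a graph only locally, whereas the transformation property refers to globally
  -- smooth functions; a cutoff bridges the gap.
  obtain ⟨v, hv, hveq⟩ := exists_contDiff_eventuallyEq hev
  have hcψ : ContinuousAt (planeMap Φ u) p := hψ.continuousOn.continuousAt (hS.mem_nhds hp)
  have hvψ : ∀ᶠ p' in 𝓝 p, v (planeMap Φ u p') = (Φ (graphPt u p')).2.2 := by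
    filter_upwards [hcψ.eventually hveq, hθψ] with p' h1 h2
    rw [h1, h2]
  have hgraph : ∀ᶠ p' in 𝓝 p, Φ (graphPt u p') = graphPt v (planeMap Φ u p') := by
    filter_upwards [hvψ] with p' h
    simp only [graphPt] at h ⊢
    rw [h]
    rfl
  exact ⟨v, θ, hv, hvψ, hθp, hθd, hψθ, fun hl =>
    hΦ.map_solution u v hu hv p _ hp hgraph.self_of_nhds
      (hgraph.mono fun p' h => ⟨_, h⟩) hl⟩

/-- The data of two functions with the same value at a point, and their images. -/
theorem IsPointTransformation.compare (hΦ : IsPointTransformation E E' Φ)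
    {u u' : ℝ × ℝ → ℝ} (hu : ContDiff ℝ ∞ u) (hu' : ContDiff ℝ ∞ u') {p : ℝ × ℝ}
    (hval : u p = u' p) (hp : graphPt u p ∈ E.dom)
    (hJ : planeJac Φ (graphPt u p) (dt u p) (dx u p) ≠ 0)
    (hJ' : planeJac Φ (graphPt u p) (dt u' p) (dx u' p) ≠ 0) :
    ∃ (v v' : ℝ × ℝ → ℝ) (θ : ℝ × ℝ → ℝ × ℝ), ContDiff ℝ ∞ v ∧ ContDiff ℝ ∞ v' ∧
      v (planeMap Φ u p) = (Φ (graphPt u p)).2.2 ∧ v' (planeMap Φ u p) = (Φ (graphPt u p)).2.2 ∧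
      (∀ᶠ p' in 𝓝 p, v (planeMap Φ u p') - v' (planeMap Φ u p')
        = pullback Φ v' (graphPt u p')) ∧
      (∀ᶠ p' in 𝓝 p, pullback Φ v' (graphPt u' p') = 0) ∧
      θ (planeMap Φ u p) = p ∧ DifferentiableAt ℝ θ (planeMap Φ u p) ∧
      (∀ᶠ y in 𝓝 (planeMap Φ u p), planeMap Φ u (θ y) = y) ∧
      (E.lhs u p = 0 → E'.lhs v (planeMap Φ u p) = 0) ∧
      (E.lhs u' p = 0 → E'.lhs v' (planeMap Φ u p) = 0) ∧
      pdT (pullback Φ v') (graphPt u p) + dt u' p * pdU (pullback Φ v') (graphPt u p) = 0 ∧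
      pdX (pullback Φ v') (graphPt u p) + dx u' p * pdU (pullback Φ v') (graphPt u p) = 0 ∧
      pdU (pullback Φ v') (graphPt u p) ≠ 0 := by
  have hgr : graphPt u' p = graphPt u p := by simp [graphPt, hval]
  have hpm : planeMap Φ u' p = planeMap Φ u p := by simp [planeMap, hgr]
  obtain ⟨v, θ, hv, hvψ, hθ, hθd, hψθ, hlhs⟩ := hΦ.exists_image hu hp hJ
  obtain ⟨v', θ', hv', hvψ', -, -, -, hlhs'⟩ := hΦ.exists_image hu' (hgr.symm ▸ hp) (hgr.symm ▸ hJ')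
  have hzero : ∀ᶠ p' in 𝓝 p, pullback Φ v' (graphPt u' p') = 0 := by
    filter_upwards [hvψ'] with p' h
    rw [pullback, ← h]
    exact sub_self _
  have hHd : DifferentiableAt ℝ (pullback Φ v') (graphPt u p) :=
    differentiableAt_of_contDiffOn E.isOpen_dom (contDiffOn_pullback hΦ hv') hp
  have hcomp : ∀ w : ℝ × ℝ, fderiv ℝ (pullback Φ v') (graphPt u p)
      (w.1, w.2, w.1 * dt u' p + w.2 * dx u' p) = 0 := by
    intro w
    have hud := hu'.differentiable (by simp) p
    have hHd' : HasFDerivAt (pullback Φ v') (fderiv ℝ (pullback Φ v') (graphPt u p))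
        (graphPt u' p) := by rw [hgr]; exact hHd.hasFDerivAt
    have h1 : HasFDerivAt (fun p => pullback Φ v' (graphPt u' p)) _ p :=
      hHd'.comp p ((contDiff_graphPt hu').differentiable (by simp) p).hasFDerivAt
    have h2 := h1.unique ((hasFDerivAt_const (0 : ℝ) p).congr_of_eventuallyEq hzero)
    have h3 := congrArg (fun L => L w) h2
    simpa [fderiv_graphPt hud, hgr] using h3
  have hT := hcomp (1, 0)
  have hX := hcomp (0, 1)
  simp only [fderiv_triple, one_mul, zero_mul, add_zero, zero_add] at hT hX
  refine ⟨v, v', θ, hv, hv', hvψ.self_of_nhds, ?_, ?_, hzero, hθ, hθd, hψθ, hlhs, ?_, hT, hX, ?_⟩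
  · have := hvψ'.self_of_nhds
    rwa [hpm, hgr] at this
  · filter_upwards [hvψ] with p' h
    rw [h]; rfl
  · intro h
    have := hlhs' h
    rwa [hpm] at this
  -- The pullback H of v' vanishes on the graph of u'. If H_u were zero, the two tangency relations
  -- would give dH = 0. But dH equals 1 on the vector that the differential of Φ maps to ∂_u.
  · intro hU
    rw [hU, mul_zero, add_zero] at hT hX
    obtain ⟨a, b, c, h1, h2, h3⟩ := hΦ.exists_pd_eq hp (0, 0, 1)
    have h4 := fderiv_pullback hΦ hv' hp (a, b, c)
    rw [fderiv_triple, fderiv_triple, fderiv_triple, fderiv_triple, h1, h2, h3, hT, hX, hU] at h4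
    norm_num at h4

/-- Test functions that are affine in `t` and polynomial in `x`, with a prescribed jet at
`(t₀, x₀)`. -/
noncomputable def testFn (t₀ x₀ u₀ a b d c : ℝ) (p : ℝ × ℝ) : ℝ :=
  testPoly x₀ u₀ b d c p.2 + (p.1 - t₀) * a

section TestFn

variable (t₀ x₀ u₀ a b d c : ℝ)

theorem contDiff_testFn : ContDiff ℝ ∞ (testFn t₀ x₀ u₀ a b d c) :=
  contDiff_affineInTime (contDiff_testPoly x₀ u₀ b c d) contDiff_const t₀

@[simp] theorem testFn_self : testFn t₀ x₀ u₀ a b d c (t₀, x₀) = u₀ := by simp [testFn]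

@[simp] theorem graphPt_testFn : graphPt (testFn t₀ x₀ u₀ a b d c) (t₀, x₀) = (t₀, x₀, u₀) := by
  simp [graphPt]

theorem graphPt_testFn_slice (x : ℝ) : graphPt (testFn t₀ x₀ u₀ a b d c) (t₀, x)
    = (t₀, x, testPoly x₀ u₀ b d c x) := by
  simp [graphPt, testFn]

@[simp] theorem dt_testFn : dt (testFn t₀ x₀ u₀ a b d c) (t₀, x₀) = a :=
  dt_affineInTime t₀ ((contDiff_testPoly x₀ u₀ b c d).differentiable (by simp) _)
    (differentiableAt_const a)

@[simp] theorem dx_testFn : dx (testFn t₀ x₀ u₀ a b d c) (t₀, x₀) = b := by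
  have h := congrFun (dx_iterate_affineInTime (contDiff_testPoly x₀ u₀ b c d)
    (contDiff_const (c := a)) t₀ 1) (t₀, x₀)
  simp only [Function.iterate_one, iteratedDeriv_one, sub_self, zero_mul, add_zero,
    deriv_testPoly_self] at h
  exact h

theorem lhs_testFn (E : Equation) : E.lhs (testFn t₀ x₀ u₀ a b d c) (t₀, x₀)
    = a + u₀ ^ E.n * b + E.α t₀ * u₀ + E.β t₀ * c := by
  have h := lhs_affineInTime E (contDiff_testPoly x₀ u₀ b c d) (contDiff_const (c := a)) t₀ x₀
  simp only [testPoly_self, deriv_testPoly_self, iteratedDeriv_five_testPoly] at h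
  exact h

end TestFn

theorem dx_iterate_eq' {f : ℝ × ℝ → ℝ} (hf : ContDiff ℝ ∞ f) (k : ℕ) (q : ℝ × ℝ) :
    dx^[k] f q = iteratedDeriv k (fun x => f (q.1, x)) q.2 :=
  dx_iterate_eq isOpen_univ hf.contDiffOn k q trivial

theorem lhs_of_isConstantCoeff {ε : ℝ} (hE' : E'.IsConstantCoeff ε) {v : ℝ × ℝ → ℝ} {q : ℝ × ℝ}
    (hq : q.1 ∈ E'.I) : E'.lhs v q = dt v q + v q ^ E'.n * dx v q + ε * dx^[5] v q := by
  rw [Equation.lhs, (hE' _ hq).1, (hE' _ hq).2]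
  ring

theorem IsPointTransformation.fst_mem (hΦ : IsPointTransformation E E' Φ) {z : ℝ × ℝ × ℝ}
    (hz : z ∈ E.dom) : (Φ z).1 ∈ E'.I := by
  have hz' : Φ z ∈ E'.dom := hΦ.target ▸ Φ.map_source (hΦ.source.symm ▸ hz)
  exact hz'.1

/-- A fifth-order perturbation in `t` of the test function detects the derivatives of the new time
with respect to `x` and `u`. -/
theorem IsPointTransformation.time_pd_of_planeJac (hΦ : IsPointTransformation E E' Φ) {ε : ℝ}
    (hε : ε ≠ 0) (hE' : E'.IsConstantCoeff ε) {t₀ x₀ u₀ a b : ℝ} (hz : (t₀, x₀, u₀) ∈ E.dom)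
    (hJ : planeJac Φ (t₀, x₀, u₀) a b ≠ 0) :
    pdX (fun z => (Φ z).1) (t₀, x₀, u₀) + b * pdU (fun z => (Φ z).1) (t₀, x₀, u₀) = 0 := by
  have hβ := E.β_ne_zero t₀ (Equation.mem_dom.1 hz).1
  -- Here u_xxxxx is solved from the equation, so that u_t = a stays free. Adding (t − t₀)^5 alters
  -- no derivative that occurs in the equation, so u and u' both satisfy it at the point.
  set c := -(a + u₀ ^ E.n * b + E.α t₀ * u₀) / E.β t₀ with hc
  set u := testFn t₀ x₀ u₀ a b 0 c with hu
  have hus : ContDiff ℝ ∞ u := contDiff_testFn t₀ x₀ u₀ a b 0 c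
  set u' : ℝ × ℝ → ℝ := fun p => u p + (p.1 - t₀) ^ 5 with hu'
  have hus' : ContDiff ℝ ∞ u' := by fun_prop
  have hlu : E.lhs u (t₀, x₀) = 0 := by
    rw [hu, lhs_testFn, hc]; field_simp; ring
  have hval : u (t₀, x₀) = u' (t₀, x₀) := by simp [hu']
  have hdxk : ∀ k, dx^[k] u' (t₀, x₀) = dx^[k] u (t₀, x₀) := by
    intro k
    rw [dx_iterate_eq' hus', dx_iterate_eq' hus]
    simp [hu']
  have hdxu' : dx u' (t₀, x₀) = b := by
    have := hdxk 1
    rw [Function.iterate_one, hu, dx_testFn] at this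
    exact this
  have hdtu' : dt u' (t₀, x₀) = a := by
    have h1 := hasDerivAt_dt (hus'.differentiable (by simp) (t₀, x₀))
    have h2 := hasDerivAt_dt (hus.differentiable (by simp) (t₀, x₀))
    have h3 := h2.fun_add (((hasDerivAt_id t₀).sub_const t₀).fun_pow 5)
    rw [h1.unique h3, hu, dt_testFn]
    simp
  have hlu' : E.lhs u' (t₀, x₀) = 0 := by
    rw [← hlu]
    simp only [Equation.lhs]
    rw [hdxk, hdxu', hdtu', ← hval, hu, dt_testFn, dx_testFn]
  have hgr : graphPt u (t₀, x₀) = (t₀, x₀, u₀) := graphPt_testFn ..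
  have hdtu : dt u (t₀, x₀) = a := dt_testFn ..
  have hdxu : dx u (t₀, x₀) = b := dx_testFn ..
  obtain ⟨v, v', θ, hv, hv', hvq, hvq', hdiff, hzero, hθ, hθd, hψθ, hl, hl', hHT, hHX, hHU⟩ :=
    hΦ.compare hus hus' (p := (t₀, x₀)) hval (hgr ▸ hz) (by rw [hgr, hdtu, hdxu]; exact hJ)
      (by rw [hgr, hdtu', hdxu']; exact hJ)
  rw [hgr, hdtu'] at hHT
  rw [hgr, hdxu'] at hHX
  rw [hgr] at hHU hvq hvq'
  have hq1 : (planeMap Φ u (t₀, x₀)).1 ∈ E'.I := by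
    simp only [planeMap, hgr]; exact hΦ.fst_mem hz
  set q := planeMap Φ u (t₀, x₀) with hq
  have hqv : (q.1, q.2) = q := rfl
  set H := pullback Φ v' with hH
  have hHs : ContDiffOn ℝ ∞ H E.dom := contDiffOn_pullback hΦ hv'
  -- the difference of the images in terms of `H`
  have hf : ∀ᶠ y in 𝓝 q, v y - v' y = H (graphPt u (θ y)) := by
    have hc : ContinuousAt θ q := hθd.continuousAt
    rw [ContinuousAt, hθ] at hc
    filter_upwards [hc.eventually hdiff, hψθ] with y h1 h2
    rw [h2] at h1
    exact h1
  have hHstrict : HasStrictFDerivAt H (fderiv ℝ H (t₀, x₀, u₀)) (t₀, x₀, u₀) :=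
    (hHs.contDiffAt (E.isOpen_dom.mem_nhds hz)).hasStrictFDerivAt (by simp)
  have hud := hus.differentiable (by simp) (t₀, x₀)
  have hfderiv : HasFDerivAt (fun y => v y - v' y) (0 : ℝ × ℝ →L[ℝ] ℝ) q := by
    have h1 : HasFDerivAt (graphPt u) (fderiv ℝ (graphPt u) (t₀, x₀)) (θ q) := by
      rw [hθ]; exact ((contDiff_graphPt hus).differentiable (by simp) _).hasFDerivAt
    have h2 : HasFDerivAt H (fderiv ℝ H (t₀, x₀, u₀)) (graphPt u (θ q)) := by
      rw [hθ, hgr]; exact hHstrict.hasFDerivAt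
    have h3 := h2.comp q (h1.comp q hθd.hasFDerivAt)
    refine (h3.congr_of_eventuallyEq hf).congr_fderiv ?_
    ext1 <;> ext1
    all_goals
      simp only [ContinuousLinearMap.comp_apply, fderiv_graphPt hud, fderiv_triple, hdtu, hdxu,
        zero_apply]
    all_goals generalize fderiv ℝ θ q _ = w
    all_goals linear_combination w.1 * hHT + w.2 * hHX
  have hvd := (hv.differentiable (by simp) q).hasFDerivAt
  have hvd' := (hv'.differentiable (by simp) q).hasFDerivAt
  have hfd : fderiv ℝ v q = fderiv ℝ v' q := sub_eq_zero.1 ((hvd.fun_sub hvd').unique hfderiv)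
  have hdtv : dt v q = dt v' q := by rw [dt, dt, hfd]
  have hdxv : dx v q = dx v' q := by rw [dx, dx, hfd]
  -- The images have equal values and equal first derivatives at q, and both satisfy the
  -- constant-coefficient equation there; ε ≠ 0 leaves no freedom for the fifth derivative.
  have h5 : dx^[5] v q = dx^[5] v' q := by
    have e1 := hl hlu
    have e2 := hl' hlu'
    rw [lhs_of_isConstantCoeff hE' hq1] at e1 e2
    rw [hdtv, hdxv, hvq] at e1
    rw [hvq'] at e2
    exact mul_left_cancel₀ hε (by linarith)
  -- the behaviour of the difference along a line in the direction of the new `x`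
  have hline : HasDerivAt (fun x => θ (q.1, x)) (fderiv ℝ θ q (0, 1)) q.2 :=
    HasFDerivAt.comp_hasDerivAt q.2 (f := fun x => (q.1, x)) (hqv ▸ hθd.hasFDerivAt)
      ((hasDerivAt_const q.2 q.1).prodMk (hasDerivAt_id q.2))
  set m := fderiv ℝ θ q (0, 1) with hm
  have hline1 : HasDerivAt (fun x => (θ (q.1, x)).1) m.1 q.2 := hline.fst
  have hline2 : HasDerivAt (fun x => (θ (q.1, x)).2) m.2 q.2 := hline.snd
  have hcx : Tendsto (fun x => (q.1, x)) (𝓝 q.2) (𝓝 q) := by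
    have : ContinuousAt (fun x : ℝ => (q.1, x)) q.2 := by fun_prop
    exact this
  have hcθ : Tendsto (fun x => θ (q.1, x)) (𝓝 q.2) (𝓝 (t₀, x₀)) := by
    have := hline.continuousAt
    rwa [ContinuousAt, hqv, hθ] at this
  have hgc : ContinuousAt (graphPt u) (t₀, x₀) := (contDiff_graphPt hus).continuous.continuousAt
  have hgc' : ContinuousAt (graphPt u') (t₀, x₀) :=
    (contDiff_graphPt hus').continuous.continuousAt
  have hgr' : graphPt u' (t₀, x₀) = (t₀, x₀, u₀) := by
    rw [← hgr]; simp [graphPt, hval]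
  have hta : Tendsto (fun x => graphPt u (θ (q.1, x))) (𝓝 q.2) (𝓝 (t₀, x₀, u₀)) := by
    rw [ContinuousAt, hgr] at hgc; exact hgc.comp hcθ
  have htb : Tendsto (fun x => graphPt u' (θ (q.1, x))) (𝓝 q.2) (𝓝 (t₀, x₀, u₀)) := by
    rw [ContinuousAt, hgr'] at hgc'; exact hgc'.comp hcθ
  have hθ1 : (θ (q.1, q.2)).1 = t₀ := by rw [hqv, hθ]
  have hpow : (fun x => ((θ (q.1, x)).1 - t₀) ^ 5 - (m.1 * (x - q.2)) ^ 5) =o[𝓝 q.2]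
      fun x => (x - q.2) ^ 5 := by
    have := isLittleO_pow_sub hline1 5
    rwa [hθ1] at this
  have hpowO : (fun x => ((θ (q.1, x)).1 - t₀) ^ 5) =O[𝓝 q.2] fun x => (x - q.2) ^ 5 := by
    have := hline1.differentiableAt.isBigO_sub.pow 5
    rwa [hθ1] at this
  -- Along the line of constant new time, v − v' is −H_u(t − t₀)^5 up to higher order, with t − t₀
  -- of slope m.1. Its fifth derivative is −120H_u m.1^5, so m.1 = 0: the old time is stationary to
  -- first order along this line.
  have ho : (fun x => v (q.1, x) - v' (q.1, x) + pdU H (t₀, x₀, u₀) * ((θ (q.1, x)).1 - t₀) ^ 5)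
      =o[𝓝 q.2] fun x => (x - q.2) ^ 5 := by
    have h1 := (hasStrictFDerivAt_iff_isLittleO.1 hHstrict).comp_tendsto
      (by simpa [nhds_prod_eq] using hta.prodMk htb :
        Tendsto (fun x => (graphPt u (θ (q.1, x)), graphPt u' (θ (q.1, x)))) (𝓝 q.2)
          (𝓝 ((t₀, x₀, u₀), (t₀, x₀, u₀))))
    have hsub : ∀ p : ℝ × ℝ, graphPt u p - graphPt u' p = (0, 0, -(p.1 - t₀) ^ 5) := by
      intro p; simp [graphPt, hu']
    have hO : (((fun p : (ℝ × ℝ × ℝ) × (ℝ × ℝ × ℝ) => p.1 - p.2) ∘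
        fun x => (graphPt u (θ (q.1, x)), graphPt u' (θ (q.1, x)))) : ℝ → ℝ × ℝ × ℝ) =O[𝓝 q.2]
        fun x => (x - q.2) ^ 5 := by
      refine (IsBigO.of_bound 1 (Eventually.of_forall fun x => ?_)).trans hpowO
      simp only [Function.comp, hsub, Prod.norm_def, norm_zero, norm_neg, one_mul]
      exact max_le (norm_nonneg _) (max_le (norm_nonneg _) le_rfl)
    refine (h1.trans_isBigO hO).congr' ?_ EventuallyEq.rfl
    filter_upwards [hcx.eventually hf, hcθ.eventually hzero] with x e1 e2
    simp only [Function.comp, hsub, fderiv_triple, e1, e2]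
    ring
  have hvs : ∀ {w : ℝ × ℝ → ℝ}, ContDiff ℝ ∞ w → ContDiff ℝ ∞ fun x => w (q.1, x) :=
    fun hw => hw.comp (by fun_prop)
  obtain ⟨-, e5⟩ := deriv_eq_of_isLittleO 0 0 0 0 (-(pdU H (t₀, x₀, u₀) * m.1 ^ 5))
    (hvs hv).contDiffAt (hvs hv').contDiffAt (x₀ := q.2)
    ((ho.sub (hpow.const_mul_left (pdU H (t₀, x₀, u₀)))).congr_left fun x => by ring)
  rw [dx_iterate_eq' hv, dx_iterate_eq' hv', e5] at h5
  have hm0 : m.1 = 0 := by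
    have : pdU H (t₀, x₀, u₀) * m.1 ^ 5 = 0 := by linarith
    exact pow_eq_zero_iff (by norm_num) |>.1 ((mul_eq_zero.1 this).resolve_left hHU)
  -- the new coordinates along the line
  have hd := differentiableAt_of_contDiffOn E.isOpen_dom hΦ.smooth hz
  have hlineU : HasDerivAt (fun x => u (θ (q.1, x))) (m.1 * a + m.2 * b) q.2 := by
    have h0 : HasFDerivAt u (fderiv ℝ u (t₀, x₀)) (θ (q.1, q.2)) := by
      rw [hqv, hθ]; exact hud.hasFDerivAt
    refine (h0.comp_hasDerivAt q.2 hline).congr_deriv ?_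
    have := fderiv_graphPt hud m
    have h1 : HasFDerivAt (graphPt u) ((ContinuousLinearMap.fst ℝ ℝ ℝ).prod
      ((ContinuousLinearMap.snd ℝ ℝ ℝ).prod (fderiv ℝ u (t₀, x₀)))) (t₀, x₀) :=
      hasFDerivAt_fst.prodMk (hasFDerivAt_snd.prodMk hud.hasFDerivAt)
    rw [h1.fderiv, hdtu, hdxu] at this
    exact congrArg (fun z => z.2.2) this
  have hcurve : ∀ F : ℝ × ℝ × ℝ → ℝ, DifferentiableAt ℝ F (t₀, x₀, u₀) →
      HasDerivAt (fun x => F (graphPt u (θ (q.1, x)))) (m.1 * pdT F (t₀, x₀, u₀)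
        + m.2 * pdX F (t₀, x₀, u₀) + (m.1 * a + m.2 * b) * pdU F (t₀, x₀, u₀)) q.2 := by
    intro F hF
    have hpt : ((θ (q.1, q.2)).1, (θ (q.1, q.2)).2, u (θ (q.1, q.2))) = (t₀, x₀, u₀) := by
      rw [hqv, hθ, ← hgr]; rfl
    have := hasDerivAt_curve (F := F) (by rw [hpt]; exact hF) hline1 hline2 hlineU
    rw [hpt] at this
    exact this
  have hψ : ∀ᶠ x in 𝓝 q.2, planeMap Φ u (θ (q.1, x)) = (q.1, x) := hcx.eventually hψθ
  have r1 := (hcurve _ hd.fst).unique ((hasDerivAt_const q.2 q.1).congr_of_eventuallyEq (by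
    filter_upwards [hψ] with x hx using (Prod.ext_iff.1 hx).1))
  have r2 := (hcurve _ hd.snd.fst).unique ((hasDerivAt_id q.2).congr_of_eventuallyEq (by
    filter_upwards [hψ] with x hx using (Prod.ext_iff.1 hx).2))
  rw [hm0] at r1 r2
  -- The new x grows at unit rate along the line, so m cannot vanish; as the new time is constant
  -- along it, T_x + bT_u = 0.
  have hm2 : m.2 ≠ 0 := by
    intro h
    rw [h] at r2
    norm_num at r2
  have : m.2 * (pdX (fun z => (Φ z).1) (t₀, x₀, u₀)
      + b * pdU (fun z => (Φ z).1) (t₀, x₀, u₀)) = 0 := by linear_combination r1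
  exact (mul_eq_zero.1 this).resolve_left hm2

/-- The polynomial (T_x + bT_u) · J(a, b) in a, b vanishes identically and the Jacobian factor J is
not the zero polynomial, so the first factor is. The instances chosen isolate the coefficients of
the product. -/
theorem IsPointTransformation.time_pd (hΦ : IsPointTransformation E E' Φ) {ε : ℝ}
    (hε : ε ≠ 0) (hE' : E'.IsConstantCoeff ε) {z : ℝ × ℝ × ℝ} (hz : z ∈ E.dom) :
    pdX (fun z => (Φ z).1) z = 0 ∧ pdU (fun z => (Φ z).1) z = 0 := by
  obtain ⟨t₀, x₀, u₀⟩ := z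
  have key : ∀ a b, (pdX (fun z => (Φ z).1) (t₀, x₀, u₀)
      + b * pdU (fun z => (Φ z).1) (t₀, x₀, u₀)) * planeJac Φ (t₀, x₀, u₀) a b = 0 := by
    intro a b
    by_cases hJ : planeJac Φ (t₀, x₀, u₀) a b = 0
    · rw [hJ, mul_zero]
    · rw [hΦ.time_pd_of_planeJac hε hE' hz hJ, zero_mul]
  obtain ⟨a₁, b₁, hJ⟩ := hΦ.exists_planeJac_ne_zero hz
  have k1 := key 0 0
  have k2 := key 0 1
  have k3 := key 0 (-1)
  have k4 := key 1 0
  have k5 := key 1 1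
  have k6 := key 0 2
  unfold planeJac at k1 k2 k3 k4 k5 k6 hJ
  generalize pdT (fun z => (Φ z).1) (t₀, x₀, u₀) = p at *
  generalize pdX (fun z => (Φ z).1) (t₀, x₀, u₀) = q at *
  generalize pdU (fun z => (Φ z).1) (t₀, x₀, u₀) = r at *
  generalize pdT (fun z => (Φ z).2.1) (t₀, x₀, u₀) = p' at *
  generalize pdX (fun z => (Φ z).2.1) (t₀, x₀, u₀) = q' at *
  generalize pdU (fun z => (Φ z).2.1) (t₀, x₀, u₀) = r' at *
  have hJ' : (p * q' - q * p') + a₁ * (r * q' - q * r') + b₁ * (p * r' - r * p') ≠ 0 := by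
    intro h; apply hJ; linear_combination h
  have g1 : q * (p * q' - q * p') = 0 := by linear_combination k1
  have g2 : q * (r * q' - q * r') = 0 := by linear_combination k4 - k1
  have g3 : r * (p * r' - r * p') = 0 := by linear_combination (k2 + k3 - 2 * k1) / 2
  have g4 : q * (p * r' - r * p') + r * (p * q' - q * p') = 0 := by
    linear_combination (k2 - k3) / 2
  have g5 : r * (r * q' - q * r') = 0 := by linear_combination k5 - k2 - k4 + k1
  have hq : q = 0 := by
    by_contra hq
    have m0 := (mul_eq_zero.1 g1).resolve_left hq
    have m1 := (mul_eq_zero.1 g2).resolve_left hq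
    rw [m0, mul_zero, add_zero] at g4
    have m2 := (mul_eq_zero.1 g4).resolve_left hq
    exact hJ' (by rw [m0, m1, m2]; ring)
  refine ⟨hq, ?_⟩
  by_contra hr
  rw [hq, zero_mul, zero_add] at g4
  have m0 := (mul_eq_zero.1 g4).resolve_left hr
  have m1 := (mul_eq_zero.1 g5).resolve_left hr
  have m2 := (mul_eq_zero.1 g3).resolve_left hr
  exact hJ' (by rw [m1, m2, hq]; linear_combination m0)

end PointTransformation

/-! ### Form of the new space variable and of the new unknown -/

section PointTransformation

variable {E E' : Equation} {Φ : OpenPartialHomeomorph (ℝ × ℝ × ℝ) (ℝ × ℝ × ℝ)} {ε : ℝ}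

theorem IsPointTransformation.time_eq (hΦ : IsPointTransformation E E' Φ) (hε : ε ≠ 0)
    (hE' : E'.IsConstantCoeff ε) {t x₁ u₁ x₂ u₂ : ℝ} (ht : t ∈ E.I)
    (h₁ : u₁ ∈ uRange E.n) (h₂ : u₂ ∈ uRange E.n) : (Φ (t, x₁, u₁)).1 = (Φ (t, x₂, u₂)).1 := by
  have := eq_affine_of_pd (F := fun z => (Φ z).1) (m := 0)
    (hΦ.smooth.fst.differentiableOn (by simp)) ht
    (fun x u hu => (hΦ.time_pd hε hE' (Equation.mem_dom.2 ⟨ht, hu⟩)).1)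
    (fun x u hu => (hΦ.time_pd hε hE' (Equation.mem_dom.2 ⟨ht, hu⟩)).2)
    (x₁ := x₁) (x₂ := x₂) h₁ h₂
  linarith

theorem IsPointTransformation.planeJac_eq (hΦ : IsPointTransformation E E' Φ) (hε : ε ≠ 0)
    (hE' : E'.IsConstantCoeff ε) {z : ℝ × ℝ × ℝ} (hz : z ∈ E.dom) (a b : ℝ) :
    planeJac Φ z a b = pdT (fun z => (Φ z).1) z
      * (pdX (fun z => (Φ z).2.1) z + b * pdU (fun z => (Φ z).2.1) z) := by
  obtain ⟨h1, h2⟩ := hΦ.time_pd hε hE' hz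
  rw [planeJac, h1, h2]
  ring

theorem IsPointTransformation.pdT_time_ne_zero (hΦ : IsPointTransformation E E' Φ) (hε : ε ≠ 0)
    (hE' : E'.IsConstantCoeff ε) {z : ℝ × ℝ × ℝ} (hz : z ∈ E.dom) :
    pdT (fun z => (Φ z).1) z ≠ 0 := by
  obtain ⟨a, b, h⟩ := hΦ.exists_planeJac_ne_zero hz
  rw [hΦ.planeJac_eq hε hE' hz] at h
  exact left_ne_zero_of_mul h

/-- The images `v` and `v'` of two test functions that satisfy the equation at a point. -/
theorem IsPointTransformation.compare_testFn (hΦ : IsPointTransformation E E' Φ) (hε : ε ≠ 0)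
    (hE' : E'.IsConstantCoeff ε) {t₀ x₀ u₀ a b d c a' b' d' c' : ℝ} (hz : (t₀, x₀, u₀) ∈ E.dom)
    (hl : a + u₀ ^ E.n * b + E.α t₀ * u₀ + E.β t₀ * c = 0)
    (hl' : a' + u₀ ^ E.n * b' + E.α t₀ * u₀ + E.β t₀ * c' = 0)
    (hr : pdX (fun z => (Φ z).2.1) (t₀, x₀, u₀) + b * pdU (fun z => (Φ z).2.1) (t₀, x₀, u₀) ≠ 0)
    (hr' : pdX (fun z => (Φ z).2.1) (t₀, x₀, u₀)
      + b' * pdU (fun z => (Φ z).2.1) (t₀, x₀, u₀) ≠ 0) :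
    ∃ (v v' : ℝ × ℝ → ℝ) (q : ℝ × ℝ), ContDiff ℝ ∞ v ∧ ContDiff ℝ ∞ v' ∧
      q = ((Φ (t₀, x₀, u₀)).1, (Φ (t₀, x₀, u₀)).2.1) ∧
      dt v q + (Φ (t₀, x₀, u₀)).2.2 ^ E'.n * dx v q + ε * dx^[5] v q = 0 ∧
      dt v' q + (Φ (t₀, x₀, u₀)).2.2 ^ E'.n * dx v' q + ε * dx^[5] v' q = 0 ∧
      (dt v q - dt v' q) * pdT (fun z => (Φ z).1) (t₀, x₀, u₀)
        + (dx v q - dx v' q) * (pdT (fun z => (Φ z).2.1) (t₀, x₀, u₀)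
          + a * pdU (fun z => (Φ z).2.1) (t₀, x₀, u₀))
        = (a - a') * pdU (pullback Φ v') (t₀, x₀, u₀) ∧
      (dx v q - dx v' q) * (pdX (fun z => (Φ z).2.1) (t₀, x₀, u₀)
          + b * pdU (fun z => (Φ z).2.1) (t₀, x₀, u₀))
        = (b - b') * pdU (pullback Φ v') (t₀, x₀, u₀) ∧
      (∀ᶠ x in 𝓝 x₀, v (q.1, (Φ (t₀, x, testPoly x₀ u₀ b d c x)).2.1)
          - v' (q.1, (Φ (t₀, x, testPoly x₀ u₀ b d c x)).2.1)
        = pullback Φ v' (t₀, x, testPoly x₀ u₀ b d c x)) ∧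
      (∀ᶠ x in 𝓝 x₀, pullback Φ v' (t₀, x, testPoly x₀ u₀ b' d' c' x) = 0) ∧
      pdT (pullback Φ v') (t₀, x₀, u₀) + a' * pdU (pullback Φ v') (t₀, x₀, u₀) = 0 ∧
      pdX (pullback Φ v') (t₀, x₀, u₀) + b' * pdU (pullback Φ v') (t₀, x₀, u₀) = 0 ∧
      pdU (pullback Φ v') (t₀, x₀, u₀) ≠ 0 := by
  obtain ⟨ht, huR⟩ := Equation.mem_dom.1 hz
  have hTt := hΦ.pdT_time_ne_zero hε hE' hz
  have hus : ContDiff ℝ ∞ (testFn t₀ x₀ u₀ a b d c) := contDiff_testFn ..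
  have hus' : ContDiff ℝ ∞ (testFn t₀ x₀ u₀ a' b' d' c') := contDiff_testFn ..
  obtain ⟨v, v', θ, hv, hv', hvq, hvq', hdiff, hzero, -, -, -, hlv, hlv', hHT, hHX, hHU⟩ :=
    hΦ.compare hus hus' (p := (t₀, x₀)) (by simp) (by simpa using hz)
      (by simpa [hΦ.planeJac_eq hε hE' hz] using ⟨hTt, hr⟩)
      (by simpa [hΦ.planeJac_eq hε hE' hz] using ⟨hTt, hr'⟩)
  have hq : planeMap Φ (testFn t₀ x₀ u₀ a b d c) (t₀, x₀)
      = ((Φ (t₀, x₀, u₀)).1, (Φ (t₀, x₀, u₀)).2.1) := by simp [planeMap]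
  set q := planeMap Φ (testFn t₀ x₀ u₀ a b d c) (t₀, x₀) with hqdef
  have hq1 : q.1 ∈ E'.I := by rw [hq]; exact hΦ.fst_mem hz
  simp only [graphPt_testFn, dt_testFn, dx_testFn] at hvq hvq' hHT hHX hHU
  have e1 := hlv (by rw [lhs_testFn]; exact hl)
  have e2 := hlv' (by rw [lhs_testFn]; exact hl')
  rw [lhs_of_isConstantCoeff hE' hq1, hvq] at e1
  rw [lhs_of_isConstantCoeff hE' hq1, hvq'] at e2
  have hcx : Tendsto (fun x => (t₀, x)) (𝓝 x₀) (𝓝 (t₀, x₀)) := by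
    have : ContinuousAt (fun x : ℝ => (t₀, x)) x₀ := by fun_prop
    exact this
  have hchain : ∀ w : ℝ × ℝ, w.1 * a * pdU (pullback Φ v') (t₀, x₀, u₀)
      + w.2 * b * pdU (pullback Φ v') (t₀, x₀, u₀) + w.1 * pdT (pullback Φ v') (t₀, x₀, u₀)
      + w.2 * pdX (pullback Φ v') (t₀, x₀, u₀)
      = (dt v q - dt v' q) * (w.1 * pdT (fun z => (Φ z).1) (t₀, x₀, u₀))
        + (dx v q - dx v' q) * (w.1 * pdT (fun z => (Φ z).2.1) (t₀, x₀, u₀)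
          + w.2 * pdX (fun z => (Φ z).2.1) (t₀, x₀, u₀)
          + (w.1 * a + w.2 * b) * pdU (fun z => (Φ z).2.1) (t₀, x₀, u₀)) := by
    intro w
    obtain ⟨hTx, hTu⟩ := hΦ.time_pd hε hE' hz
    have hgr : graphPt (testFn t₀ x₀ u₀ a b d c) (t₀, x₀) = (t₀, x₀, u₀) := graphPt_testFn ..
    have hud := hus.differentiable (by simp) (t₀, x₀)
    have hHd : HasFDerivAt (pullback Φ v) (fderiv ℝ (pullback Φ v) (t₀, x₀, u₀))
        (graphPt (testFn t₀ x₀ u₀ a b d c) (t₀, x₀)) := by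
      rw [hgr]
      exact (differentiableAt_of_contDiffOn E.isOpen_dom (contDiffOn_pullback hΦ hv) hz).hasFDerivAt
    have h1 : HasFDerivAt (fun p => pullback Φ v (graphPt (testFn t₀ x₀ u₀ a b d c) p)) _ (t₀, x₀) :=
      hHd.comp (t₀, x₀) ((contDiff_graphPt hus).differentiable (by simp) (t₀, x₀)).hasFDerivAt
    have h2 := h1.unique ((hasFDerivAt_const (0 : ℝ) (t₀, x₀)).congr_of_eventuallyEq (by
      filter_upwards [hdiff] with p h
      simp only [pullback, planeMap] at h ⊢
      linarith))
    have h3 := congrArg (fun L => L w) h2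
    simp only [ContinuousLinearMap.comp_apply, fderiv_graphPt hud, dt_testFn, dx_testFn,
      zero_apply, fderiv_pullback hΦ hv hz] at h3
    have h4 := fderiv_pullback hΦ hv' hz (w.1, w.2, w.1 * a + w.2 * b)
    rw [← hq] at h3 h4
    simp only [fderiv_triple, hTx, hTu] at h3 h4
    linear_combination h4 + h3
  refine ⟨v, v', q, hv, hv', hq, e1, e2, ?_, ?_, ?_, ?_, hHT, hHX, hHU⟩
  · linear_combination - hchain (1, 0) + hHT
  · linear_combination - hchain (0, 1) + hHX
  · filter_upwards [hcx.eventually hdiff, eventually_slice_mem_dom (φ := testPoly x₀ u₀ b d c)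
      (contDiff_testPoly x₀ u₀ b c d).continuous.continuousAt (by simpa using hz)] with x h hx
    rw [graphPt_testFn_slice] at h
    have hT : planeMap Φ (testFn t₀ x₀ u₀ a b d c) (t₀, x)
        = (q.1, (Φ (t₀, x, testPoly x₀ u₀ b d c x)).2.1) := by
      rw [planeMap, graphPt_testFn_slice, hq]
      exact Prod.ext (hΦ.time_eq hε hE' ht (Equation.mem_dom.1 hx).2 huR) rfl
    rwa [hT] at h
  · filter_upwards [hcx.eventually hzero] with x h
    rwa [graphPt_testFn_slice] at h

/-- The fifth `x`-derivatives of two functions, from their difference along a curve. -/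
theorem dx_five_sub_of_isLittleO {v v' : ℝ × ℝ → ℝ} (hv : ContDiff ℝ ∞ v) (hv' : ContDiff ℝ ∞ v')
    {t x₀ r : ℝ} {χ : ℝ → ℝ} (k l b c : ℝ) (hχ : HasDerivAt χ r x₀) (hr : r ≠ 0)
    (h : (fun x => v (t, χ x) - v' (t, χ x) - (k + l * (χ x - χ x₀) + b * (χ x - χ x₀) ^ 4
      + c * (χ x - χ x₀) ^ 5)) =o[𝓝 x₀] fun x => (x - x₀) ^ 5) :
    dx^[5] v (t, χ x₀) - dx^[5] v' (t, χ x₀) = 120 * c := by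
  have hs : ∀ {w : ℝ × ℝ → ℝ}, ContDiff ℝ ∞ w → ContDiff ℝ ∞ fun x => w (t, x) :=
    fun hw => hw.comp (by fun_prop)
  have h5 := (deriv_of_comp_isLittleO (f := fun x => v (t, x) - v' (t, x)) k l b c
    ((hs hv).sub (hs hv')) hχ hr h).2
  rw [iteratedDeriv_fun_sub ((hs hv).of_le ENat.LEInfty.out).contDiffAt
    ((hs hv').of_le ENat.LEInfty.out).contDiffAt] at h5
  rw [dx_iterate_eq' hv, dx_iterate_eq' hv', ← h5]

theorem IsPointTransformation.differentiableAt_space (hΦ : IsPointTransformation E E' Φ)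
    {z : ℝ × ℝ × ℝ} (hz : z ∈ E.dom) : DifferentiableAt ℝ (fun z => (Φ z).2.1) z :=
  differentiableAt_of_contDiffOn E.isOpen_dom hΦ.smooth.snd.fst hz

/-- Raising u_xxxxx by 1 lowers u_t by β. In the image, with r = X_x + bX_u, the fifth derivative
changes by H_u / r^5 and the time derivative by −βH_u / T_t, while value and first x-derivative are
kept. The new equation balances the two changes. -/
theorem IsPointTransformation.beta_mul_pow_eq (hΦ : IsPointTransformation E E' Φ) (hε : ε ≠ 0)
    (hE' : E'.IsConstantCoeff ε) {t₀ x₀ u₀ b : ℝ} (hz : (t₀, x₀, u₀) ∈ E.dom)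
    (hr : pdX (fun z => (Φ z).2.1) (t₀, x₀, u₀) + b * pdU (fun z => (Φ z).2.1) (t₀, x₀, u₀) ≠ 0) :
    E.β t₀ * (pdX (fun z => (Φ z).2.1) (t₀, x₀, u₀)
      + b * pdU (fun z => (Φ z).2.1) (t₀, x₀, u₀)) ^ 5
      = ε * pdT (fun z => (Φ z).1) (t₀, x₀, u₀) := by
  have hT := hΦ.pdT_time_ne_zero hε hE' hz
  set a := -(u₀ ^ E.n * b + E.α t₀ * u₀) with ha
  obtain ⟨v, v', q, hv, hv', hq, e1, e2, ht, hx, hdiff, hzero, -, -, hκ⟩ :=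
    hΦ.compare_testFn hε hE' (a := a) (b := b) (d := 0) (c := 0) (a' := a - E.β t₀) (b' := b)
      (d' := 0) (c' := 1) hz (by rw [ha]; ring) (by rw [ha]; ring) hr hr
  have hχ : HasDerivAt (fun x => (Φ (t₀, x, testPoly x₀ u₀ b 0 0 x)).2.1) _ x₀ :=
    hasDerivAt_slice (F := fun z => (Φ z).2.1) (by simpa using hΦ.differentiableAt_space hz)
      (hasDerivAt_testPoly x₀ u₀ b 0 0 x₀)
  simp only [testPoly_self, sub_self, ne_eq, OfNat.ofNat_ne_zero, not_false_eq_true, zero_pow,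
    mul_zero, add_zero] at hχ
  set r := pdX (fun z => (Φ z).2.1) (t₀, x₀, u₀) + b * pdU (fun z => (Φ z).2.1) (t₀, x₀, u₀)
  set H := pullback Φ v' with hH
  set κ := pdU H (t₀, x₀, u₀)
  have hHs : ContDiffOn ℝ ∞ H E.dom := contDiffOn_pullback hΦ hv'
  have hpert := isLittleO_perturb_five hHs (t₀ := t₀) (x₀ := x₀) (φ := testPoly x₀ u₀ b 0 0) (c := 1 / 120)
    (by simpa using hz) (contDiff_testPoly x₀ u₀ b 0 0).continuous.continuousAt
  have hpow := isLittleO_pow_sub hχ 5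
  have h5 := dx_five_sub_of_isLittleO hv hv' 0 0 0 (-κ / (120 * r ^ 5)) hχ hr (t := q.1) (by
    refine ((hpert.neg_left).sub (hpow.const_mul_left (-κ / (120 * r ^ 5)))).congr' ?_
      EventuallyEq.rfl
    filter_upwards [hdiff, hzero] with x h1 h2
    have h3 : testPoly x₀ u₀ b 0 1 x = testPoly x₀ u₀ b 0 0 x + 1 / 120 * (x - x₀) ^ 5 := by
      simp [testPoly]
    rw [h3] at h2
    simp only [h1, h2, testPoly_self]
    field_simp
    ring)
  have hqq : q = (q.1, (Φ (t₀, x₀, testPoly x₀ u₀ b 0 0 x₀)).2.1) := by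
    rw [hq]; simp
  rw [← hqq] at h5
  rw [sub_self, zero_mul] at hx
  have hx' := (mul_eq_zero.1 hx).resolve_right hr
  rw [hx', zero_mul, add_zero, sub_sub_cancel] at ht
  have key : κ * (E.β t₀ * r ^ 5 - ε * pdT (fun z => (Φ z).1) (t₀, x₀, u₀)) = 0 := by
    have h6 : (dx^[5] v q - dx^[5] v' q) * r ^ 5 = -κ := by
      rw [h5]; field_simp
    linear_combination -r ^ 5 * ht - ε * pdT (fun z => (Φ z).1) (t₀, x₀, u₀) * h6
      + r ^ 5 * pdT (fun z => (Φ z).1) (t₀, x₀, u₀) * (e1 - e2)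
      - r ^ 5 * pdT (fun z => (Φ z).1) (t₀, x₀, u₀) * (Φ (t₀, x₀, u₀)).2.2 ^ E'.n * hx'
  exact sub_eq_zero.1 ((mul_eq_zero.1 key).resolve_left hκ)

/-- The new space variable does not depend on `u`, and its derivative with respect to `x` is
determined by that of the new time. -/
theorem IsPointTransformation.space_pd (hΦ : IsPointTransformation E E' Φ) (hε : ε ≠ 0)
    (hE' : E'.IsConstantCoeff ε) {z : ℝ × ℝ × ℝ} (hz : z ∈ E.dom) :
    pdU (fun z => (Φ z).2.1) z = 0 ∧ pdX (fun z => (Φ z).2.1) z ≠ 0 ∧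
      E.β z.1 * pdX (fun z => (Φ z).2.1) z ^ 5 = ε * pdT (fun z => (Φ z).1) z := by
  obtain ⟨t₀, x₀, u₀⟩ := z
  have hβ := E.β_ne_zero t₀ (Equation.mem_dom.1 hz).1
  have hU : pdU (fun z => (Φ z).2.1) (t₀, x₀, u₀) = 0 := by
    by_contra hU
    -- If X_u ≠ 0, a suitable slope b gives X_x + bX_u any value s, so βs^5 would not depend on s ≠
    -- 0; comparing s = 2 and s = 1 gives 31β = 0.
    have key : ∀ s : ℝ, s ≠ 0 →
        E.β t₀ * s ^ 5 = ε * pdT (fun z => (Φ z).1) (t₀, x₀, u₀) := by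
      intro s hs
      have h : pdX (fun z => (Φ z).2.1) (t₀, x₀, u₀)
          + (s - pdX (fun z => (Φ z).2.1) (t₀, x₀, u₀)) / pdU (fun z => (Φ z).2.1) (t₀, x₀, u₀)
            * pdU (fun z => (Φ z).2.1) (t₀, x₀, u₀) = s := by
        field_simp; ring
      have := hΦ.beta_mul_pow_eq hε hE' hz (by rw [h]; exact hs)
      rwa [h] at this
    apply hβ
    linear_combination (key 2 two_ne_zero - key 1 one_ne_zero) / 31
  obtain ⟨a, b, hJ⟩ := hΦ.exists_planeJac_ne_zero hz
  rw [hΦ.planeJac_eq hε hE' hz, hU, mul_zero, add_zero] at hJ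
  have hX := right_ne_zero_of_mul hJ
  refine ⟨hU, hX, ?_⟩
  simpa using hΦ.beta_mul_pow_eq hε hE' (b := 0) hz (by simpa using hX)

/-- The new space variable is affine in `x`. -/
theorem IsPointTransformation.space_eq (hΦ : IsPointTransformation E E' Φ) (hε : ε ≠ 0)
    (hE' : E'.IsConstantCoeff ε) {t x₁ u₁ x₂ u₂ : ℝ} (ht : t ∈ E.I)
    (h₁ : u₁ ∈ uRange E.n) (h₂ : u₂ ∈ uRange E.n) :
    (Φ (t, x₁, u₁)).2.1 - (Φ (t, x₂, u₂)).2.1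
      = pdX (fun z => (Φ z).2.1) (t, 0, 1) * (x₁ - x₂) ∧
    pdX (fun z => (Φ z).2.1) (t, x₁, u₁) = pdX (fun z => (Φ z).2.1) (t, 0, 1) := by
  have hone := one_mem_uRange E.n
  have hX : ∀ x, ∀ u ∈ uRange E.n, pdX (fun z => (Φ z).2.1) (t, x, u)
      = pdX (fun z => (Φ z).2.1) (t, 0, 1) := by
    intro x u hu
    have e1 := (hΦ.space_pd hε hE' (Equation.mem_dom.2 ⟨ht, hu⟩ : (t, x, u) ∈ E.dom)).2.2
    have e2 := (hΦ.space_pd hε hE' (Equation.mem_dom.2 ⟨ht, hone⟩ : (t, 0, 1) ∈ E.dom)).2.2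
    have e3 : pdT (fun z => (Φ z).1) (t, x, u) = pdT (fun z => (Φ z).1) (t, 0, 1) :=
      pdT_eq_of_eq hΦ.smooth.fst ht hu hone fun s hs => hΦ.time_eq hε hE' hs hu hone
    rw [e3, ← e2] at e1
    -- X_x is recovered from X_x^5 = εT_t / β, whose right side depends on t only.
    exact (Odd.strictMono_pow (by decide : Odd 5)).injective
      (mul_left_cancel₀ (E.β_ne_zero t ht) e1)
  exact ⟨eq_affine_of_pd (F := fun z => (Φ z).2.1) (hΦ.smooth.snd.fst.differentiableOn (by simp))
    ht hX (fun x u hu => (hΦ.space_pd hε hE' (Equation.mem_dom.2 ⟨ht, hu⟩)).1) h₁ h₂, hX _ _ h₁⟩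

/-- As T and X do not involve u, the function v drops out of this derivative. -/
theorem IsPointTransformation.pdU_pullback (hΦ : IsPointTransformation E E' Φ) (hε : ε ≠ 0)
    (hE' : E'.IsConstantCoeff ε) {v : ℝ × ℝ → ℝ} (hv : ContDiff ℝ ∞ v) {z : ℝ × ℝ × ℝ}
    (hz : z ∈ E.dom) : pdU (pullback Φ v) z = pdU (fun z => (Φ z).2.2) z := by
  rw [pdU, fderiv_pullback hΦ hv hz]
  change _ - (pdU (fun z => (Φ z).1) z * _ + pdU (fun z => (Φ z).2.1) z * _) = _
  rw [(hΦ.time_pd hε hE' hz).2, (hΦ.space_pd hε hE' hz).1]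
  simp [pdU]

/-- The derivative of the new `u` with respect to `u` does not depend on `x` and `u`. -/
theorem IsPointTransformation.pd_pdU_eq_zero (hΦ : IsPointTransformation E E' Φ) (hε : ε ≠ 0)
    (hE' : E'.IsConstantCoeff ε) {z : ℝ × ℝ × ℝ} (hz : z ∈ E.dom) :
    pdX (pdU fun z => (Φ z).2.2) z = 0 ∧ pdU (pdU fun z => (Φ z).2.2) z = 0 := by
  obtain ⟨t₀, x₀, u₀⟩ := z
  obtain ⟨ht₀, hu₀⟩ := Equation.mem_dom.1 hz
  suffices key : ∀ b, pdX (pdU fun z => (Φ z).2.2) (t₀, x₀, u₀)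
      + b * pdU (pdU fun z => (Φ z).2.2) (t₀, x₀, u₀) = 0 by
    have h0 := key 0
    have h1 := key 1
    exact ⟨by linarith, by linarith⟩
  intro b
  obtain ⟨hXu, hXx, -⟩ := hΦ.space_pd hε hE' hz
  have hT := hΦ.pdT_time_ne_zero hε hE' hz
  have hr : pdX (fun z => (Φ z).2.1) (t₀, x₀, u₀)
      + b * pdU (fun z => (Φ z).2.1) (t₀, x₀, u₀) ≠ 0 := by rwa [hXu, mul_zero, add_zero]
  set a := -(u₀ ^ E.n * b + E.α t₀ * u₀) with ha
  obtain ⟨v, v', q, hv, hv', hq, e1, e2, ht, hx, hdiff, hzero, -, -, -⟩ :=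
    hΦ.compare_testFn hε hE' (a := a) (b := b) (d := 0) (c := 0) (a' := a) (b' := b)
      (d' := 1) (c' := 0) hz (by rw [ha]; ring) (by rw [ha]; ring) hr hr
  set φ := testPoly x₀ u₀ b 0 0 with hφdef
  have hφs : ContDiff ℝ ∞ φ := contDiff_testPoly x₀ u₀ b 0 0
  have hφ0 : φ x₀ = u₀ := testPoly_self ..
  have hφ : HasDerivAt φ b x₀ := by
    simpa using hasDerivAt_testPoly x₀ u₀ b 0 0 x₀
  have hslice : (t₀, x₀, φ x₀) ∈ E.dom := by rwa [hφ0]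
  set H := pullback Φ v' with hH
  have hHs : ContDiffOn ℝ ∞ H E.dom := contDiffOn_pullback hΦ hv'
  have hHUe : pdU H =ᶠ[𝓝 (t₀, x₀, u₀)] pdU fun z => (Φ z).2.2 := by
    filter_upwards [E.isOpen_dom.mem_nhds hz] with z hz using hΦ.pdU_pullback hε hE' hv' hz
  have hfd := hHUe.fderiv_eq (𝕜 := ℝ)
  have hpX : pdX (pdU H) (t₀, x₀, u₀) = pdX (pdU fun z => (Φ z).2.2) (t₀, x₀, u₀) := by
    simp only [pdX, hfd]
  have hpU : pdU (pdU H) (t₀, x₀, u₀) = pdU (pdU fun z => (Φ z).2.2) (t₀, x₀, u₀) := by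
    change fderiv ℝ (pdU H) _ _ = _
    rw [hfd]; rfl
  rw [← hpX, ← hpU]
  set m := pdX (fun z => (Φ z).2.1) (t₀, 0, 1) with hm
  have hm0 : m ≠ 0 := by
    rw [hm, ← (hΦ.space_eq hε hE' (x₁ := x₀) (x₂ := x₀) ht₀ hu₀ hu₀).2]; exact hXx
  set χ : ℝ → ℝ := fun x => (Φ (t₀, x₀, u₀)).2.1 + m * (x - x₀) with hχdef
  have hχ : HasDerivAt χ m x₀ := by
    exact ((((hasDerivAt_id x₀).sub_const x₀).const_mul m).const_add
      (Φ (t₀, x₀, u₀)).2.1).congr_deriv (mul_one m)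
  have hpert := isLittleO_perturb_four hHs (c := 1 / 24) hslice hφ
  rw [hφ0] at hpert
  set κ := pdU H (t₀, x₀, u₀)
  set μ := pdX (pdU H) (t₀, x₀, u₀) + b * pdU (pdU H) (t₀, x₀, u₀)
  -- Only u_xxxx differs between the two test functions, so the images share their first derivatives
  -- and hence, by the equation, the fifth one. Since X is affine in x, the fourth-order term of the
  -- difference does not contribute to that derivative, and what remains is the multiple of μ.
  have h5 := dx_five_sub_of_isLittleO hv hv' 0 0 (-κ / (24 * m ^ 4)) (-μ / (24 * m ^ 5)) hχ hm0
    (t := q.1) (by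
    refine hpert.neg_left.congr' ?_ EventuallyEq.rfl
    filter_upwards [hdiff, hzero, eventually_slice_mem_dom hφ.continuousAt hslice] with x h1 h2 hxd
    have h3 : testPoly x₀ u₀ b 1 0 x = φ x + 1 / 24 * (x - x₀) ^ 4 := by
      simp [hφdef, testPoly]
    have h4 : (Φ (t₀, x, φ x)).2.1 = χ x := by
      linear_combination (hΦ.space_eq hε hE' (x₁ := x) (x₂ := x₀) ht₀
        (Equation.mem_dom.1 hxd).2 hu₀).1
    rw [h3] at h2
    rw [h4] at h1
    rw [h1, h2]
    simp only [hχdef]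
    field_simp
    ring)
  have hqq : q = (q.1, χ x₀) := by rw [hq]; simp [hχdef]
  rw [← hqq] at h5
  rw [sub_self, zero_mul] at hx ht
  have hx' := (mul_eq_zero.1 hx).resolve_right hr
  rw [hx', zero_mul, add_zero] at ht
  have ht' := (mul_eq_zero.1 ht).resolve_right hT
  have h6 : ε * (dx^[5] v q - dx^[5] v' q) = 0 := by
    linear_combination e1 - e2 - ht' - (Φ (t₀, x₀, u₀)).2.2 ^ E'.n * hx'
  have h7 := (mul_eq_zero.1 h6).resolve_left hε
  rw [h7] at h5
  have h8 : -μ / (24 * m ^ 5) = 0 := by linarith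
  rw [div_eq_zero_iff] at h8
  have := h8.resolve_right (by positivity)
  linarith

theorem IsPointTransformation.pdU_unknown (hΦ : IsPointTransformation E E' Φ) (hε : ε ≠ 0)
    (hE' : E'.IsConstantCoeff ε) {t x u : ℝ} (ht : t ∈ E.I) (hu : u ∈ uRange E.n) :
    pdU (fun z => (Φ z).2.2) (t, x, u) = pdU (fun z => (Φ z).2.2) (t, 0, 1) ∧
      (Φ (t, x, u)).2.2 = (Φ (t, x, 1)).2.2 + pdU (fun z => (Φ z).2.2) (t, 0, 1) * (u - 1) :=
  eq_affine_of_pdU (F := fun z => (Φ z).2.2) hΦ.smooth.snd.snd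
    (fun _ hz => (hΦ.pd_pdU_eq_zero hε hE' hz).1)
    (fun _ hz => (hΦ.pd_pdU_eq_zero hε hE' hz).2) ht hu

/-- The relation between the old and the new unknown that comes from the nonlinear term. -/
theorem IsPointTransformation.rpow_unknown (hΦ : IsPointTransformation E E' Φ) (hε : ε ≠ 0)
    (hE' : E'.IsConstantCoeff ε) {t₀ x₀ u₀ : ℝ} (hz : (t₀, x₀, u₀) ∈ E.dom) :
    pdU (fun z => (Φ z).2.2) (t₀, 0, 1) ≠ 0 ∧
    (Φ (t₀, x₀, u₀)).2.2 ^ E'.n * pdT (fun z => (Φ z).1) (t₀, x₀, u₀)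
      = u₀ ^ E.n * pdX (fun z => (Φ z).2.1) (t₀, 0, 1)
        + pdT (fun z => (Φ z).2.1) (t₀, x₀, u₀) := by
  obtain ⟨ht₀, hu₀⟩ := Equation.mem_dom.1 hz
  obtain ⟨hXu, hXx, -⟩ := hΦ.space_pd hε hE' hz
  have hr : ∀ b : ℝ, pdX (fun z => (Φ z).2.1) (t₀, x₀, u₀)
      + b * pdU (fun z => (Φ z).2.1) (t₀, x₀, u₀) ≠ 0 := by
    intro b; rwa [hXu, mul_zero, add_zero]
  obtain ⟨v, v', q, hv, hv', hq, e1, e2, ht, hx, hdiff, hzero, -, -, hκ⟩ :=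
    hΦ.compare_testFn hε hE' (a := -(u₀ ^ E.n + E.α t₀ * u₀)) (b := 1) (d := 0) (c := 0)
      (a' := -(E.α t₀ * u₀)) (b' := 0) (d' := 0) (c' := 0) hz (by ring) (by ring) (hr 1) (hr 0)
  have hA := (hΦ.pdU_unknown hε hE' (x := x₀) ht₀ hu₀).1
  rw [hΦ.pdU_pullback hε hE' hv' hz, hA] at hκ ht hx
  have hm := (hΦ.space_eq hε hE' (x₁ := x₀) (x₂ := x₀) ht₀ hu₀ hu₀).2
  rw [hXu, hm] at hx
  rw [hXu] at ht
  rw [hm] at hXx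
  set m := pdX (fun z => (Φ z).2.1) (t₀, 0, 1) with hmdef
  set A := pdU (fun z => (Φ z).2.2) (t₀, 0, 1)
  set χ : ℝ → ℝ := fun x => (Φ (t₀, x₀, u₀)).2.1 + m * (x - x₀) with hχdef
  have hχ : HasDerivAt χ m x₀ :=
    ((((hasDerivAt_id x₀).sub_const x₀).const_mul m).const_add
      (Φ (t₀, x₀, u₀)).2.1).congr_deriv (mul_one m)
  -- The test functions differ by x − x₀ on the slice, and U is affine in u with slope A, so the
  -- images differ there exactly by a linear function of the new x and have equal fifth derivatives.
  have h5 := dx_five_sub_of_isLittleO hv hv' 0 (A / m) 0 0 hχ hXx (t := q.1) (by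
    refine (isLittleO_zero _ _).congr' ?_ EventuallyEq.rfl
    filter_upwards [hdiff, hzero, eventually_slice_mem_dom (φ := testPoly x₀ u₀ 1 0 0)
      (contDiff_testPoly x₀ u₀ 1 0 0).continuous.continuousAt (by simpa using hz)] with x h1 h2 hxd
    have hu := (Equation.mem_dom.1 hxd).2
    have p0 : testPoly x₀ u₀ 0 0 0 x = u₀ := by simp [testPoly]
    have p1 : testPoly x₀ u₀ 1 0 0 x = u₀ + (x - x₀) := by simp [testPoly]
    rw [p0] at h2
    rw [p1] at h1 hu
    have hX : ∀ u ∈ uRange E.n, (Φ (t₀, x, u)).2.1 = χ x := by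
      intro u hu
      linear_combination (hΦ.space_eq hε hE' (x₁ := x) (x₂ := x₀) ht₀ hu hu₀).1
    have hT : ∀ u ∈ uRange E.n, (Φ (t₀, x, u)).1 = q.1 := by
      intro u hu
      rw [hq]; exact hΦ.time_eq hε hE' ht₀ hu hu₀
    rw [pullback, hX _ hu, hT _ hu, (hΦ.pdU_unknown hε hE' ht₀ hu).2] at h1
    rw [pullback, hX _ hu₀, hT _ hu₀, (hΦ.pdU_unknown hε hE' ht₀ hu₀).2] at h2
    have h3 : χ x - χ x₀ = m * (x - x₀) := by simp [hχdef]
    rw [h3]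
    field_simp
    linear_combination -h2 - h1)
  have hqq : q = (q.1, χ x₀) := by rw [hq]; simp [hχdef]
  rw [← hqq, mul_zero] at h5
  refine ⟨hκ, mul_left_cancel₀ hκ ?_⟩
  linear_combination pdT (fun z => (Φ z).1) (t₀, x₀, u₀) * m * (e1 - e2 - ε * h5) - m * ht
    + (pdT (fun z => (Φ z).2.1) (t₀, x₀, u₀)
      - (Φ (t₀, x₀, u₀)).2.2 ^ E'.n * pdT (fun z => (Φ z).1) (t₀, x₀, u₀)) * hx

/-- The new unknown is proportional to `u`, and the new space variable does not depend on `t`. -/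
theorem IsPointTransformation.unknown_eq (hΦ : IsPointTransformation E E' Φ) (hε : ε ≠ 0)
    (hE' : E'.IsConstantCoeff ε) (hn : E'.n = E.n) {t x u : ℝ} (ht : t ∈ E.I)
    (hu : u ∈ uRange E.n) :
    (Φ (t, x, u)).2.2 = pdU (fun z => (Φ z).2.2) (t, 0, 1) * u ∧
    pdT (fun z => (Φ z).2.1) (t, x, u) = 0 ∧
    pdU (fun z => (Φ z).2.2) (t, 0, 1) ^ E.n * pdT (fun z => (Φ z).1) (t, x, u)
      = pdX (fun z => (Φ z).2.1) (t, 0, 1) := by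
  have hone := one_mem_uRange E.n
  have hT : ∀ w ∈ uRange E.n, pdT (fun z => (Φ z).1) (t, x, w)
      = pdT (fun z => (Φ z).1) (t, x, 1) := fun w hw =>
    pdT_eq_of_eq hΦ.smooth.fst ht hw hone fun s hs => hΦ.time_eq hε hE' hs hw hone
  have hXt : ∀ w ∈ uRange E.n, pdT (fun z => (Φ z).2.1) (t, x, w)
      = pdT (fun z => (Φ z).2.1) (t, x, 1) := fun w hw =>
    pdT_eq_of_eq hΦ.smooth.snd.fst ht hw hone fun s hs => by
      have := (hΦ.space_eq hε hE' (x₁ := x) (x₂ := x) hs hw hone).1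
      rwa [sub_self, mul_zero, sub_eq_zero] at this
  have hz : (t, x, 1) ∈ E.dom := Equation.mem_dom.2 ⟨ht, hone⟩
  have hT0 := hΦ.pdT_time_ne_zero hε hE' hz
  have hm0 := (hΦ.space_pd hε hE' (Equation.mem_dom.2 ⟨ht, hone⟩ : (t, 0, 1) ∈ E.dom)).2.1
  -- For fixed t and x, U is affine in u; dividing the relation of `rpow_unknown` by T_t gives an
  -- identity of powers in u > 0. This is where equality of the two exponents enters.
  obtain ⟨h1, h2, h3⟩ := affine_rpow_eq (n := E.n) (a := pdU (fun z => (Φ z).2.2) (t, 0, 1))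
    (b := (Φ (t, x, 1)).2.2 - pdU (fun z => (Φ z).2.2) (t, 0, 1))
    (A := pdX (fun z => (Φ z).2.1) (t, 0, 1) / pdT (fun z => (Φ z).1) (t, x, 1))
    (B := pdT (fun z => (Φ z).2.1) (t, x, 1) / pdT (fun z => (Φ z).1) (t, x, 1))
    E.n_ne_zero E.n_ne_one (hΦ.rpow_unknown hε hE' hz).1 (div_ne_zero hm0 hT0) (by
      intro w hw
      have hw' : w ∈ uRange E.n := mem_uRange_of_pos hw
      have h := (hΦ.rpow_unknown hε hE' (Equation.mem_dom.2 ⟨ht, hw'⟩ : (t, x, w) ∈ E.dom)).2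
      rw [hn, hT w hw', hXt w hw', (hΦ.pdU_unknown hε hE' ht hw').2] at h
      rw [show pdU (fun z => (Φ z).2.2) (t, 0, 1) * w
        + ((Φ (t, x, 1)).2.2 - pdU (fun z => (Φ z).2.2) (t, 0, 1)) = (Φ (t, x, 1)).2.2
        + pdU (fun z => (Φ z).2.2) (t, 0, 1) * (w - 1) by ring]
      field_simp
      linear_combination h)
  refine ⟨?_, ?_, ?_⟩
  · rw [(hΦ.pdU_unknown hε hE' ht hu).2]; linear_combination h1
  · rw [hXt u hu]; exact (div_eq_zero_iff.1 h2).resolve_right hT0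
  · rw [hT u hu, h3]; field_simp

/-- The scaling factor of the unknown satisfies the equation `a' = α a`. -/
theorem IsPointTransformation.pdT_unknown (hΦ : IsPointTransformation E E' Φ) (hε : ε ≠ 0)
    (hE' : E'.IsConstantCoeff ε) (hn : E'.n = E.n) {t₀ : ℝ} (ht₀ : t₀ ∈ E.I) :
    pdT (fun z => (Φ z).2.2) (t₀, 0, 1) = E.α t₀ * (Φ (t₀, 0, 1)).2.2 := by
  have hone := one_mem_uRange E.n
  have hz : (t₀, 0, 1) ∈ E.dom := Equation.mem_dom.2 ⟨ht₀, hone⟩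
  obtain ⟨hXu, hXx, -⟩ := hΦ.space_pd hε hE' hz
  have hr : pdX (fun z => (Φ z).2.1) (t₀, 0, 1)
      + 0 * pdU (fun z => (Φ z).2.1) (t₀, 0, 1) ≠ 0 := by rwa [zero_mul, add_zero]
  -- The test function has u = 1, u_t = −α and is constant in x at t₀. Its image is constant in the
  -- new x near q, so the new equation gives v'_t = 0 and the tangency relation in t reduces to U_t
  -- = αU_u.
  obtain ⟨v, v', q, hv, hv', hq, -, e2, -, -, -, hzero, hHT, hHX, -⟩ :=
    hΦ.compare_testFn hε hE' (a := -E.α t₀) (b := 0) (d := 0) (c := 0)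
      (a' := -E.α t₀) (b' := 0) (d' := 0) (c' := 0) hz (by ring) (by ring) hr hr
  obtain ⟨hU, hXt, -⟩ := hΦ.unknown_eq hε hE' hn (x := 0) ht₀ hone
  obtain ⟨hTx, hTu⟩ := hΦ.time_pd hε hE' hz
  have hUx : pdX (fun z => (Φ z).2.2) (t₀, 0, 1) = 0 := by
    have h := hasDerivAt_pdX (F := fun z => (Φ z).2.2) (differentiableAt_of_contDiffOn E.isOpen_dom
      hΦ.smooth.snd.snd hz)
    simp only [(hΦ.unknown_eq hε hE' hn ht₀ hone).1] at h
    exact h.unique (hasDerivAt_const _ _)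
  rw [hΦ.pdU_pullback hε hE' hv' hz] at hHT hHX
  have hpX : pdX (pullback Φ v') (t₀, 0, 1)
      = -(pdX (fun z => (Φ z).2.1) (t₀, 0, 1) * dx v' q) := by
    rw [pdX, fderiv_pullback hΦ hv' hz, ← hq, fderiv_triple, fderiv_triple, fderiv_triple,
      hUx, hTx]
    ring
  have hpT : pdT (pullback Φ v') (t₀, 0, 1) = pdT (fun z => (Φ z).2.2) (t₀, 0, 1)
      - pdT (fun z => (Φ z).1) (t₀, 0, 1) * dt v' q := by
    rw [pdT, fderiv_pullback hΦ hv' hz, ← hq, fderiv_triple, fderiv_triple, fderiv_triple, hXt]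
    ring
  have hdx : dx v' q = 0 := by
    rw [hpX, zero_mul, add_zero, neg_eq_zero] at hHX
    exact (mul_eq_zero.1 hHX).resolve_left hXx
  set m := pdX (fun z => (Φ z).2.1) (t₀, 0, 1) with hmdef
  set χ : ℝ → ℝ := fun x => (Φ (t₀, 0, 1)).2.1 + m * (x - 0) with hχdef
  have hχ : HasDerivAt χ m 0 :=
    ((((hasDerivAt_id (0 : ℝ)).sub_const 0).const_mul m).const_add
      (Φ (t₀, 0, 1)).2.1).congr_deriv (mul_one m)
  have h5 := dx_five_sub_of_isLittleO hv' (contDiff_const (c := (0 : ℝ)))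
      (Φ (t₀, 0, 1)).2.2 0 0 0 hχ hXx (t := q.1) (by
    refine (isLittleO_zero _ _).congr' ?_ EventuallyEq.rfl
    filter_upwards [hzero] with x h2
    have p0 : testPoly 0 1 0 0 0 x = 1 := by simp [testPoly]
    have hX : (Φ (t₀, x, 1)).2.1 = χ x := by
      linear_combination (hΦ.space_eq hε hE' (x₁ := x) (x₂ := 0) ht₀ hone hone).1
    have hT : (Φ (t₀, x, 1)).1 = q.1 := by
      rw [hq]; exact hΦ.time_eq hε hE' ht₀ hone hone
    rw [p0, pullback, hX, hT, (hΦ.unknown_eq hε hE' hn ht₀ hone).1] at h2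
    rw [hU]
    linear_combination h2)
  have h0 : dx^[5] (fun _ : ℝ × ℝ => (0 : ℝ)) (q.1, χ 0) = 0 := by
    rw [dx_iterate_eq' contDiff_const]
    simp
  have hqq : q = (q.1, χ 0) := by rw [hq]; simp [hχdef]
  rw [h0, ← hqq, sub_zero, mul_zero] at h5
  rw [hdx, h5, mul_zero, mul_zero, add_zero, add_zero] at e2
  rw [hpT, e2] at hHT
  rw [hU]
  linear_combination hHT

/-- Eliminating T_t between βX_x⁵ = εT_t and a^n T_t = X_x gives βX_x⁴a^n = ε. As X_x does not
depend on t and a' = αa, the t-derivative of the left side is (β' + nαβ)X_x⁴a^n. -/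
theorem IsPointTransformation.isReducible (hΦ : IsPointTransformation E E' Φ) (hε : ε ≠ 0)
    (hE' : E'.IsConstantCoeff ε) (hn : E'.n = E.n) : E.IsReducible := by
  intro t ht
  have hone := one_mem_uRange E.n
  have hmem : ∀ s ∈ E.I, ∀ x, (s, x, 1) ∈ E.dom := fun s hs x => Equation.mem_dom.2 ⟨hs, hone⟩
  -- X_x and a are written as values of Φ at fixed (x, u), so that their t-derivatives follow from
  -- the known X_t and U_t without mixed second derivatives.
  have hm : ∀ s ∈ E.I, (Φ (s, 1, 1)).2.1 - (Φ (s, 0, 1)).2.1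
      = pdX (fun z => (Φ z).2.1) (s, 0, 1) := fun s hs => by
    simpa using (hΦ.space_eq hε hE' (x₁ := 1) (x₂ := 0) hs hone hone).1
  have hA : ∀ s ∈ E.I, (Φ (s, 0, 1)).2.2 = pdU (fun z => (Φ z).2.2) (s, 0, 1) := fun s hs => by
    simpa using (hΦ.unknown_eq hε hE' hn (x := 0) hs hone).1
  have hconst : ∀ s ∈ E.I, E.β s * ((Φ (s, 1, 1)).2.1 - (Φ (s, 0, 1)).2.1) ^ 4
      * (Φ (s, 0, 1)).2.2 ^ E.n = ε := by
    intro s hs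
    obtain ⟨-, hm0, h1⟩ := hΦ.space_pd hε hE' (hmem s hs 0)
    have h2 := (hΦ.unknown_eq hε hE' hn (x := 0) hs hone).2.2
    rw [hm s hs, hA s hs]
    refine mul_left_cancel₀ hm0 ?_
    linear_combination pdU (fun z => (Φ z).2.2) (s, 0, 1) ^ E.n * h1 + ε * h2
  have hXd : ∀ x, HasDerivAt (fun s => (Φ (s, x, 1)).2.1) 0 t := by
    intro x
    have h := hasDerivAt_pdT (F := fun z => (Φ z).2.1) (hΦ.differentiableAt_space (hmem t ht x))
    rwa [(hΦ.unknown_eq hε hE' hn ht hone).2.1] at h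
  have hUd : HasDerivAt (fun s => (Φ (s, 0, 1)).2.2) (E.α t * (Φ (t, 0, 1)).2.2) t := by
    rw [← hΦ.pdT_unknown hε hE' hn ht]
    exact hasDerivAt_pdT (F := fun z => (Φ z).2.2)
      (differentiableAt_of_contDiffOn E.isOpen_dom hΦ.smooth.snd.snd (hmem t ht 0))
  have hA0 : (Φ (t, 0, 1)).2.2 ≠ 0 := by
    rw [hA t ht]; exact (hΦ.rpow_unknown hε hE' (hmem t ht 0)).1
  have hd := (((E.hasDerivAt_β ht).fun_mul (((hXd 1).fun_sub (hXd 0)).fun_pow 4)).fun_mul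
    (hUd.rpow_const (p := E.n) (Or.inl hA0))).unique
    ((hasDerivAt_const t ε).congr_of_eventuallyEq (by
      filter_upwards [E.isOpen_I.mem_nhds ht] with s hs using hconst s hs))
  rw [Real.rpow_sub_one hA0] at hd
  have hc := hconst t ht
  have hne := hε
  rw [← hc] at hne
  have hM := right_ne_zero_of_mul (left_ne_zero_of_mul hne)
  have hP := right_ne_zero_of_mul hne
  refine (mul_eq_zero.1 (?_ : _ * (((Φ (t, 1, 1)).2.1 - (Φ (t, 0, 1)).2.1) ^ 4
      * (Φ (t, 0, 1)).2.2 ^ E.n) = 0)).resolve_right (mul_ne_zero hM hP)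
  field_simp at hd
  linear_combination hd

end PointTransformation

end FKdV

theorem proposition2 (E : FKdV.Equation) :
    List.TFAE
      [∃ g, E.IsLieSymmetryAlgebra g ∧ Module.finrank ℝ g = 3,
        ∃ g, E.IsMaximalLieSymmetryAlgebra g ∧ Module.finrank ℝ g = 3,
        ∃ (ε : ℝ) (E' : FKdV.Equation), ε ≠ 0 ∧ E'.n = E.n ∧ E'.IsConstantCoeff ε ∧
          FKdV.PointEquivalent E E'] := by
  tfae_have 1 → 3 := fun ⟨_, hg, h3⟩ =>
    (FKdV.Equation.isReducible_of_finrank hg.symmetry h3).exists_constantCoeff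
  tfae_have 3 → 2 := by
    rintro ⟨ε, E', hε, hn, hE', Φ, h1, h2, h3, h4, h5⟩
    -- Only the direction from solutions of the given equation to solutions of the
    -- constant-coefficient one is used.
    have hΦ : FKdV.IsPointTransformation E E' Φ :=
      ⟨h1, h2, h3, h4, fun u v hu hv p q hp hq he => (h5 u v hu hv p q hp hq he).1⟩
    exact (hΦ.isReducible hε hE' hn).exists_maximal
  tfae_have 2 → 1 := fun ⟨g, hg, h3⟩ => ⟨g, hg.toIsLieSymmetryAlgebra, h3⟩
  tfae_finish
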